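/- \textbf{Setting.} Let $R$ be a commutative ring containing $\mathbb{Q}$ and $\mathfrak g$ a Lie algebra over $R$ that is a free module with a finite basis $e_1,\dots,e_n$ and dual basis $e^1,\dots,e^n$; sums over repeated indices are understood. Let $r=r^{ij}e_i\otimes e_j=\tfrac12 r^{ij}e_i\wedge e_j\in\Lambda^2\mathfrak g$ be a non-degenerate $r$-matrix, i.e. the Schouten bracket satisfies $[\![r,r]\!]=0$ and $\mathfrak g^*\to\mathfrak g$, $\alpha\mapsto r^{ij}\alpha(e_j)e_i$, is bijective; let $\omega\in\Lambda^2\mathfrak g^*$ be its inverse, $r^{ij}\omega(e_j,e_k)=\delta^i_k$. Let $\nabla\colon\mathfrak g\times\mathfrak g\to\mathfrak g$, $(X,Y)\mapsto\nabla_XY$, be bilinear, torsion-free ($\nabla_XY-\nabla_YX=[X,Y]$) and symplectic ($\nabla_X\omega=0$), let $s=s^{ij}e_i\otimes e_j\in\mathrm{Sym}^2\mathfrak g$ satisfy $\nabla_Xs=0$ for all $X$, and let $\Omega\in t\,\Lambda^2\mathfrak g^*[[t]]$ be a formal series of two-forms closed for the Chevalley--Eilenberg differential. Put $\pi=r+s\in\mathfrak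 g\otimes\mathfrak g$. \textbf{The construction.} For an associative algebra $A$ on which $\mathfrak g$ acts by derivations (written $\triangleright$) let $A\otimes\mathcal W\otimes\Lambda^\bullet=\prod_{k\ge0}(A\otimes\mathrm{Sym}^k\mathfrak g^*\otimes\Lambda^\bullet\mathfrak g^*)[[t]]$, with undeformed product $\mu$ and the deformed product $a\circ b=\mu\circ e^{\frac t2\pi^{ij}\,i_s(e_i)\otimes i_s(e_j)}(a\otimes b)$, where $i_s,i_a$ are the symmetric and antisymmetric insertions; $\mathcal W\otimes\Lambda^\bullet$ is the case $A=R$. Let $\delta=e^i\wedge i_s(e_i)$, and let $\delta^{-1}$ be $\frac1{k+\ell}\,e^i\vee i_a(e_i)$ in symmetric degree $k$ and antisymmetric degree $\ell$ (zero if $k+\ell=0$); let $D=e^i\wedge\nabla_{e_i}$, let $L_A(\xi\otimes f\otimes\alpha)=e_i\triangleright\xi\otimes f\otimes e^i\wedge\alpha$, and let $\sigma$ be the projection onto symmetric and antisymmetric degree $0$. Let $\mathcal R=\tfrac14\,\omega(e_k,\tilde R(e_i,e_j)e_l)\,e^k\vee e^l\otimes e^i\wedge e^j$ with $\tilde R(X,Y)=[\nabla_X,\nabla_Y]-\nabla_{[X,Y]}$.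 The total degree is the symmetric degree plus twice the $t$-degree, and brackets of operators and elements below are graded commutators with respect to the antisymmetric degree, with $\mathrm{ad}(\varrho)=[\varrho,\cdot\,]$ formed with $\circ$. \textbf{Theorem.} There is a unique $\varrho\in\mathcal W\otimes\Lambda^1$ all of whose components have total degree at least $2$ such that $$\delta\varrho=\mathcal R+D\varrho+\tfrac1t\,\varrho\circ\varrho+\Omega,\qquad \delta^{-1}\varrho=0.$$ For $\xi\in A[[t]]$ set $\tau_A(\xi)=\sum_{k\ge0}\bigl[\delta^{-1},\,D+L_A+\tfrac1t\mathrm{ad}(\varrho)\bigr]^k\xi$, and set $\xi\star\eta=\sigma(\tau_A(\xi)\circ\tau_A(\eta))$ (the universal deformation formula). Take $A=T^\bullet(U(\mathfrak g))$, the tensor algebra of the universal enveloping algebra, on which $X\in\mathfrak g$ acts by the derivation extending left multiplication by $X$ on $U(\mathfrak g)$, and let $1\in U(\mathfrak g)=T^1(U(\mathfrak g))$ be the unit of $U(\mathfrak g)$. Then $F=1\star1$ lies in $T^2(U(\mathfrak g))[[t]]=(U(\mathfrak g)\otimes U(\mathfrak g))[[t]]$ and is a formal Drinfel'd twist: it is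 invertible, $$(\Delta\otimes\mathrm{id})(F)\,(F\otimes1)=(\mathrm{id}\otimes\Delta)(F)\,(1\otimes F),\qquad(\epsilon\otimes\mathrm{id})F=1=(\mathrm{id}\otimes\epsilon)F,$$ with $\Delta,\epsilon$ the coproduct and counit of $U(\mathfrak g)$, and $F=1\otimes1+O(t)$. Moreover $$1\star1=1\otimes1+\tfrac t2\,\pi+O(t^2).$$ -/

import Mathlib

open scoped TensorProduct

noncomputable section

namespace Fedosov

attribute [local instance 100] LieRing.ofAssociativeRing

/-! ### Tensors on a Lie algebra with a chosen finite basis -/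

section Tensors

variable {R g : Type*} [CommRing R] [Algebra ℚ R] [LieRing g] [LieAlgebra R g]

/-- The rational number `q`, viewed in the ground ring. -/
abbrev rat (R : Type*) [CommRing R] [Algebra ℚ R] (q : ℚ) : R := algebraMap ℚ R q

/-- Antisymmetric elements of `g ⊗ g`, i.e. bivectors: the bivector `x ∧ y` is
`x ⊗ y - y ⊗ x`. -/
def IsAntisymm (p : g ⊗[R] g) : Prop := TensorProduct.comm R g g p = -p

/-- Symmetric elements of `g ⊗ g`, i.e. symmetric bivectors. -/
def IsSymm (p : g ⊗[R] g) : Prop := TensorProduct.comm R g g p = p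

/-- The musical map `g* → g`, pairing with the tensor `p`: `α ↦ p^{ij} α(e_j) e_i`. -/
def sharp (p : g ⊗[R] g) (α : Module.Dual R g) : g :=
  TensorProduct.rid R g (LinearMap.lTensor g α p)

variable {n : ℕ} (b : Module.Basis (Fin n) R g)

/-- The coefficients `p^{ij}` in `p = p^{ij} e_i ⊗ e_j`. -/
def coords (p : g ⊗[R] g) : Matrix (Fin n) (Fin n) R :=
  fun i j => (b.tensorProduct b).repr p (i, j)

/-- The Schouten bracket `⟦x ∧ y, z ∧ w⟧` of decomposable bivectors. -/
def schoutenDec (R : Type*) {g : Type*} [CommRing R] [LieRing g] [LieAlgebra R g]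
    (x y z w : g) : ExteriorAlgebra R g :=
  ExteriorAlgebra.ι R ⁅x, z⁆ * ExteriorAlgebra.ι R y * ExteriorAlgebra.ι R w
  - ExteriorAlgebra.ι R ⁅x, w⁆ * ExteriorAlgebra.ι R y * ExteriorAlgebra.ι R z
  - ExteriorAlgebra.ι R ⁅y, z⁆ * ExteriorAlgebra.ι R x * ExteriorAlgebra.ι R w
  + ExteriorAlgebra.ι R ⁅y, w⁆ * ExteriorAlgebra.ι R x * ExteriorAlgebra.ι R z

/-- The Schouten bracket of two bivectors `p = ½ p^{ij} e_i ∧ e_j` and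
`q = ½ q^{kl} e_k ∧ e_l`. -/
def schouten (p q : g ⊗[R] g) : ExteriorAlgebra R g :=
  ∑ i, ∑ j, ∑ k, ∑ l, (rat R (1 / 4) * coords b p i j * coords b q k l) •
    schoutenDec R (b i) (b j) (b k) (b l)

/-- A non-degenerate (classical) `r`-matrix. -/
structure IsNondegRMatrix (r : g ⊗[R] g) : Prop where
  antisymm : IsAntisymm r
  schouten_self : schouten b r r = 0
  nondeg : Function.Bijective (sharp r)

/-- The inverse two-form `ω` of `r`, with `r^{ij} ω(e_j, e_k) = δ^i_k`. -/
def omega (r : g ⊗[R] g) (X Y : g) : R :=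
  ∑ i, ∑ j, (coords b r)⁻¹ i j * b.coord i X * b.coord j Y

/-- A torsion-free covariant derivative `∇` that is symplectic for `r`, i.e. `∇_X ω = 0`. -/
structure IsSymplecticTorsionFree (r : g ⊗[R] g) (nab : g →ₗ[R] g →ₗ[R] g) : Prop where
  torsion_free : ∀ X Y : g, nab X Y - nab Y X - ⁅X, Y⁆ = 0
  symplectic : ∀ X Y Z : g, omega b r (nab X Y) Z + omega b r Y (nab X Z) = 0

/-- `∇_X s = 0` for all `X`, where `∇_X` acts on `g ⊗ g` as a derivation. -/
def IsCovConst (nab : g →ₗ[R] g →ₗ[R] g) (s : g ⊗[R] g) : Prop :=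
  ∀ X : g, LinearMap.rTensor g (nab X) s + LinearMap.lTensor g (nab X) s = 0

/-- Christoffel symbols `Γ_{ij}^k = e^k(∇_{e_i} e_j)`. -/
def christoffel (nab : g →ₗ[R] g →ₗ[R] g) (i j k : Fin n) : R := b.coord k (nab (b i) (b j))

/-- The curvature operator `∇_X ∇_Y Z - ∇_Y ∇_X Z - ∇_{[X,Y]} Z`. -/
def curvOp (nab : g →ₗ[R] g →ₗ[R] g) (X Y Z : g) : g :=
  nab X (nab Y Z) - nab Y (nab X Z) - nab ⁅X, Y⁆ Z

/-- The curvature tensor `R(Z, U, X, Y) = ω(Z, R̃(X, Y) U)`. -/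
def curvTensor (r : g ⊗[R] g) (nab : g →ₗ[R] g →ₗ[R] g) (Z U X Y : g) : R :=
  omega b r Z (curvOp nab X Y U)

end Tensors

/-! ### Forms and the Chevalley-Eilenberg differential -/

section Forms

variable {R g : Type*} [CommRing R] [Algebra ℚ R] [LieRing g] [LieAlgebra R g]

/-- The Grassmann algebra `Λ^• g*`. -/
abbrev Forms (R g : Type*) [CommRing R] [LieRing g] [LieAlgebra R g] :=
  ExteriorAlgebra R (Module.Dual R g)

/-- The antisymmetric insertion `i_a(X)`: the antiderivation of `Λ^• g*` with `α ↦ α(X)`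
on `g*`. -/
def insForm (X : g) : Forms R g →ₗ[R] Forms R g :=
  CliffordAlgebra.contractLeft (Module.Dual.eval R g X)

/-- The projection of `Λ^• g*` onto `Λ^ℓ g*`. -/
def projForm (l : ℕ) : Forms R g →ₗ[R] Forms R g :=
  GradedAlgebra.proj (fun i : ℕ => ⋀[R]^i (Module.Dual R g)) l

/-- The sign `α ↦ (-1)^ℓ α` for `α ∈ Λ^ℓ g*`. -/
def signForm : Forms R g →ₗ[R] Forms R g := CliffordAlgebra.involute.toLinearMap

variable {n : ℕ} (b : Module.Basis (Fin n) R g)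

/-- The dual basis vector `e^i`, as a one-form. -/
def dualVec (i : Fin n) : Forms R g := ExteriorAlgebra.ι R (b.coord i)

/-- The Chevalley-Eilenberg differential `δ_CE`: the antiderivation of `Λ^• g*` determined by
`δ_CE e^k = -½ C_{ij}^k e^i ∧ e^j`, written as `α ↦ ∑_k (δ_CE e^k) ∧ i_a(e_k) α`. -/
def deltaCE (α : Forms R g) : Forms R g :=
  ∑ k, (∑ i, ∑ j, (-(rat R (1 / 2)) * b.coord k ⁅b i, b j⁆) • (dualVec b i * dualVec b j)) *
    insForm (b k) α

/-- `Ω ∈ t Λ² g*[[t]]` is a formal series of `δ_CE`-closed two-forms. -/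
structure IsClosedSeries (Om : PowerSeries (Forms R g)) : Prop where
  coeff_zero : PowerSeries.coeff 0 Om = 0
  two_form : ∀ m, PowerSeries.coeff m Om ∈ ⋀[R]^2 (Module.Dual R g)
  closed : ∀ m, deltaCE b (PowerSeries.coeff m Om) = 0

end Forms

/-! ### The (enlarged) Fedosov algebra

The symmetric powers `Sym^k g*` are spanned by the monomials of degree `k` in `y^1, …, y^n`, where
`y^i` is `e^i` seen in `Sym^1 g*`. -/

section Algebra

variable {R g : Type*} [CommRing R] [Algebra ℚ R] [LieRing g] [LieAlgebra R g]

/-- `A ⊗ Λ^• g*`; the product is `(ξ ⊗ α) (η ⊗ β) = ξ η ⊗ α ∧ β`. -/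
abbrev Cf (R g A : Type*) [CommRing R] [LieRing g] [LieAlgebra R g] [Ring A] [Algebra R A] :=
  A ⊗[R] Forms R g

/-- The enlarged Fedosov algebra
`A ⊗ W ⊗ Λ^• = ∏_k (A ⊗ Sym^k g* ⊗ Λ^• g*) [[t]]`, with its undeformed product `μ`. The formal Weyl
algebra `W ⊗ Λ^•` is the case `A = R`. -/
abbrev Fed (R g : Type*) (n : ℕ) (A : Type*) [CommRing R] [LieRing g] [LieAlgebra R g]
    [Ring A] [Algebra R A] :=
  PowerSeries (MvPowerSeries (Fin n) (Cf R g A))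

variable {n : ℕ} {A : Type*} [Ring A] [Algebra R A]

/-- The coefficient in `A ⊗ Λ^•` of `t^m y^κ`. -/
def cf (m : ℕ) (κ : Fin n →₀ ℕ) (a : Fed R g n A) : Cf R g A :=
  MvPowerSeries.coeff κ (PowerSeries.coeff m a)

/-- The element with prescribed coefficients. -/
def mkFed (c : ℕ → (Fin n →₀ ℕ) → Cf R g A) : Fed R g n A :=
  PowerSeries.mk fun m => (fun κ => c m κ : MvPowerSeries (Fin n) (Cf R g A))

/-- A linear operator on `A ⊗ Λ^•`, extended to `A ⊗ W ⊗ Λ^•`. -/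
def mapCf (f : Cf R g A →ₗ[R] Cf R g A) (a : Fed R g n A) : Fed R g n A :=
  mkFed fun m κ => f (cf m κ a)

/-- An element of `A ⊗ Λ^•` as an element of `A ⊗ W ⊗ Λ^•`. -/
def const (c : Cf R g A) : Fed R g n A := PowerSeries.C (MvPowerSeries.C c)

/-- The extension of `a ∈ W ⊗ Λ^•` to `1 ⊗ a ∈ A ⊗ W ⊗ Λ^•`. -/
def extend (A : Type*) [Ring A] [Algebra R A] (a : Fed R g n R) : Fed R g n A :=
  PowerSeries.map (MvPowerSeries.map
    (Algebra.TensorProduct.map (Algebra.ofId R A) (AlgHom.id R (Forms R g))).toRingHom) a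

/-- A formal series of forms as an element of `W ⊗ Λ^•`. -/
def ofForms (Om : PowerSeries (Forms R g)) : Fed R g n R :=
  PowerSeries.map (MvPowerSeries.C.comp
    (Algebra.TensorProduct.includeRight : Forms R g →ₐ[R] Cf R g R).toRingHom) Om

/-- `ξ ↦ ξ ⊗ 1 ⊗ 1`. -/
def incl (ξ : PowerSeries A) : Fed R g n A :=
  PowerSeries.map (MvPowerSeries.C.comp
    (Algebra.TensorProduct.includeLeft : A →ₐ[R] Cf R g A).toRingHom) ξ

/-- The projection `σ` on symmetric and antisymmetric degree zero, with values in `A[[t]]`. -/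
def sigma (a : Fed R g n A) : PowerSeries A :=
  PowerSeries.mk fun m => TensorProduct.rid R A
    (LinearMap.lTensor A ExteriorAlgebra.algebraMapInv.toLinearMap (cf m 0 a))

/-- Multiplication by `y^i = e^i ∈ Sym^1 g*`. -/
def symMul (i : Fin n) (a : Fed R g n A) : Fed R g n A :=
  PowerSeries.C (MvPowerSeries.X i) * a

/-- The symmetric insertion `i_s(e_i)`, i.e. the partial derivative in `y^i`. -/
def insSym (i : Fin n) (a : Fed R g n A) : Fed R g n A :=
  mkFed fun m κ => (κ i + 1) • cf m (κ + Finsupp.single i 1) a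

/-- The projection on antisymmetric degree `ℓ`. -/
def projA (l : ℕ) (a : Fed R g n A) : Fed R g n A :=
  mapCf (LinearMap.lTensor A (projForm l)) a

/-- The sign `(-1)^ℓ` in antisymmetric degree `ℓ`. -/
def signA (a : Fed R g n A) : Fed R g n A := mapCf (LinearMap.lTensor A signForm) a

/-- Division by `t` of a series without term of order zero in `t`. -/
def divT (a : Fed R g n A) : Fed R g n A :=
  PowerSeries.mk fun m => PowerSeries.coeff (m + 1) a

/-- `a ∈ W_k ⊗ Λ^•`: all components of total degree `Deg = deg_s + 2 deg_t` below `k` vanish. -/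
def InFiltration (k : ℕ) (a : Fed R g n A) : Prop :=
  ∀ m κ, 2 * m + κ.degree < k → cf m κ a = 0

/-- `μ ∘ P^N (a ⊗ b')` with `P = p^{ij} i_s(e_i) ⊗ i_s(e_j)`. -/
def moyalTerm (p : Matrix (Fin n) (Fin n) R) : ℕ → Fed R g n A → Fed R g n A → Fed R g n A
  | 0, a, a' => a * a'
  | N + 1, a, a' => ∑ i, ∑ j, p i j • moyalTerm p N (insSym i a) (insSym j a')

/-- The deformed product `μ ∘ exp((t/2) P)`: the coefficient of `t^m` collects the terms
`t^N / (2^N N!) μ ∘ P^N` with `N ≤ m`. -/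
def circ (p : Matrix (Fin n) (Fin n) R) (a a' : Fed R g n A) : Fed R g n A :=
  PowerSeries.mk fun m => ∑ N ∈ Finset.range (m + 1),
    rat R (1 / (2 ^ N * N.factorial)) • PowerSeries.coeff (m - N) (moyalTerm p N a a')

/-- `(1/t) ad(x)` for `x` of antisymmetric degree one: `a ↦ (x ∘ a - (-1)^ℓ a ∘ x) / t`
for `a` of antisymmetric degree `ℓ`. -/
def adOverT (p : Matrix (Fin n) (Fin n) R) (x a : Fed R g n A) : Fed R g n A :=
  divT (circ p x a - circ p (signA a) x)

variable (b : Module.Basis (Fin n) R g)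

/-- Left multiplication by `e^i ∈ Λ^1 g*`. -/
def wedge (i : Fin n) (a : Fed R g n A) : Fed R g n A :=
  const ((1 : A) ⊗ₜ[R] dualVec b i) * a

/-- The antisymmetric insertion `i_a(e_i)`. -/
def insAnti (i : Fin n) (a : Fed R g n A) : Fed R g n A :=
  mapCf (LinearMap.lTensor A (insForm (b i))) a

/-- `δ = e^i ∧ i_s(e_i)`. -/
def delta (a : Fed R g n A) : Fed R g n A := ∑ i, wedge b i (insSym i a)

/-- `δ^* = e^i ∨ i_a(e_i)`. -/
def deltaStar (a : Fed R g n A) : Fed R g n A := ∑ i, symMul i (insAnti b i a)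

/-- Division by `k + ℓ` in symmetric degree `k` and antisymmetric degree `ℓ`, and zero for
`k + ℓ = 0`. -/
def divDeg (a : Fed R g n A) : Fed R g n A :=
  mkFed fun m κ => ∑ l ∈ Finset.range (n + 1),
    (if κ.degree + l = 0 then (0 : R) else rat R (1 / ((κ.degree + l : ℕ) : ℚ))) •
      cf m κ (projA l a)

/-- `δ^{-1}`, i.e. `δ^* / (k + ℓ)` in symmetric degree `k` and antisymmetric degree `ℓ`. -/
def deltaInv (a : Fed R g n A) : Fed R g n A := deltaStar b (divDeg a)

/-- `∇_{e_i}` on `A ⊗ W ⊗ Λ^•`: trivial on `A`, the derivation of both the symmetric and the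
antisymmetric factor extending `∇_{e_i} e^k = -Γ_{ij}^k e^j`. -/
def nabla (nab : g →ₗ[R] g →ₗ[R] g) (i : Fin n) (a : Fed R g n A) : Fed R g n A :=
  -∑ j, ∑ k, christoffel b nab i j k •
    (symMul j (insSym k a) + wedge b j (insAnti b k a))

/-- `D = e^i ∧ ∇_{e_i}`. -/
def covD (nab : g →ₗ[R] g →ₗ[R] g) (a : Fed R g n A) : Fed R g n A :=
  ∑ i, wedge b i (nabla b nab i a)

/-- The curvature `R = ¼ R(e_k, e_l, e_i, e_j) e^k ∨ e^l ⊗ e^i ∧ e^j ∈ W ⊗ Λ^2`. -/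
def curvature (r : g ⊗[R] g) (nab : g →ₗ[R] g →ₗ[R] g) : Fed R g n R :=
  ∑ k, ∑ l, ∑ i, ∑ j, (rat R (1 / 4) * curvTensor b r nab (b k) (b l) (b i) (b j)) •
    symMul k (symMul l (wedge b i (wedge b j 1)))

/-- The defining properties of the element `ϱ ∈ W_2 ⊗ Λ^1` of Fedosov's construction:
`δϱ = R + Dϱ + (1/t) ϱ ∘ ϱ + Ω` and `δ^{-1} ϱ = 0`. -/
structure IsFedosovElement (r s : g ⊗[R] g) (nab : g →ₗ[R] g →ₗ[R] g)
    (Om : PowerSeries (Forms R g)) (x : Fed R g n R) : Prop where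
  filtration : InFiltration 2 x
  one_form : projA 1 x = x
  equation : delta b x = curvature b r nab + covD b nab x
    + divT (circ (coords b (r + s)) x x) + ofForms Om
  normalization : deltaInv b x = 0

end Algebra

/-! ### The universal deformation formula -/

section UDF

/-- An action of the Lie algebra `g` on the algebra `A` by derivations. -/
structure DerivationAction (R g A : Type*) [CommRing R] [LieRing g] [LieAlgebra R g]
    [Ring A] [Algebra R A] where
  act : g →ₗ[R] A →ₗ[R] A
  act_lie : ∀ (X Y : g) (a : A), act ⁅X, Y⁆ a = act X (act Y a) - act Y (act X a)
  leibniz : ∀ (X : g) (a a' : A), act X (a * a') = act X a * a' + a * act X a'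

variable {R g : Type*} [CommRing R] [Algebra ℚ R] [LieRing g] [LieAlgebra R g]
variable {n : ℕ} (b : Module.Basis (Fin n) R g)
variable {A : Type*} [Ring A] [Algebra R A] (T : DerivationAction R g A)

/-- `L_A (ξ ⊗ f ⊗ α) = e_i ▷ ξ ⊗ f ⊗ e^i ∧ α`. -/
def leftOp (a : Fed R g n A) : Fed R g n A :=
  ∑ i, wedge b i (mapCf (LinearMap.rTensor (Forms R g) (T.act (b i))) a)

variable (r s : g ⊗[R] g) (nab : g →ₗ[R] g →ₗ[R] g) (x : Fed R g n R)

/-- `D + L_A + (1/t) ad(ϱ)`. -/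
def perturbation (a : Fed R g n A) : Fed R g n A :=
  covD b nab a + leftOp b T a + adOverT (coords b (r + s)) (extend A x) a

/-- The graded commutator `[δ^{-1}, D + L_A + (1/t) ad(ϱ)]` of two operators of odd degree. -/
def tauStep (a : Fed R g n A) : Fed R g n A :=
  deltaInv b (perturbation b T r s nab x a) + perturbation b T r s nab x (deltaInv b a)

/-- The Fedosov-Taylor series `τ_A(ξ) = ∑_k [δ^{-1}, D + L_A + (1/t) ad(ϱ)]^k ξ`. The operator
raises the total degree, so that each coefficient is a sum with finitely many non-zero terms. -/
def tau (ξ : PowerSeries A) : Fed R g n A :=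
  mkFed fun m κ => ∑ᶠ k : ℕ, cf m κ ((tauStep b T r s nab x)^[k] (incl ξ))

/-- The universal deformation formula `ξ ⋆ η = σ(τ(ξ) ∘ τ(η))` on `A[[t]]`. -/
def star (ξ η : PowerSeries A) : PowerSeries A :=
  sigma (circ (coords b (r + s)) (tau b T r s nab x ξ) (tau b T r s nab x η))

end UDF

/-! ### The tensor algebra of `U(g)` -/

section TensorAlg

/-- The algebra map `a ↦ a + ε D(a)` for the derivation `D` of the tensor algebra extending `f`. -/
def derLift {R M : Type*} [CommRing R] [AddCommGroup M] [Module R M] (f : M →ₗ[R] M) :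
    TensorAlgebra R M →ₐ[R] TrivSqZeroExt (TensorAlgebra R M) (TensorAlgebra R M) :=
  TensorAlgebra.lift R
    ((TrivSqZeroExt.inlAlgHom R (TensorAlgebra R M) (TensorAlgebra R M)).toLinearMap ∘ₗ
        TensorAlgebra.ι R
      + ((TrivSqZeroExt.inrHom (TensorAlgebra R M) (TensorAlgebra R M)).restrictScalars R) ∘ₗ
        TensorAlgebra.ι R ∘ₗ f)

/-- The derivation of the tensor algebra `T(M)` extending the linear map `f : M → M`. -/
def der {R M : Type*} [CommRing R] [AddCommGroup M] [Module R M] (f : M →ₗ[R] M) :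
    TensorAlgebra R M →ₗ[R] TensorAlgebra R M :=
  ((TrivSqZeroExt.sndHom (TensorAlgebra R M) (TensorAlgebra R M)).restrictScalars R) ∘ₗ
    (derLift f).toLinearMap

section
variable {R M : Type*} [CommRing R] [AddCommGroup M] [Module R M]

theorem derLift_fst (f : M →ₗ[R] M) (a : TensorAlgebra R M) : (derLift f a).fst = a := by
  have h : (TrivSqZeroExt.fstHom R (TensorAlgebra R M) (TensorAlgebra R M)).comp (derLift f)
      = AlgHom.id R _ := by
    ext m; simp [derLift]
  exact DFunLike.congr_fun h a

theorem der_ι (f : M →ₗ[R] M) (m : M) :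
    der f (TensorAlgebra.ι R m) = TensorAlgebra.ι R (f m) := by
  simp [der, derLift]

theorem der_mul (f : M →ₗ[R] M) (a a' : TensorAlgebra R M) :
    der f (a * a') = der f a * a' + a * der f a' := by
  simp [der, TrivSqZeroExt.snd_mul, derLift_fst, add_comm]

theorem der_algebraMap (f : M →ₗ[R] M) (c : R) :
    der f (algebraMap R (TensorAlgebra R M) c) = 0 := by
  simp [der, TrivSqZeroExt.algebraMap_eq_inl']

/-- Uniqueness of derivations with given values on generators. -/
theorem eq_zero_of_leibniz (h : TensorAlgebra R M →ₗ[R] TensorAlgebra R M)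
    (hc : ∀ c, h (algebraMap R _ c) = 0) (hm : ∀ m, h (TensorAlgebra.ι R m) = 0)
    (hl : ∀ a a', h (a * a') = h a * a' + a * h a') (a : TensorAlgebra R M) : h a = 0 := by
  induction a using TensorAlgebra.induction with
  | algebraMap c => exact hc c
  | ι m => exact hm m
  | mul a a' h1 h2 => simp [hl, h1, h2]
  | add a a' h1 h2 => simp [h1, h2]

end

variable (R g : Type*) [CommRing R] [LieRing g] [LieAlgebra R g]

/-- The universal enveloping algebra. -/
abbrev U := UniversalEnvelopingAlgebra R g

variable {g} in
/-- Left multiplication by `X ∈ g` on `U(g)`. -/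
def leftMul (X : g) : U R g →ₗ[R] U R g :=
  LinearMap.mulLeft R (UniversalEnvelopingAlgebra.ι R X)

/-- The action of `g` on `T(U(g))` by derivations that extends left multiplication on `U(g)`. -/
def tensorAction : DerivationAction R g (TensorAlgebra R (U R g)) where
  act :=
    { toFun := fun X => der (leftMul R X)
      map_add' := fun X Y => by
        ext a
        refine sub_eq_zero.1 (eq_zero_of_leibniz
          (der (leftMul R (X + Y)) - (der (leftMul R X) + der (leftMul R Y))) ?_ ?_ ?_ a)
        · intro c; simp [der_algebraMap]
        · intro m; simp [der_ι, leftMul, add_mul]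
        · intro a a'; simp only [LinearMap.sub_apply, LinearMap.add_apply, der_mul]; noncomm_ring
      map_smul' := fun c X => by
        ext a
        refine sub_eq_zero.1 (eq_zero_of_leibniz
          (der (leftMul R (c • X)) - c • der (leftMul R X)) ?_ ?_ ?_ a)
        · intro c; simp [der_algebraMap]
        · intro m; simp [der_ι, leftMul]
        · intro a a'
          simp only [LinearMap.sub_apply, LinearMap.smul_apply, der_mul, smul_add,
            sub_mul, mul_sub, smul_mul_assoc, mul_smul_comm]
          abel }
  act_lie := fun X Y a => by
    refine sub_eq_zero.1 (eq_zero_of_leibniz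
      (der (leftMul R ⁅X, Y⁆) - (der (leftMul R X) ∘ₗ der (leftMul R Y)
        - der (leftMul R Y) ∘ₗ der (leftMul R X))) ?_ ?_ ?_ a)
    · intro c; simp [der_algebraMap]
    · intro m
      simp [der_ι, leftMul, LieRing.of_associative_ring_bracket, sub_mul, mul_assoc]
    · intro a a'
      simp only [LinearMap.sub_apply, LinearMap.comp_apply, der_mul, map_add]; noncomm_ring
  leibniz := fun X a a' => der_mul _ a a'

/-- The element `1 ∈ U(g)`, seen in tensor degree one of `T(U(g))[[t]]`. It is not the unit of
the tensor algebra. -/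
def oneT : PowerSeries (TensorAlgebra R (U R g)) :=
  PowerSeries.C (TensorAlgebra.ι R (1 : U R g))

/-- The inclusion `U(g) ⊗ U(g) → T(U(g))` as the elements of tensor degree two. -/
def tensorTwo : U R g ⊗[R] U R g →ₗ[R] TensorAlgebra R (U R g) :=
  LinearMap.mul' R _ ∘ₗ TensorProduct.map (TensorAlgebra.ι R) (TensorAlgebra.ι R)

end TensorAlg

/-! ### Drinfel'd twists -/

section Twist

variable (R g : Type*) [CommRing R] [LieRing g] [LieAlgebra R g]

/-- The coproduct of `U(g)`, with `Δ(X) = X ⊗ 1 + 1 ⊗ X` for `X ∈ g`. -/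
def comul : U R g →ₐ[R] U R g ⊗[R] U R g :=
  UniversalEnvelopingAlgebra.lift R
    { toFun := fun X => UniversalEnvelopingAlgebra.ι R X ⊗ₜ[R] (1 : U R g)
        + (1 : U R g) ⊗ₜ[R] UniversalEnvelopingAlgebra.ι R X
      map_add' := fun X Y => by
        simp only [map_add, TensorProduct.add_tmul, TensorProduct.tmul_add]; abel
      map_smul' := fun c X => by
        simp [TensorProduct.smul_tmul']
      map_lie' := fun {X Y} => by
        simp only [LieHom.map_lie, LieRing.of_associative_ring_bracket, mul_add, add_mul,
          Algebra.TensorProduct.tmul_mul_tmul, mul_one, one_mul, TensorProduct.sub_tmul,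
          TensorProduct.tmul_sub]
        abel }

/-- The counit of `U(g)`, with `ε(X) = 0` for `X ∈ g`. -/
def counit : U R g →ₐ[R] R := UniversalEnvelopingAlgebra.lift R (0 : g →ₗ⁅R⁆ R)

/-- `Δ ⊗ id`. -/
def comulLeft : U R g ⊗[R] U R g →ₐ[R] (U R g ⊗[R] U R g) ⊗[R] U R g :=
  Algebra.TensorProduct.map (comul R g) (AlgHom.id R _)

/-- `U ⊗ (U ⊗ U) ≃ (U ⊗ U) ⊗ U`. -/
def reassoc : U R g ⊗[R] (U R g ⊗[R] U R g) →ₐ[R] (U R g ⊗[R] U R g) ⊗[R] U R g :=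
  (Algebra.TensorProduct.assoc R R R (U R g) (U R g) (U R g)).symm.toAlgHom

/-- `id ⊗ Δ`. -/
def comulRight : U R g ⊗[R] U R g →ₐ[R] (U R g ⊗[R] U R g) ⊗[R] U R g :=
  (reassoc R g).comp (Algebra.TensorProduct.map (AlgHom.id R _) (comul R g))

/-- `F ↦ F ⊗ 1`. -/
def tensorOne : U R g ⊗[R] U R g →ₐ[R] (U R g ⊗[R] U R g) ⊗[R] U R g :=
  Algebra.TensorProduct.includeLeft

/-- `F ↦ 1 ⊗ F`. -/
def oneTensor : U R g ⊗[R] U R g →ₐ[R] (U R g ⊗[R] U R g) ⊗[R] U R g :=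
  (reassoc R g).comp Algebra.TensorProduct.includeRight

/-- `ε ⊗ id`. -/
def counitLeft : U R g ⊗[R] U R g →ₐ[R] U R g :=
  (Algebra.TensorProduct.lid R (U R g)).toAlgHom.comp
    (Algebra.TensorProduct.map (counit R g) (AlgHom.id R _))

/-- `id ⊗ ε`. -/
def counitRight : U R g ⊗[R] U R g →ₐ[R] U R g :=
  (Algebra.TensorProduct.rid R R (U R g)).toAlgHom.comp
    (Algebra.TensorProduct.map (AlgHom.id R _) (counit R g))

variable {R g}

/-- The extension of an algebra map to formal power series, coefficient by coefficient. -/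
abbrev ext {B C : Type*} [Ring B] [Algebra R B] [Ring C] [Algebra R C] (f : B →ₐ[R] C) :
    PowerSeries B →+* PowerSeries C :=
  PowerSeries.map f.toRingHom

/-- Formal Drinfel'd twists. -/
structure IsTwist (F : PowerSeries (U R g ⊗[R] U R g)) : Prop where
  isUnit : IsUnit F
  cocycle : ext (comulLeft R g) F * ext (tensorOne R g) F
    = ext (comulRight R g) F * ext (oneTensor R g) F
  counit_left : ext (counitLeft R g) F = 1
  counit_right : ext (counitRight R g) F = 1
  coeff_zero : PowerSeries.coeff 0 F = (1 : U R g) ⊗ₜ[R] (1 : U R g)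

/-- The inclusion `g ⊗ g → U(g) ⊗ U(g)`. -/
def gg : g ⊗[R] g →ₗ[R] U R g ⊗[R] U R g :=
  TensorProduct.map (UniversalEnvelopingAlgebra.ι R : g →ₗ⁅R⁆ U R g).toLinearMap
    (UniversalEnvelopingAlgebra.ι R : g →ₗ⁅R⁆ U R g).toLinearMap

end Twist

end Fedosov

end

open scoped TensorProduct

noncomputable section

set_option linter.unusedSectionVars false

/-! This is Fedosov's method, carried out algebraically on `Fed`. Every operator is built from
multiplication by `y^i` and `e^i`, the insertions `i_s(e_i)` and `i_a(e_i)`, the sign, and maps of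
the coefficients in `A`. The product `circL` is the exponential of a bidifferential operator with
constant coefficients; the three operators it induces on triples commute, which gives `circ_assoc`.
Two tools carry the argument. The Koszul operator `δ` has the homotopy `δ⁻¹`, with `δ δ⁻¹ + δ⁻¹ δ =
1 - P` (`hodge`), where `P` projects on symmetric and antisymmetric degree zero. The total degree is
a complete filtration in which `δ⁻¹` raises the degree by one, while `D`, `L_A` and `(1/t) ad(ϱ)` do
not lower it. Hence fixed point equations through `δ⁻¹` are uniquely solvable, and an element
reproduced by `δ⁻¹` after one of these operators vanishes. The element `ϱ` is the fixed point of `x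
↦ δ⁻¹(R + Dx + (1/t) x ∘ x + Ω)`. The defect `B` of Fedosov's equation satisfies `δB = DB - (1/t)[B,
ϱ]` and `δ⁻¹B = 0`, so it vanishes (`exists_fedosovElement`). The inputs are `ad(R) = t D²`
(`curvEl_bracket`), `δR = 0`, `DR = 0` and `DΩ = 0`. Consequently `-δ + D + L_A + (1/t) ad(ϱ)` is an
antiderivation of `∘` with square zero (`opFed_opFed`). Its kernel in form degree zero is a
subalgebra on which `σ` is bijective onto `A[[t]]`, with inverse `τ` (`opFed_tau`,
`tau_sigma_of_flat`). So `⋆` is a transported product: it is associative and has the unit of `A` as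
unit. For the twist, `τ` commutes with every linear map of `A` that commutes with the action of `g`
(`tau_map`). For `a` in `T(U(g))`, projecting to tensor degree one and applying `u ↦ u ▷ a` is such
a map and carries the unit of `U(g)` to `a`. Hence `a ⋆ a'` arises by letting `F` act on `a ⊗ a'`
(`coeff_star_C`). A derivation action turns products into coproducts, so `(1 ⋆ 1) ⋆ 1 = 1 ⋆ (1 ⋆ 1)`
becomes the cocycle identity after injecting into tensor degree three (`tensorThree_injective`); the
unit of `T(U(g))` gives the counit identities. The first order term follows from `τ(c) = c + y^i
(e_i ▷ c)` up to total degree two. -/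

namespace Fedosov

section

open Finset.HasAntidiagonal (antidiagonal)

/-! ### Coefficients of elements of the Fedosov algebra. -/

section FedBasics

variable {R g : Type*} [CommRing R] [LieRing g] [LieAlgebra R g] {n : ℕ}
  {A : Type*} [Ring A] [Algebra R A]

instance : Ring (Fed R g n A) := inferInstance

instance : Semiring (Fed R g n A) := inferInstance

instance : NonUnitalNonAssocRing (Fed R g n A) := inferInstance

instance : NonUnitalNonAssocSemiring (Fed R g n A) := inferInstance

instance : AddCommGroup (Fed R g n A) := inferInstance

instance : AddCommMonoid (Fed R g n A) := inferInstance

instance : AddGroup (Fed R g n A) := inferInstance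

instance : SubtractionMonoid (Fed R g n A) := inferInstance

instance : SubNegMonoid (Fed R g n A) := inferInstance

instance : AddMonoid (Fed R g n A) := inferInstance

instance : Add (Fed R g n A) := inferInstance

instance : Mul (Fed R g n A) := inferInstance

instance : Semigroup (Fed R g n A) := inferInstance

instance : Zero (Fed R g n A) := inferInstance

instance : Module R (Fed R g n A) := inferInstance

instance : SMul R (Fed R g n A) := inferInstance

/-- The coefficient of `t^m y^κ`, as a linear map. -/
def cfL (m : ℕ) (κ : Fin n →₀ ℕ) : Fed R g n A →ₗ[R] Cf R g A where
  toFun := cf m κ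
  map_add' _ _ := by simp [cf]
  map_smul' _ _ := rfl

theorem fed_ext {a a' : Fed R g n A} (h : ∀ m κ, cf m κ a = cf m κ a') : a = a' :=
  PowerSeries.ext fun m => MvPowerSeries.ext fun κ => h m κ

@[simp] theorem cf_add (m : ℕ) (κ : Fin n →₀ ℕ) (a a' : Fed R g n A) :
    cf m κ (a + a') = cf m κ a + cf m κ a' := (cfL m κ).map_add a a'

@[simp] theorem cf_sub (m : ℕ) (κ : Fin n →₀ ℕ) (a a' : Fed R g n A) :
    cf m κ (a - a') = cf m κ a - cf m κ a' := (cfL m κ).map_sub a a'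

@[simp] theorem cf_neg (m : ℕ) (κ : Fin n →₀ ℕ) (a : Fed R g n A) :
    cf m κ (-a) = -cf m κ a := (cfL m κ).map_neg a

@[simp] theorem cf_zero (m : ℕ) (κ : Fin n →₀ ℕ) : cf m κ (0 : Fed R g n A) = 0 :=
  (cfL m κ).map_zero

@[simp] theorem cf_smul (m : ℕ) (κ : Fin n →₀ ℕ) (c : R) (a : Fed R g n A) :
    cf m κ (c • a) = c • cf m κ a := (cfL m κ).map_smul c a

@[simp] theorem cf_sum {ι : Type*} (m : ℕ) (κ : Fin n →₀ ℕ) (s : Finset ι)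
    (f : ι → Fed R g n A) : cf m κ (∑ i ∈ s, f i) = ∑ i ∈ s, cf m κ (f i) :=
  map_sum (cfL m κ) f s

@[simp] theorem cf_mkFed (m : ℕ) (κ : Fin n →₀ ℕ) (c : ℕ → (Fin n →₀ ℕ) → Cf R g A) :
    cf m κ (mkFed c) = c m κ := by
  unfold cf mkFed
  erw [PowerSeries.coeff_mk]; rfl

@[simp] theorem cf_mapCf (m : ℕ) (κ : Fin n →₀ ℕ) (f : Cf R g A →ₗ[R] Cf R g A)
    (a : Fed R g n A) : cf m κ (mapCf f a) = f (cf m κ a) := cf_mkFed _ _ _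

@[simp] theorem cf_insSym (m : ℕ) (κ : Fin n →₀ ℕ) (i : Fin n) (a : Fed R g n A) :
    cf m κ (insSym i a) = (κ i + 1) • cf m (κ + Finsupp.single i 1) a := cf_mkFed _ _ _

theorem cf_mul (m : ℕ) (κ : Fin n →₀ ℕ) (a a' : Fed R g n A) :
    cf m κ (a * a') = ∑ p ∈ antidiagonal m, ∑ q ∈ antidiagonal κ,
      cf p.1 q.1 a * cf p.2 q.2 a' := by
  simp only [cf, PowerSeries.coeff_mul, map_sum, MvPowerSeries.coeff_mul]

theorem cf_const (m : ℕ) (κ : Fin n →₀ ℕ) (c : Cf R g A) :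
    cf m κ (const c : Fed R g n A) = if m = 0 ∧ κ = 0 then c else 0 := by
  classical
  rw [cf, const, PowerSeries.coeff_C]
  split_ifs with h1 h2 h2
  · rw [h2.2, MvPowerSeries.coeff_zero_C]
  · rw [MvPowerSeries.coeff_C, if_neg fun h => h2 ⟨h1, h⟩]
  · exact absurd h2.1 h1
  · exact map_zero _

@[simp] theorem cf_const_mul (m : ℕ) (κ : Fin n →₀ ℕ) (c : Cf R g A) (a : Fed R g n A) :
    cf m κ (const c * a) = c * cf m κ a := by
  rw [cf, const, PowerSeries.coeff_C_mul, MvPowerSeries.coeff_C_mul]; rfl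

@[simp] theorem cf_mul_const (m : ℕ) (κ : Fin n →₀ ℕ) (c : Cf R g A) (a : Fed R g n A) :
    cf m κ (a * const c) = cf m κ a * c := by
  rw [cf, const, PowerSeries.coeff_mul_C, MvPowerSeries.coeff_mul_C]; rfl

theorem cf_one (m : ℕ) (κ : Fin n →₀ ℕ) :
    cf m κ (1 : Fed R g n A) = if m = 0 ∧ κ = 0 then 1 else 0 := by
  have := cf_const m κ (1 : Cf R g A)
  rwa [const, map_one, map_one] at this

@[simp] theorem cf_X_mul_succ (m : ℕ) (κ : Fin n →₀ ℕ) (a : Fed R g n A) :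
    cf (m + 1) κ (PowerSeries.X * a) = cf m κ a := by
  rw [cf, PowerSeries.coeff_succ_X_mul]; rfl

@[simp] theorem cf_X_mul_zero (κ : Fin n →₀ ℕ) (a : Fed R g n A) :
    cf 0 κ (PowerSeries.X * a) = 0 := by
  rw [cf, PowerSeries.coeff_zero_X_mul, map_zero]

theorem cf_symMul_add (m : ℕ) (κ : Fin n →₀ ℕ) (i : Fin n) (a : Fed R g n A) :
    cf m (κ + Finsupp.single i 1) (symMul i a) = cf m κ a := by
  rw [cf, symMul, PowerSeries.coeff_C_mul, add_comm, MvPowerSeries.X,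
    MvPowerSeries.coeff_add_monomial_mul, one_mul]; rfl

theorem cf_symMul_of_eq_zero (m : ℕ) (κ : Fin n →₀ ℕ) (i : Fin n) (a : Fed R g n A)
    (h : κ i = 0) : cf m κ (symMul i a) = 0 := by
  rw [cf, symMul, PowerSeries.coeff_C_mul, MvPowerSeries.X, MvPowerSeries.coeff_monomial_mul,
    if_neg]
  intro h'
  have := h' i
  simp [h] at this

theorem cf_symMul_insSym (m : ℕ) (κ : Fin n →₀ ℕ) (i : Fin n) (a : Fed R g n A) :
    cf m κ (symMul i (insSym i a)) = κ i • cf m κ a := by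
  by_cases h : κ i = 0
  · rw [cf_symMul_of_eq_zero _ _ _ _ h, h, zero_smul]
  · obtain ⟨κ', rfl⟩ : ∃ κ', κ = κ' + Finsupp.single i 1 :=
      ⟨κ - Finsupp.single i 1, (tsub_add_cancel_of_le (by
        rw [Finsupp.single_le_iff]; omega)).symm⟩
    rw [cf_symMul_add, cf_insSym]
    simp

theorem cf_divT (m : ℕ) (κ : Fin n →₀ ℕ) (a : Fed R g n A) :
    cf m κ (divT a) = cf (m + 1) κ a := by
  rw [cf, divT, PowerSeries.coeff_mk]; rfl

theorem X_mul_comm (a : Fed R g n A) : (PowerSeries.X : Fed R g n A) * a = a * PowerSeries.X :=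
  (PowerSeries.commute_X a).symm.eq

theorem X_mul_cancel {a a' : Fed R g n A}
    (h : (PowerSeries.X : Fed R g n A) * a = PowerSeries.X * a') : a = a' :=
  fed_ext fun m κ => by rw [← cf_X_mul_succ m κ a, h, cf_X_mul_succ]

theorem X_mul_divT {a : Fed R g n A} (h : PowerSeries.coeff 0 a = 0) :
    (PowerSeries.X : Fed R g n A) * divT a = a := fed_ext fun m κ => by
  cases m with
  | zero => rw [cf_X_mul_zero, cf, h, map_zero]
  | succ m => rw [cf_X_mul_succ, cf_divT]

theorem sum_antidiagonal_swap {M : Type*} [AddCommMonoid M] (κ : Fin n →₀ ℕ)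
    (f : (Fin n →₀ ℕ) × (Fin n →₀ ℕ) → M) :
    ∑ q ∈ antidiagonal κ, f q.swap = ∑ q ∈ antidiagonal κ, f q := by
  rw [← Finset.HasAntidiagonal.map_swap_antidiagonal, Finset.sum_map]
  simp

/-- The reindexing behind the Leibniz rule for `∂/∂y^i`: pairs with `q.1 i = 0` carry weight zero,
and the others are shifts of the pairs with sum `κ`. -/
theorem sum_antidiagonal_add_single {M : Type*} [AddCommMonoid M] (κ : Fin n →₀ ℕ) (i : Fin n)
    (f : (Fin n →₀ ℕ) × (Fin n →₀ ℕ) → M) :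
    (antidiagonal (κ + Finsupp.single i 1)).sum
        (fun q : (Fin n →₀ ℕ) × (Fin n →₀ ℕ) => q.1 i • f q)
      = ∑ q ∈ antidiagonal κ,
        (q.1 i + 1) • f (q.1 + Finsupp.single i 1, q.2) := by
  classical
  symm
  refine Finset.sum_bij_ne_zero (fun q _ _ => (q.1 + Finsupp.single i 1, q.2)) ?_ ?_ ?_ ?_
  · intro q hq _
    rw [Finset.HasAntidiagonal.mem_antidiagonal] at hq ⊢
    rw [← hq]; simp only []; abel
  · rintro ⟨q1, q2⟩ _ _ ⟨q1', q2'⟩ _ _ h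
    simpa using h
  · rintro ⟨q1, q2⟩ hq h0
    have hi : q1 i ≠ 0 := fun h => h0 (by simp [h])
    have hle : Finsupp.single i 1 ≤ q1 := by rw [Finsupp.single_le_iff]; omega
    have he : q1 - Finsupp.single i 1 + Finsupp.single i 1 = q1 := tsub_add_cancel_of_le hle
    refine ⟨(q1 - Finsupp.single i 1, q2), ?_, ?_, ?_⟩
    · rw [Finset.HasAntidiagonal.mem_antidiagonal] at hq ⊢
      have : q1 - Finsupp.single i 1 + q2 + Finsupp.single i 1 = κ + Finsupp.single i 1 := by
        rw [← hq, add_right_comm, he]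
      exact add_right_cancel this
    · simp only [he]
      convert h0 using 2
      simp; omega
    · simp only [he]
  · intro q _ _
    simp

/-- The symmetric insertion is a derivation of the undeformed product. -/
theorem insSym_mul (i : Fin n) (a a' : Fed R g n A) :
    insSym i (a * a') = insSym i a * a' + a * insSym i a' := by
  refine fed_ext fun m κ => ?_
  rw [cf_add, cf_insSym, cf_mul, cf_mul, cf_mul, Finset.smul_sum, ← Finset.sum_add_distrib]
  refine Finset.sum_congr rfl fun p _ => ?_
  have h1 := sum_antidiagonal_add_single κ i (fun q => cf p.1 q.1 a * cf p.2 q.2 a')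
  have h2 := sum_antidiagonal_add_single κ i (fun q => cf p.1 q.2 a * cf p.2 q.1 a')
  rw [← sum_antidiagonal_swap, ← sum_antidiagonal_swap κ] at h2
  simp only [Prod.swap] at h2
  simp only [cf_insSym, smul_mul_assoc, mul_smul_comm]
  rw [← h1, ← h2, ← Finset.sum_add_distrib, Finset.smul_sum]
  refine Finset.sum_congr rfl fun q hq => ?_
  -- On this antidiagonal `q.1 i + q.2 i = κ i + 1`, so the two partial weights add up to the weight
  -- of the derivative.
  rw [← add_smul]
  congr 1
  rw [Finset.HasAntidiagonal.mem_antidiagonal] at hq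
  have := DFunLike.congr_fun hq i
  simp at this
  omega

end FedBasics

end

/-! ### Signs and contractions on the Grassmann algebra. -/

section FormLemmas

variable {R g : Type*} [CommRing R] [LieRing g] [LieAlgebra R g]

/-- Forms are the Clifford algebra of the zero quadratic form, so left induction reduces the
antiderivation rule to products with a single one-form. -/
theorem insForm_mul (X : g) (α β : Forms R g) :
    insForm X (α * β) = insForm X α * β + signForm α * insForm X β := by
  induction α using CliffordAlgebra.left_induction with
  | algebraMap r =>
    simp only [insForm, signForm, CliffordAlgebra.contractLeft_algebraMap_mul,
      CliffordAlgebra.contractLeft_algebraMap, AlgHom.toLinearMap_apply, AlgHom.commutes,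
      zero_mul, zero_add]
  | add x y hx hy => rw [add_mul, map_add, hx, hy, map_add, map_add, add_mul, add_mul]; abel
  | ι_mul x v hx =>
    simp only [insForm, signForm, mul_assoc, CliffordAlgebra.contractLeft_ι_mul,
      AlgHom.toLinearMap_apply, map_mul, CliffordAlgebra.involute_ι] at hx ⊢
    rw [hx]
    simp only [sub_mul, smul_mul_assoc, mul_add, neg_mul, mul_assoc]
    abel

theorem signForm_mul (α β : Forms R g) : signForm (α * β) = signForm α * signForm β :=
  map_mul CliffordAlgebra.involute α β

theorem signForm_signForm (α : Forms R g) : signForm (signForm α) = α :=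
  CliffordAlgebra.involute_involute α

theorem signForm_ι (v : Module.Dual R g) :
    signForm (ExteriorAlgebra.ι R v : Forms R g) = -ExteriorAlgebra.ι R v :=
  CliffordAlgebra.involute_ι v

theorem ι_mul_comm (v : Module.Dual R g) (α : Forms R g) :
    ExteriorAlgebra.ι R v * α = signForm α * ExteriorAlgebra.ι R v := by
  induction α using CliffordAlgebra.left_induction with
  | algebraMap r =>
    simp only [signForm, AlgHom.toLinearMap_apply, AlgHom.commutes]
    exact (Algebra.commutes r _).symm
  | add x y hx hy => rw [mul_add, hx, hy, map_add, add_mul]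
  | ι_mul x w hx =>
    have h : ExteriorAlgebra.ι R v * ExteriorAlgebra.ι R w
        = -(ExteriorAlgebra.ι R w * ExteriorAlgebra.ι R v) :=
      eq_neg_of_add_eq_zero_left (ExteriorAlgebra.ι_add_mul_swap v w)
    change ExteriorAlgebra.ι R v * (ExteriorAlgebra.ι R w * x) =
      signForm (ExteriorAlgebra.ι R w * x) * ExteriorAlgebra.ι R v
    rw [← mul_assoc, h, signForm_mul, signForm_ι, neg_mul, neg_mul, mul_assoc, hx, ← mul_assoc,
      neg_mul]

theorem insForm_ι (X : g) (v : Module.Dual R g) :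
    insForm X (ExteriorAlgebra.ι R v : Forms R g) = algebraMap R _ (v X) :=
  CliffordAlgebra.contractLeft_ι (Q := 0) (Module.Dual.eval R g X) v

theorem insForm_comm (X Y : g) (α : Forms R g) :
    insForm X (insForm Y α) = -insForm Y (insForm X α) :=
  CliffordAlgebra.contractLeft_comm _ _ _

theorem signForm_insForm (X : g) (α : Forms R g) :
    signForm (insForm X α) = -insForm X (signForm α) := by
  induction α using CliffordAlgebra.left_induction with
  | algebraMap r =>
    simp only [insForm, signForm, AlgHom.toLinearMap_apply, AlgHom.commutes,
      CliffordAlgebra.contractLeft_algebraMap, map_zero, neg_zero]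
  | add x y hx hy => simp only [map_add, hx, hy, neg_add]
  | ι_mul x v hx =>
    change signForm (insForm X (ExteriorAlgebra.ι R v * x)) =
      -insForm X (signForm (ExteriorAlgebra.ι R v * x))
    rw [insForm_mul, signForm_mul, insForm_mul, map_add, signForm_mul, signForm_mul, hx,
      insForm_ι, signForm_ι]
    simp only [map_neg, insForm_ι, signForm_ι]
    simp only [signForm, AlgHom.toLinearMap_apply, AlgHom.commutes]
    simp only [neg_mul, mul_neg, neg_neg, neg_add]

end FormLemmas

/-! ### The elementary operators and their commutation relations. -/

section Ops

variable (R g : Type*) [CommRing R] [LieRing g] [LieAlgebra R g] (n : ℕ)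
  (A : Type*) [Ring A] [Algebra R A]

/-- Coefficientwise application of an endomorphism of `A ⊗ Λ^•`. -/
def mapEnd : Module.End R (Cf R g A) →ₐ[R] Module.End R (Fed R g n A) :=
  AlgHom.ofLinearMap
    { toFun := fun f =>
        { toFun := mapCf f
          map_add' := fun _ _ => fed_ext fun _ _ => by simp
          map_smul' := fun _ _ => fed_ext fun _ _ => by simp }
      map_add' := fun _ _ => LinearMap.ext fun _ => fed_ext fun _ _ => by simp
      map_smul' := fun _ _ => LinearMap.ext fun _ => fed_ext fun _ _ => by simp }
    (LinearMap.ext fun _ => fed_ext fun _ _ => by simp)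
    (fun _ _ => LinearMap.ext fun _ => fed_ext fun _ _ => by simp)

variable {R g n A}

@[simp] theorem cf_mapEnd (m : ℕ) (κ : Fin n →₀ ℕ) (f : Module.End R (Cf R g A))
    (a : Fed R g n A) : cf m κ (mapEnd R g n A f a) = f (cf m κ a) := cf_mapCf _ _ _ _

/-- `i_s(e_i)` as a linear map. -/
def opD (i : Fin n) : Module.End R (Fed R g n A) where
  toFun := insSym i
  map_add' _ _ := fed_ext fun _ _ => by simp
  map_smul' _ _ := fed_ext fun _ _ => by simp only [cf_insSym, cf_smul, RingHom.id_apply]; rw [smul_comm]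

/-- Multiplication by `y^i` as a linear map. -/
def opY (i : Fin n) : Module.End R (Fed R g n A) :=
  LinearMap.mulLeft R (PowerSeries.C (MvPowerSeries.X i))

/-- The antisymmetric sign as a linear map. -/
def opS : Module.End R (Fed R g n A) := mapEnd R g n A (LinearMap.lTensor A signForm)

variable (b : Module.Basis (Fin n) R g)

/-- Multiplication by `e^i` as a linear map. -/
def opE (i : Fin n) : Module.End R (Fed R g n A) :=
  LinearMap.mulLeft R (const ((1 : A) ⊗ₜ[R] dualVec b i))

/-- `i_a(e_i)` as a linear map. -/
def opI (i : Fin n) : Module.End R (Fed R g n A) :=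
  mapEnd R g n A (LinearMap.lTensor A (insForm (b i)))

theorem insSym_eq (i : Fin n) (a : Fed R g n A) : insSym i a = opD i a := rfl
theorem symMul_eq (i : Fin n) (a : Fed R g n A) : symMul i a = opY i a := rfl
theorem wedge_eq (i : Fin n) (a : Fed R g n A) : wedge b i a = opE b i a := rfl
theorem cf_opD (m : ℕ) (κ : Fin n →₀ ℕ) (i : Fin n) (a : Fed R g n A) :
    cf m κ (opD i a) = (κ i + 1) • cf m (κ + Finsupp.single i 1) a := cf_insSym _ _ _ _

theorem cf_opE (m : ℕ) (κ : Fin n →₀ ℕ) (i : Fin n) (a : Fed R g n A) :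
    cf m κ (opE b i a) = ((1 : A) ⊗ₜ[R] dualVec b i) * cf m κ a := cf_const_mul _ _ _ _

theorem cf_opI (m : ℕ) (κ : Fin n →₀ ℕ) (i : Fin n) (a : Fed R g n A) :
    cf m κ (opI b i a) = LinearMap.lTensor A (insForm (b i)) (cf m κ a) := cf_mapEnd _ _ _ _

theorem cf_opS (m : ℕ) (κ : Fin n →₀ ℕ) (a : Fed R g n A) :
    cf m κ (opS a) = LinearMap.lTensor A signForm (cf m κ a) := cf_mapEnd _ _ _ _

theorem opD_mul (i : Fin n) (a a' : Fed R g n A) :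
    opD i (a * a') = opD i a * a' + a * opD i a' := insSym_mul i a a'

theorem cf_ite {p : Prop} [Decidable p] (m : ℕ) (κ : Fin n →₀ ℕ) (a a' : Fed R g n A) :
    cf m κ (if p then a else a') = if p then cf m κ a else cf m κ a' := by
  split_ifs <;> rfl

/-- The element `y^i`. -/
def elY (i : Fin n) : Fed R g n A := PowerSeries.C (MvPowerSeries.X i)

theorem opY_apply (i : Fin n) (a : Fed R g n A) : opY i a = elY i * a := rfl

theorem elY_comm (i : Fin n) (a : Fed R g n A) : elY i * a = a * elY i := by
  refine PowerSeries.ext fun m => ?_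
  rw [elY, PowerSeries.coeff_C_mul, PowerSeries.coeff_mul_C]
  exact (MvPowerSeries.commute_X _ i).symm.eq

theorem cf_elY (m : ℕ) (κ : Fin n →₀ ℕ) (i : Fin n) :
    cf m κ (elY i : Fed R g n A) = if m = 0 ∧ κ = Finsupp.single i 1 then 1 else 0 := by
  classical
  rw [cf, elY, PowerSeries.coeff_C]
  split_ifs with h1 h2 h2
  · rw [h2.2, MvPowerSeries.coeff_index_single_self_X]
  · rw [MvPowerSeries.coeff_X, if_neg fun h => h2 ⟨h1, h⟩]
  · exact absurd h2.1 h1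
  · exact map_zero _

theorem opD_elY (i j : Fin n) : opD i (elY j : Fed R g n A) = if i = j then 1 else 0 := by
  refine fed_ext fun m κ => ?_
  rw [cf_opD, cf_elY, cf_ite, cf_one, cf_zero]
  by_cases hij : i = j
  · subst hij
    simp only [add_eq_right, if_true]
    split_ifs with h
    · simp [h.2]
    · simp
  · rw [if_neg hij, if_neg, smul_zero]
    rintro ⟨-, h⟩
    have := DFunLike.congr_fun h i
    rw [Finsupp.add_apply, Finsupp.single_eq_same, Finsupp.single_apply,
      if_neg (Ne.symm hij)] at this
    omega

section Relations

theorem opD_opD (i j : Fin n) : (opD i * opD j : Module.End R (Fed R g n A)) = opD j * opD i := by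
  refine LinearMap.ext fun a => fed_ext fun m κ => ?_
  simp only [Module.End.mul_apply, cf_opD, smul_smul]
  rw [add_right_comm κ]
  congr 1
  by_cases h : i = j
  · rw [h]
  · simp [h, Ne.symm h, mul_comm]

theorem opD_opY (i j : Fin n) : (opD i * opY j : Module.End R (Fed R g n A))
    = opY j * opD i + if i = j then 1 else 0 := by
  refine LinearMap.ext fun a => ?_
  simp only [Module.End.mul_apply, opY_apply, opD_mul, opD_elY, LinearMap.add_apply]
  split_ifs <;> simp [add_comm]

/-- An operator on the coefficients does not see the variables `y`. The commutation of `opD` with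
`e^i`, `i_a(e_i)`, the sign and the action on `A` are all instances of this. -/
theorem opD_mapEnd (i : Fin n) (f : Module.End R (Cf R g A)) :
    opD i * mapEnd R g n A f = mapEnd R g n A f * opD i := by
  refine LinearMap.ext fun a => fed_ext fun m κ => ?_
  simp only [Module.End.mul_apply, cf_opD, cf_mapEnd]
  rw [map_nsmul]

theorem opE_eq_mapEnd (i : Fin n) : (opE b i : Module.End R (Fed R g n A)) =
    mapEnd R g n A (LinearMap.mulLeft R ((1 : A) ⊗ₜ[R] dualVec b i)) :=
  LinearMap.ext fun a => fed_ext fun m κ => by rw [cf_opE, cf_mapEnd]; rfl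

theorem cf_opY (m : ℕ) (κ : Fin n →₀ ℕ) (i : Fin n) (a : Fed R g n A) :
    cf m κ (opY i a) = if κ i = 0 then 0 else cf m (κ - Finsupp.single i 1) a := by
  split_ifs with h
  · exact cf_symMul_of_eq_zero m κ i a h
  · have he : κ - Finsupp.single i 1 + Finsupp.single i 1 = κ := tsub_add_cancel_of_le (by
      rw [Finsupp.single_le_iff]; omega)
    have := cf_symMul_add m (κ - Finsupp.single i 1) i a
    rwa [he] at this

theorem opY_mapEnd (i : Fin n) (f : Module.End R (Cf R g A)) :
    opY i * mapEnd R g n A f = mapEnd R g n A f * opY i := by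
  refine LinearMap.ext fun a => fed_ext fun m κ => ?_
  simp only [Module.End.mul_apply, cf_opY, cf_mapEnd]
  split_ifs <;> simp

theorem opD_opE (i j : Fin n) :
    (opD i * opE b j : Module.End R (Fed R g n A)) = opE b j * opD i := by
  rw [opE_eq_mapEnd, opD_mapEnd]

theorem opD_opI (i j : Fin n) :
    (opD i * opI b j : Module.End R (Fed R g n A)) = opI b j * opD i := opD_mapEnd _ _

theorem opD_opS (i : Fin n) :
    (opD i * opS : Module.End R (Fed R g n A)) = opS * opD i := opD_mapEnd _ _

theorem opY_opY (i j : Fin n) : (opY i * opY j : Module.End R (Fed R g n A)) = opY j * opY i := by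
  refine LinearMap.ext fun a => ?_
  simp only [Module.End.mul_apply, opY_apply]
  rw [← mul_assoc, elY_comm, mul_assoc, elY_comm]

theorem opY_opE (i j : Fin n) :
    (opY i * opE b j : Module.End R (Fed R g n A)) = opE b j * opY i := by
  rw [opE_eq_mapEnd, opY_mapEnd]

theorem opY_opI (i j : Fin n) :
    (opY i * opI b j : Module.End R (Fed R g n A)) = opI b j * opY i := opY_mapEnd _ _

theorem opY_opS (i : Fin n) :
    (opY i * opS : Module.End R (Fed R g n A)) = opS * opY i := opY_mapEnd _ _

theorem dualVec_mul_dualVec (i j : Fin n) : dualVec b i * dualVec b j = -(dualVec b j * dualVec b i) :=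
  eq_neg_of_add_eq_zero_left (ExteriorAlgebra.ι_add_mul_swap _ _)

theorem opE_opE (i j : Fin n) :
    (opE b i * opE b j : Module.End R (Fed R g n A)) = -(opE b j * opE b i) := by
  refine LinearMap.ext fun a => fed_ext fun m κ => ?_
  simp only [Module.End.mul_apply, LinearMap.neg_apply, cf_neg, cf_opE, ← mul_assoc,
    Algebra.TensorProduct.tmul_mul_tmul, dualVec_mul_dualVec b i j, TensorProduct.tmul_neg,
    neg_mul, one_mul]

theorem lTensor_insForm_mul (X : g) (c c' : Cf R g A) :
    LinearMap.lTensor A (insForm X) (c * c') = LinearMap.lTensor A (insForm X) c * c'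
      + LinearMap.lTensor A signForm c * LinearMap.lTensor A (insForm X) c' := by
  induction c using TensorProduct.induction_on with
  | zero => simp
  | add x y hx hy => rw [add_mul, map_add, hx, hy, map_add, map_add, add_mul, add_mul]; abel
  | tmul a α =>
    induction c' using TensorProduct.induction_on with
    | zero => simp
    | add x y hx hy => rw [mul_add, map_add, hx, hy, map_add, mul_add, mul_add]; abel
    | tmul a' α' =>
      simp only [Algebra.TensorProduct.tmul_mul_tmul, LinearMap.lTensor_tmul, insForm_mul,
        TensorProduct.tmul_add]

theorem opI_opE (k i : Fin n) : (opI b k * opE b i : Module.End R (Fed R g n A))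
    = (if k = i then 1 else 0) - opE b i * opI b k := by
  refine LinearMap.ext fun a => fed_ext fun m κ => ?_
  simp only [Module.End.mul_apply, LinearMap.sub_apply, cf_sub, cf_opE, cf_opI,
    lTensor_insForm_mul, LinearMap.lTensor_tmul]
  rw [dualVec, signForm_ι, insForm_ι, TensorProduct.tmul_neg, neg_mul, ← sub_eq_add_neg,
    Module.Basis.coord_apply, Module.Basis.repr_self, Finsupp.single_apply]
  congr 1
  split_ifs
  · rw [map_one, ← Algebra.TensorProduct.one_def, one_mul]; rfl
  · rw [map_zero, TensorProduct.tmul_zero, zero_mul, LinearMap.zero_apply, cf_zero]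

theorem opI_opI (i j : Fin n) :
    (opI b i * opI b j : Module.End R (Fed R g n A)) = -(opI b j * opI b i) := by
  rw [opI, opI, ← map_mul, ← map_mul, ← map_neg]
  congr 1
  refine TensorProduct.ext' fun a α => ?_
  simp only [Module.End.mul_apply, LinearMap.lTensor_tmul, LinearMap.neg_apply,
    insForm_comm (b i), TensorProduct.tmul_neg]

theorem opS_opE (i : Fin n) :
    (opS * opE b i : Module.End R (Fed R g n A)) = -(opE b i * opS) := by
  rw [opE_eq_mapEnd, opS, ← map_mul, ← map_mul, ← map_neg]
  congr 1
  refine TensorProduct.ext' fun a α => ?_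
  simp only [Module.End.mul_apply, LinearMap.lTensor_tmul, LinearMap.neg_apply,
    LinearMap.mulLeft_apply, Algebra.TensorProduct.tmul_mul_tmul, signForm_mul, dualVec,
    signForm_ι, neg_mul, TensorProduct.tmul_neg]

theorem opS_opI (i : Fin n) :
    (opS * opI b i : Module.End R (Fed R g n A)) = -(opI b i * opS) := by
  rw [opI, opS, ← map_mul, ← map_mul, ← map_neg]
  congr 1
  refine TensorProduct.ext' fun a α => ?_
  simp only [Module.End.mul_apply, LinearMap.lTensor_tmul, LinearMap.neg_apply,
    signForm_insForm, TensorProduct.tmul_neg]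

theorem opS_opS : (opS * opS : Module.End R (Fed R g n A)) = 1 := by
  rw [opS, ← map_mul, ← map_one (mapEnd R g n A)]
  congr 1
  refine TensorProduct.ext' fun a α => ?_
  simp only [Module.End.mul_apply, LinearMap.lTensor_tmul, signForm_signForm, Module.End.one_apply]

theorem lTensor_signForm_mul (c c' : Cf R g A) :
    LinearMap.lTensor A signForm (c * c') =
      LinearMap.lTensor A signForm c * LinearMap.lTensor A signForm c' :=
  map_mul (Algebra.TensorProduct.map (AlgHom.id R A) CliffordAlgebra.involute) c c'

theorem opS_mul (a a' : Fed R g n A) : opS (a * a') = opS a * opS a' := by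
  refine fed_ext fun m κ => ?_
  simp only [cf_opS, cf_mul, map_sum, lTensor_signForm_mul]

theorem opI_mul (i : Fin n) (a a' : Fed R g n A) :
    opI b i (a * a') = opI b i a * a' + opS a * opI b i a' := by
  refine fed_ext fun m κ => ?_
  simp only [cf_opI, cf_opS, cf_mul, map_sum, lTensor_insForm_mul, cf_add,
    Finset.sum_add_distrib]

theorem opE_mul (i : Fin n) (a a' : Fed R g n A) : opE b i (a * a') = opE b i a * a' :=
  (mul_assoc _ _ _).symm

theorem dualVec_mul_comm (i : Fin n) (c : Cf R g A) :
    ((1 : A) ⊗ₜ[R] dualVec b i) * c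
      = LinearMap.lTensor A signForm c * ((1 : A) ⊗ₜ[R] dualVec b i) := by
  induction c using TensorProduct.induction_on with
  | zero => simp
  | add x y hx hy => rw [mul_add, hx, hy, map_add, add_mul]
  | tmul a α =>
    simp only [Algebra.TensorProduct.tmul_mul_tmul, LinearMap.lTensor_tmul, one_mul, mul_one,
      dualVec, ι_mul_comm]

/-- `e^i` moves past an element at the cost of the sign. -/
theorem mul_opE (i : Fin n) (a a' : Fed R g n A) : opS a * opE b i a' = opE b i (a * a') := by
  have h : opE b i a = opS a * const ((1 : A) ⊗ₜ[R] dualVec b i) := fed_ext fun m κ => by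
    rw [cf_opE, cf_mul_const, cf_opS, dualVec_mul_comm]
  rw [opE_mul, h, mul_assoc]; rfl

theorem mul_opY (i : Fin n) (a a' : Fed R g n A) : a * opY i a' = opY i (a * a') := by
  rw [opY_apply, opY_apply, ← mul_assoc, ← elY_comm, mul_assoc]

end Relations

end Ops

/-! ### The terms of the deformed product, order by order. -/

section Moyal

variable {R g : Type*} [CommRing R] [LieRing g] [LieAlgebra R g] {n : ℕ}
  {A : Type*} [Ring A] [Algebra R A] (p : Matrix (Fin n) (Fin n) R)

/-- Linear operators commuting with multiplication by `t`. -/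
def TLinear (T : Module.End R (Fed R g n A)) : Prop :=
  ∀ a, T (PowerSeries.X * a) = PowerSeries.X * T a

theorem TLinear.X_pow {T : Module.End R (Fed R g n A)} (hT : TLinear T) (N : ℕ)
    (a : Fed R g n A) : T (PowerSeries.X ^ N * a) = PowerSeries.X ^ N * T a := by
  induction N with
  | zero => simp
  | succ N ih => rw [pow_succ', mul_assoc, hT, ih, mul_assoc]

theorem TLinear.mul {T T' : Module.End R (Fed R g n A)} (hT : TLinear T) (hT' : TLinear T') :
    TLinear (T * T') := fun a => by
  rw [Module.End.mul_apply, hT', hT]; rfl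

theorem TLinear.add {T T' : Module.End R (Fed R g n A)} (hT : TLinear T) (hT' : TLinear T') :
    TLinear (T + T') := fun a => by
  simp only [LinearMap.add_apply, hT a, hT' a, mul_add]

theorem TLinear.neg {T : Module.End R (Fed R g n A)} (hT : TLinear T) : TLinear (-T) := fun a => by
  simp only [LinearMap.neg_apply, hT a, mul_neg]

theorem TLinear.smul {T : Module.End R (Fed R g n A)} (hT : TLinear T) (c : R) :
    TLinear (c • T) := fun a => by
  simp only [LinearMap.smul_apply, hT a, mul_smul_comm]

theorem TLinear.sum {ι : Type*} {s : Finset ι} {T : ι → Module.End R (Fed R g n A)}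
    (hT : ∀ i ∈ s, TLinear (T i)) : TLinear (∑ i ∈ s, T i) := fun a => by
  simp only [LinearMap.sum_apply, Finset.mul_sum]
  exact Finset.sum_congr rfl fun i hi => hT i hi a

theorem tlinear_mapEnd (f : Module.End R (Cf R g A)) : TLinear (mapEnd R g n A f) := fun a =>
  fed_ext fun m κ => by
    cases m with
    | zero => rw [cf_X_mul_zero, cf_mapEnd, cf_X_mul_zero, map_zero]
    | succ m => rw [cf_X_mul_succ, cf_mapEnd, cf_X_mul_succ, cf_mapEnd]

theorem tlinear_opD (i : Fin n) : TLinear (opD i : Module.End R (Fed R g n A)) := fun a =>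
  fed_ext fun m κ => by
    cases m with
    | zero => rw [cf_X_mul_zero, cf_opD, cf_X_mul_zero, smul_zero]
    | succ m => rw [cf_X_mul_succ, cf_opD, cf_X_mul_succ, cf_opD]

theorem tlinear_opY (i : Fin n) : TLinear (opY i : Module.End R (Fed R g n A)) := fun a => by
  rw [opY_apply, opY_apply, ← mul_assoc, ← X_mul_comm, mul_assoc]

theorem tlinear_opE (b : Module.Basis (Fin n) R g) (i : Fin n) :
    TLinear (opE b i : Module.End R (Fed R g n A)) := by
  rw [opE_eq_mapEnd]; exact tlinear_mapEnd _

theorem tlinear_opI (b : Module.Basis (Fin n) R g) (i : Fin n) :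
    TLinear (opI b i : Module.End R (Fed R g n A)) := tlinear_mapEnd _

theorem tlinear_opS : TLinear (opS : Module.End R (Fed R g n A)) := tlinear_mapEnd _

/-- `moyalTerm` as a bilinear map. -/
def moyalL : ℕ → Fed R g n A →ₗ[R] Fed R g n A →ₗ[R] Fed R g n A
  | 0 => LinearMap.mul R (Fed R g n A)
  | N + 1 => ∑ i, ∑ j, p i j • (moyalL N).compl₁₂ (opD i) (opD j)

theorem moyalTerm_eq (N : ℕ) (a a' : Fed R g n A) : moyalTerm p N a a' = moyalL p N a a' := by
  induction N generalizing a a' with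
  | zero => rfl
  | succ N ih =>
    simp only [moyalTerm, moyalL, LinearMap.sum_apply, LinearMap.smul_apply,
      LinearMap.compl₁₂_apply, ih, insSym_eq]

theorem moyalL_zero (a a' : Fed R g n A) : moyalL p 0 a a' = a * a' := rfl

theorem moyalL_succ (N : ℕ) (a a' : Fed R g n A) :
    moyalL p (N + 1) a a' = ∑ i, ∑ j, p i j • moyalL p N (opD i a) (opD j a') := by
  simp only [moyalL, LinearMap.sum_apply, LinearMap.smul_apply, LinearMap.compl₁₂_apply]

theorem opD_comm_apply (i j : Fin n) (a : Fed R g n A) : opD i (opD j a) = opD j (opD i a) :=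
  LinearMap.congr_fun (opD_opD i j) a

/-- If `T ∘ μ = μ ∘ (T₁ ⊗ T₂)` and the factors commute with all partial derivatives, the tensor
product commutes with `P`. This moves `e^i` and the sign through the deformed product. -/
theorem moyalL_intertwine {T T₁ T₂ : Module.End R (Fed R g n A)}
    (h : ∀ a a', T (a * a') = T₁ a * T₂ a') (h₁ : ∀ i, T₁ * opD i = opD i * T₁)
    (h₂ : ∀ i, T₂ * opD i = opD i * T₂) (N : ℕ) (a a' : Fed R g n A) :
    T (moyalL p N a a') = moyalL p N (T₁ a) (T₂ a') := by
  induction N generalizing a a' with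
  | zero => exact h a a'
  | succ N ih =>
    simp only [moyalL_succ, map_sum, map_smul, ih]
    refine Finset.sum_congr rfl fun i _ => Finset.sum_congr rfl fun j _ => ?_
    rw [← Module.End.mul_apply T₁, h₁, ← Module.End.mul_apply T₂, h₂]; rfl

/-- Partial derivatives commute with each other and `p` is constant, so the Leibniz rule of `μ`
passes to `μ ∘ P^N`. -/
theorem moyalL_opD (N : ℕ) (k : Fin n) (a a' : Fed R g n A) :
    opD k (moyalL p N a a') = moyalL p N (opD k a) a' + moyalL p N a (opD k a') := by
  induction N generalizing a a' with
  | zero => exact opD_mul k a a'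
  | succ N ih =>
    simp only [moyalL_succ, map_sum, map_smul, ih, smul_add, Finset.sum_add_distrib,
      opD_comm_apply k]

/-- A derivation of the undeformed product acting linearly on the `y^i` and preserving the tensor
`p` is a derivation of each term of the deformed product. -/
theorem moyalL_derivation {T : Module.End R (Fed R g n A)}
    (h : ∀ a a', T (a * a') = T a * a' + a * T a') (G : Matrix (Fin n) (Fin n) R)
    (hG : ∀ i, T * opD i = opD i * T + ∑ k, G i k • opD k)
    (hp : ∀ k l, ∑ i, p i l * G i k + ∑ i, p k i * G i l = 0) (N : ℕ) (a a' : Fed R g n A) :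
    T (moyalL p N a a') = moyalL p N (T a) a' + moyalL p N a (T a') := by
  induction N generalizing a a' with
  | zero => exact h a a'
  | succ N ih =>
    have hT : ∀ i a, T (opD i a) = opD i (T a) + ∑ k, G i k • opD k a := fun i a => by
      have := LinearMap.congr_fun (hG i) a
      simpa only [LinearMap.add_apply, Module.End.mul_apply, LinearMap.sum_apply,
        LinearMap.smul_apply] using this
    simp only [moyalL_succ, map_sum, map_smul, ih, hT, map_add, LinearMap.add_apply,
      LinearMap.sum_apply, LinearMap.smul_apply, smul_add, Finset.sum_add_distrib,
      Finset.smul_sum, smul_smul]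
    -- The commutators of `T` with the derivatives contribute the action of `G` on each index of
    -- `p`. Renaming the summation indices collects the two contributions into the combination
    -- annihilated by `hp`.
    have h1 : ∑ i, ∑ j, ∑ k, (p i j * G i k) • moyalL p N (opD k a) (opD j a')
        = ∑ k, ∑ l, (∑ i, p i l * G i k) • moyalL p N (opD k a) (opD l a') := by
      simp only [Finset.sum_smul]
      rw [Finset.sum_comm]
      rw [Finset.sum_comm (s := Finset.univ (α := Fin n)) (t := Finset.univ (α := Fin n))
        (f := fun k l => ∑ i, (p i l * G i k) • moyalL p N (opD k a) (opD l a'))]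
      exact Finset.sum_congr rfl fun j _ => Finset.sum_comm
    have h2 : ∑ i, ∑ j, ∑ k, (p i j * G j k) • moyalL p N (opD i a) (opD k a')
        = ∑ k, ∑ l, (∑ i, p k i * G i l) • moyalL p N (opD k a) (opD l a') := by
      simp only [Finset.sum_smul]
      exact Finset.sum_congr rfl fun j _ => Finset.sum_comm
    rw [add_add_add_comm, h1, h2]
    simp only [← Finset.sum_add_distrib, ← add_smul, hp, zero_smul, Finset.sum_const_zero, add_zero]

theorem moyalL_X_left (N : ℕ) (a a' : Fed R g n A) :
    moyalL p N (PowerSeries.X * a) a' = PowerSeries.X * moyalL p N a a' := by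
  induction N generalizing a a' with
  | zero => exact mul_assoc _ _ _
  | succ N ih =>
    simp only [moyalL_succ, tlinear_opD _ _, ih, Finset.mul_sum, mul_smul_comm]

theorem moyalL_X_right (N : ℕ) (a a' : Fed R g n A) :
    moyalL p N a (PowerSeries.X * a') = PowerSeries.X * moyalL p N a a' := by
  induction N generalizing a a' with
  | zero => simp only [moyalL_zero]; rw [← mul_assoc, ← X_mul_comm, mul_assoc]
  | succ N ih =>
    simp only [moyalL_succ, tlinear_opD _ _, ih, Finset.mul_sum, mul_smul_comm]

/-- The three bidifferential operators acting on functions of three arguments. -/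
abbrev Tri (R g : Type*) [CommRing R] [LieRing g] [LieAlgebra R g] (n : ℕ)
    (A : Type*) [Ring A] [Algebra R A] :=
  Fed R g n A → Fed R g n A → Fed R g n A → Fed R g n A

/-- `P` acting on the first and second arguments. -/
def P12 : Module.End R (Tri R g n A) where
  toFun f := fun a a' a'' => ∑ i, ∑ j, p i j • f (opD i a) (opD j a') a''
  map_add' f f' := by
    funext a a' a''
    simp only [Pi.add_apply, smul_add, Finset.sum_add_distrib]
  map_smul' c f := by
    funext a a' a''
    simp only [Pi.smul_apply, Finset.smul_sum, RingHom.id_apply]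
    exact Finset.sum_congr rfl fun i _ => Finset.sum_congr rfl fun j _ => smul_comm _ _ _

/-- `P` acting on the first and third arguments. -/
def P13 : Module.End R (Tri R g n A) where
  toFun f := fun a a' a'' => ∑ i, ∑ j, p i j • f (opD i a) a' (opD j a'')
  map_add' f f' := by
    funext a a' a''
    simp only [Pi.add_apply, smul_add, Finset.sum_add_distrib]
  map_smul' c f := by
    funext a a' a''
    simp only [Pi.smul_apply, Finset.smul_sum, RingHom.id_apply]
    exact Finset.sum_congr rfl fun i _ => Finset.sum_congr rfl fun j _ => smul_comm _ _ _

/-- `P` acting on the second and third arguments. -/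
def P23 : Module.End R (Tri R g n A) where
  toFun f := fun a a' a'' => ∑ i, ∑ j, p i j • f a (opD i a') (opD j a'')
  map_add' f f' := by
    funext a a' a''
    simp only [Pi.add_apply, smul_add, Finset.sum_add_distrib]
  map_smul' c f := by
    funext a a' a''
    simp only [Pi.smul_apply, Finset.smul_sum, RingHom.id_apply]
    exact Finset.sum_congr rfl fun i _ => Finset.sum_congr rfl fun j _ => smul_comm _ _ _

theorem P12_apply (f : Tri R g n A) (a a' a'' : Fed R g n A) :
    P12 p f a a' a'' = ∑ i, ∑ j, p i j • f (opD i a) (opD j a') a'' := rfl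
theorem P13_apply (f : Tri R g n A) (a a' a'' : Fed R g n A) :
    P13 p f a a' a'' = ∑ i, ∑ j, p i j • f (opD i a) a' (opD j a'') := rfl
theorem P23_apply (f : Tri R g n A) (a a' a'' : Fed R g n A) :
    P23 p f a a' a'' = ∑ i, ∑ j, p i j • f a (opD i a') (opD j a'') := rfl

theorem sum_smul_sum_comm {M : Type*} [AddCommGroup M] [Module R M]
    (f : Fin n → Fin n → Fin n → Fin n → M) :
    ∑ i, ∑ j, p i j • ∑ k, ∑ l, p k l • f i j k l
      = ∑ i, ∑ j, p i j • ∑ k, ∑ l, p k l • f k l i j := by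
  simp only [Finset.smul_sum]
  have h : ∀ F : Fin n → Fin n → Fin n → Fin n → M,
      ∑ i, ∑ j, ∑ k, ∑ l, F i j k l = ∑ k, ∑ l, ∑ i, ∑ j, F i j k l := fun F => by
    calc _ = ∑ i, ∑ k, ∑ j, ∑ l, F i j k l := Finset.sum_congr rfl fun _ _ => Finset.sum_comm
      _ = ∑ k, ∑ i, ∑ j, ∑ l, F i j k l := Finset.sum_comm
      _ = ∑ k, ∑ i, ∑ l, ∑ j, F i j k l :=
        Finset.sum_congr rfl fun _ _ => Finset.sum_congr rfl fun _ _ => Finset.sum_comm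
      _ = _ := Finset.sum_congr rfl fun _ _ => Finset.sum_comm
  rw [h]
  refine Finset.sum_congr rfl fun i _ => Finset.sum_congr rfl fun j _ =>
    Finset.sum_congr rfl fun k _ => Finset.sum_congr rfl fun l _ => ?_
  rw [smul_comm]

theorem P12_comm_P13 : Commute (P12 p : Module.End R (Tri R g n A)) (P13 p) := by
  change P12 p * P13 p = P13 p * P12 p
  refine LinearMap.ext fun f => ?_
  funext a a' a''
  simp only [Module.End.mul_apply, P12_apply, P13_apply]
  rw [sum_smul_sum_comm]
  refine Finset.sum_congr rfl fun i _ => Finset.sum_congr rfl fun j _ =>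
    congrArg _ (Finset.sum_congr rfl fun k _ => Finset.sum_congr rfl fun l _ => congrArg _ ?_)
  rw [opD_comm_apply]

theorem P12_comm_P23 : Commute (P12 p : Module.End R (Tri R g n A)) (P23 p) := by
  change P12 p * P23 p = P23 p * P12 p
  refine LinearMap.ext fun f => ?_
  funext a a' a''
  simp only [Module.End.mul_apply, P12_apply, P23_apply]
  rw [sum_smul_sum_comm]
  refine Finset.sum_congr rfl fun i _ => Finset.sum_congr rfl fun j _ =>
    congrArg _ (Finset.sum_congr rfl fun k _ => Finset.sum_congr rfl fun l _ => congrArg _ ?_)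
  rw [opD_comm_apply]

theorem P13_comm_P23 : Commute (P13 p : Module.End R (Tri R g n A)) (P23 p) := by
  change P13 p * P23 p = P23 p * P13 p
  refine LinearMap.ext fun f => ?_
  funext a a' a''
  simp only [Module.End.mul_apply, P13_apply, P23_apply]
  rw [sum_smul_sum_comm]
  refine Finset.sum_congr rfl fun i _ => Finset.sum_congr rfl fun j _ =>
    congrArg _ (Finset.sum_congr rfl fun k _ => Finset.sum_congr rfl fun l _ => congrArg _ ?_)
  rw [opD_comm_apply]

theorem moyalL_left_mul (N : ℕ) (a a' a'' : Fed R g n A) :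
    moyalL p N a a' * a'' = ((P12 p ^ N) fun a a' a'' => a * a' * a'') a a' a'' := by
  induction N generalizing a a' with
  | zero => rfl
  | succ N ih =>
    rw [pow_succ', Module.End.mul_apply, P12_apply, moyalL_succ]
    simp only [Finset.sum_mul, smul_mul_assoc, ih]

theorem mul_moyalL (N : ℕ) (a a' a'' : Fed R g n A) :
    a * moyalL p N a' a'' = ((P23 p ^ N) fun a a' a'' => a * a' * a'') a a' a'' := by
  induction N generalizing a' a'' with
  | zero => exact (mul_assoc _ _ _).symm
  | succ N ih =>
    rw [pow_succ', Module.End.mul_apply, P23_apply, moyalL_succ]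
    simp only [Finset.mul_sum, mul_smul_comm, ih]

/-- By the Leibniz rule an outer derivative of an inner product falls on either inner factor, so the
outer `P` becomes `P13 + P23`. Both bracketings thus become polynomials in commuting operators on
triples. -/
theorem moyalL_moyalL_left (N M : ℕ) (a a' a'' : Fed R g n A) :
    moyalL p N (moyalL p M a a') a''
      = ((P13 p + P23 p) ^ N * P12 p ^ M : Module.End R (Tri R g n A))
          (fun a a' a'' => a * a' * a'') a a' a'' := by
  induction N generalizing a a' a'' with
  | zero => rw [pow_zero, one_mul, moyalL_zero, moyalL_left_mul]
  | succ N ih =>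
    rw [pow_succ', mul_assoc, Module.End.mul_apply, LinearMap.add_apply, Pi.add_apply,
      Pi.add_apply, Pi.add_apply, P13_apply, P23_apply, moyalL_succ]
    simp only [moyalL_opD, map_add, LinearMap.add_apply, ih, smul_add, Finset.sum_add_distrib]

theorem moyalL_moyalL_right (N M : ℕ) (a a' a'' : Fed R g n A) :
    moyalL p N a (moyalL p M a' a'')
      = ((P12 p + P13 p) ^ N * P23 p ^ M : Module.End R (Tri R g n A))
          (fun a a' a'' => a * a' * a'') a a' a'' := by
  induction N generalizing a a' a'' with
  | zero => rw [pow_zero, one_mul, moyalL_zero, mul_moyalL]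
  | succ N ih =>
    rw [pow_succ', mul_assoc, Module.End.mul_apply, LinearMap.add_apply, Pi.add_apply,
      Pi.add_apply, Pi.add_apply, P12_apply, P13_apply, moyalL_succ]
    simp only [moyalL_opD, map_add, ih, smul_add, Finset.sum_add_distrib]

end Moyal

/-! ### The deformed product and its associativity. -/

section Circ

variable {R g : Type*} [CommRing R] [Algebra ℚ R] [LieRing g] [LieAlgebra R g] {n : ℕ}
  {A : Type*} [Ring A] [Algebra R A] (p : Matrix (Fin n) (Fin n) R)

/-- The weight `1 / (2^N N!)`. -/
def wt (R : Type*) [CommRing R] [Algebra ℚ R] (N : ℕ) : R := rat R (1 / (2 ^ N * N.factorial))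

/-- This is `exp(x) exp(y) = exp(x + y)` at the level of coefficients; it supplies the binomial
factor needed in `moyal_sum_eq`. -/
theorem wt_mul_wt (N M : ℕ) : wt R N * wt R M = wt R (N + M) * ((N + M).choose N : R) := by
  have h : ((N + M).choose N : R) = rat R ((N + M).choose N : ℚ) := (map_natCast _ _).symm
  rw [wt, wt, wt, h, ← map_mul, ← map_mul]
  congr 1
  have h1 : ((N + M).choose N : ℚ) * (N.factorial * M.factorial) = (N + M).factorial := by
    rw [← mul_assoc, Nat.choose_symm_add]
    exact_mod_cast Nat.add_choose_mul_factorial_mul_factorial N M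
  have h2 := Nat.cast_ne_zero (R := ℚ) |>.2 N.factorial_ne_zero
  have h3 := Nat.cast_ne_zero (R := ℚ) |>.2 M.factorial_ne_zero
  have h4 := Nat.cast_ne_zero (R := ℚ) |>.2 (N + M).factorial_ne_zero
  field_simp
  rw [← h1]; ring

theorem coeff_circ (m : ℕ) (a a' : Fed R g n A) : PowerSeries.coeff m (circ p a a') =
    ∑ N ∈ Finset.range (m + 1), wt R N • PowerSeries.coeff (m - N) (moyalL p N a a') := by
  simp only [circ, PowerSeries.coeff_mk, moyalTerm_eq, wt]

/-- The deformed product as a bilinear map. -/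
def circL : Fed R g n A →ₗ[R] Fed R g n A →ₗ[R] Fed R g n A :=
  LinearMap.mk₂ R (circ p)
    (fun _ _ _ => PowerSeries.ext fun _ => by
      simp only [coeff_circ, map_add, LinearMap.add_apply, smul_add, Finset.sum_add_distrib])
    (fun c _ _ => PowerSeries.ext fun _ => by
      simp only [coeff_circ, map_smul, LinearMap.smul_apply, Finset.smul_sum,
        PowerSeries.coeff_smul]
      exact Finset.sum_congr rfl fun _ _ => smul_comm _ _ _)
    (fun _ _ _ => PowerSeries.ext fun _ => by
      simp only [coeff_circ, map_add, smul_add, Finset.sum_add_distrib])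
    (fun c _ _ => PowerSeries.ext fun _ => by
      simp only [coeff_circ, map_smul, Finset.smul_sum,
        PowerSeries.coeff_smul]
      exact Finset.sum_congr rfl fun _ _ => smul_comm _ _ _)

theorem circ_eq (a a' : Fed R g n A) : circ p a a' = circL p a a' := rfl

/-- The deformed product is an infinite series in `t`. A `t`-linear operator sends the remainder to
a multiple of `t^(m+1)`, which is invisible in the coefficient of `t^m`; thus operators only ever
meet finite sums. -/
theorem circ_approx (a a' : Fed R g n A) (m : ℕ) : ∃ d : Fed R g n A,
    circL p a a' = ∑ N ∈ Finset.range (m + 1), wt R N • (PowerSeries.X ^ N * moyalL p N a a')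
      + PowerSeries.X ^ (m + 1) * d := by
  have h : (PowerSeries.X : Fed R g n A) ^ (m + 1) ∣ circL p a a' -
      ∑ N ∈ Finset.range (m + 1), wt R N • (PowerSeries.X ^ N * moyalL p N a a') := by
    rw [PowerSeries.X_pow_dvd_iff]
    intro k hk
    rw [map_sub, ← circ_eq, coeff_circ, map_sum, sub_eq_zero]
    rw [← Finset.sum_subset (Finset.range_subset_range.2 hk)]
    · refine Finset.sum_congr rfl fun N hN => ?_
      rw [Finset.mem_range] at hN
      rw [PowerSeries.coeff_smul, PowerSeries.coeff_X_pow_mul', if_pos (by omega)]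
    · intro N _ hN
      rw [Finset.mem_range] at hN
      rw [PowerSeries.coeff_smul, PowerSeries.coeff_X_pow_mul', if_neg (by omega), smul_zero]
  obtain ⟨d, hd⟩ := h
  exact ⟨d, by rw [← hd]; abel⟩

theorem coeff_tlinear_circ {T : Module.End R (Fed R g n A)} (hT : TLinear T) (m : ℕ)
    (a a' : Fed R g n A) : PowerSeries.coeff m (T (circL p a a')) =
    ∑ N ∈ Finset.range (m + 1), wt R N • PowerSeries.coeff (m - N) (T (moyalL p N a a')) := by
  obtain ⟨d, hd⟩ := circ_approx p a a' m
  rw [hd, map_add, hT.X_pow, map_add, PowerSeries.coeff_X_pow_mul', if_neg (by omega), add_zero,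
    map_sum, map_sum]
  refine Finset.sum_congr rfl fun N hN => ?_
  rw [Finset.mem_range] at hN
  rw [map_smul, PowerSeries.coeff_smul, hT.X_pow, PowerSeries.coeff_X_pow_mul',
    if_pos (by omega)]

/-- To identify a linear combination of deformed products it suffices to compare terms. -/
theorem tlinear_circ_eq {T : Module.End R (Fed R g n A)} (hT : TLinear T)
    {a a' a₁ a₁' : Fed R g n A}
    (h : ∀ N, T (moyalL p N a a') = moyalL p N a₁ a₁') :
    T (circL p a a') = circL p a₁ a₁' := PowerSeries.ext fun m => by
  rw [coeff_tlinear_circ p hT, ← circ_eq, coeff_circ]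
  exact Finset.sum_congr rfl fun N _ => by rw [h]

theorem tlinear_circ_eq_add {T : Module.End R (Fed R g n A)} (hT : TLinear T)
    {a a' a₁ a₁' a₂ a₂' : Fed R g n A}
    (h : ∀ N, T (moyalL p N a a') = moyalL p N a₁ a₁' + moyalL p N a₂ a₂') :
    T (circL p a a') = circL p a₁ a₁' + circL p a₂ a₂' := PowerSeries.ext fun m => by
  rw [coeff_tlinear_circ p hT, map_add, ← circ_eq, ← circ_eq, coeff_circ, coeff_circ,
    ← Finset.sum_add_distrib]
  exact Finset.sum_congr rfl fun N _ => by rw [h, map_add, smul_add]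

theorem circ_X_left (a a' : Fed R g n A) :
    circL p (PowerSeries.X * a) a' = PowerSeries.X * circL p a a' :=
  (tlinear_circ_eq p (T := LinearMap.mulLeft R (PowerSeries.X : Fed R g n A)) (fun _ => rfl)
    fun N => (moyalL_X_left p N a a').symm).symm

theorem circ_X_right (a a' : Fed R g n A) :
    circL p a (PowerSeries.X * a') = PowerSeries.X * circL p a a' :=
  (tlinear_circ_eq p (T := LinearMap.mulLeft R (PowerSeries.X : Fed R g n A)) (fun _ => rfl)
    fun N => (moyalL_X_right p N a a').symm).symm

/-- Associativity in order `K`: by the binomial theorem for commuting operators, both sides equal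
the weight of `K` times `(P12 + P13 + P23)^K` applied to the triple product. -/
theorem moyal_sum_eq {a a' a'' : Fed R g n A} (K : ℕ) :
    ∑ N ∈ Finset.range (K + 1), (wt R N * wt R (K - N)) • moyalL p N (moyalL p (K - N) a a') a''
    = ∑ N ∈ Finset.range (K + 1),
      (wt R N * wt R (K - N)) • moyalL p N a (moyalL p (K - N) a' a'') := by
  have key : ∀ Q Q' : Module.End R (Tri R g n A), Commute Q Q' →
      ∑ N ∈ Finset.range (K + 1), (wt R N * wt R (K - N)) •
        ((Q ^ N * Q' ^ (K - N)) fun a a' a'' => a * a' * a'') a a' a''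
      = wt R K • (((Q + Q') ^ K) fun a a' a'' => a * a' * a'') a a' a'' := by
    intro Q Q' h
    rw [h.add_pow, LinearMap.sum_apply, Finset.sum_apply, Finset.sum_apply, Finset.sum_apply,
      Finset.smul_sum]
    refine Finset.sum_congr rfl fun N hN => ?_
    rw [Finset.mem_range] at hN
    have hK : N + (K - N) = K := by omega
    rw [wt_mul_wt, hK, mul_smul, Nat.cast_smul_eq_nsmul, ← Nat.cast_comm, ← nsmul_eq_mul]
    rfl
  simp only [moyalL_moyalL_left, moyalL_moyalL_right]
  rw [key _ _ ((P12_comm_P13 p).symm.add_left (P12_comm_P23 p).symm),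
    key _ _ ((P12_comm_P23 p).add_left (P13_comm_P23 p))]
  rw [show P13 p + P23 p + P12 p = P12 p + P13 p + P23 p by abel]

theorem circ_assoc (a a' a'' : Fed R g n A) :
    circL p (circL p a a') a'' = circL p a (circL p a' a'') := PowerSeries.ext fun m => by
  rw [← circ_eq p (circL p a a') a'', ← circ_eq p a (circL p a' a''), coeff_circ, coeff_circ]
  -- With its other argument fixed, `moyalL p N` is itself a `t`-linear operator, so the inner
  -- deformed product can be expanded inside it.
  have h1 : ∀ N, PowerSeries.coeff (m - N) (moyalL p N (circL p a a') a'') =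
      ∑ M ∈ Finset.range (m - N + 1),
        wt R M • PowerSeries.coeff (m - N - M) (moyalL p N (moyalL p M a a') a'') := fun N =>
    coeff_tlinear_circ p (T := (moyalL p N).flip a'') (fun _ => moyalL_X_left p N _ _) _ _ _
  have h2 : ∀ N, PowerSeries.coeff (m - N) (moyalL p N a (circL p a' a'')) =
      ∑ M ∈ Finset.range (m - N + 1),
        wt R M • PowerSeries.coeff (m - N - M) (moyalL p N a (moyalL p M a' a'')) := fun N =>
    coeff_tlinear_circ p (T := moyalL p N a) (fun _ => moyalL_X_right p N _ _) _ _ _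
  simp only [h1, h2, Finset.smul_sum, smul_smul]
  -- The double sum is regrouped by the total order `K = N + M` in `P`, the order in which
  -- `moyal_sum_eq` applies.
  have h3 : ∀ f : ℕ → ℕ → MvPowerSeries (Fin n) (Cf R g A),
      ∑ N ∈ Finset.range (m + 1), ∑ M ∈ Finset.range (m - N + 1), f N M
      = ∑ K ∈ Finset.range (m + 1), ∑ N ∈ Finset.range (K + 1), f N (K - N) := fun f => by
    rw [Finset.sum_range_diag_flip]
    refine Finset.sum_congr rfl fun N hN => ?_
    rw [Finset.mem_range] at hN
    rw [show m + 1 - N = m - N + 1 by omega]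
  rw [h3, h3]
  refine Finset.sum_congr rfl fun K hK => ?_
  have := congrArg (PowerSeries.coeff (m - K)) (moyal_sum_eq p (a := a) (a' := a') (a'' := a'') K)
  simp only [map_sum, PowerSeries.coeff_smul] at this
  convert this using 1
  all_goals
    refine Finset.sum_congr rfl fun N hN => ?_
    rw [Finset.mem_range] at hN hK
    rw [show m - N - (K - N) = m - K by omega]

end Circ

/-! ### The degree of forms and the Euler operator. -/

section FormDegree

variable {R g : Type*} [CommRing R] [LieRing g] [LieAlgebra R g]

theorem extPow_induction {C : ℕ → Forms R g → Prop}
    (h0 : ∀ r : R, C 0 (algebraMap R _ r)) (hadd : ∀ (l : ℕ) (x y : Forms R g), C l x → C l y → C l (x + y))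
    (hmul : ∀ (v : Module.Dual R g) (l : ℕ) (x : Forms R g), x ∈ ⋀[R]^l (Module.Dual R g) →
      C l x → C (l + 1) (ExteriorAlgebra.ι R v * x))
    {l : ℕ} {α : Forms R g} (hα : α ∈ ⋀[R]^l (Module.Dual R g)) : C l α := by
  refine Submodule.pow_induction_on_left' (LinearMap.range (ExteriorAlgebra.ι R))
    (C := fun l x _ => C l x) h0 (fun x y l _ _ hx hy => hadd l x y hx hy) ?_ hα
  rintro _ ⟨v, rfl⟩ l x hx hC
  exact hmul v l x hx hC

theorem ι_mul_mem (v : Module.Dual R g) {l : ℕ} {α : Forms R g}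
    (hα : α ∈ ⋀[R]^l (Module.Dual R g)) :
    ExteriorAlgebra.ι R v * α ∈ ⋀[R]^(l + 1) (Module.Dual R g) := by
  rw [ExteriorAlgebra.exteriorPower, pow_succ']
  exact Submodule.mul_mem_mul (LinearMap.mem_range_self _ v) hα

theorem insForm_algebraMap (X : g) (r : R) : insForm X (algebraMap R (Forms R g) r) = 0 :=
  CliffordAlgebra.contractLeft_algebraMap (Q := 0) (Module.Dual.eval R g X) r

theorem insForm_ι_mul (X : g) (v : Module.Dual R g) (α : Forms R g) :
    insForm X (ExteriorAlgebra.ι R v * α) = v X • α - ExteriorAlgebra.ι R v * insForm X α :=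
  CliffordAlgebra.contractLeft_ι_mul (Q := 0) (d := Module.Dual.eval R g X) v α

theorem insForm_mem (X : g) {l : ℕ} {α : Forms R g} (hα : α ∈ ⋀[R]^(l + 1) (Module.Dual R g)) :
    insForm X α ∈ ⋀[R]^l (Module.Dual R g) := by
  refine extPow_induction (C := fun k x => ∀ l, k = l + 1 →
    insForm X x ∈ ⋀[R]^l (Module.Dual R g)) ?_ ?_ ?_ hα l rfl
  · intro r l h; omega
  · intro l x y hx hy k hk
    rw [map_add]; exact add_mem (hx k hk) (hy k hk)
  · intro v l x hx hC k hk
    obtain rfl : l = k := by omega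
    rw [insForm_ι_mul]
    refine sub_mem (Submodule.smul_mem _ _ hx) ?_
    cases l with
    | zero =>
      rw [ExteriorAlgebra.exteriorPower, pow_zero] at hx
      obtain ⟨r, rfl⟩ := Submodule.mem_one.1 hx
      rw [insForm_algebraMap, mul_zero]; exact zero_mem _
    | succ l => exact ι_mul_mem v (hC l rfl)

theorem insForm_eq_zero (X : g) {α : Forms R g} (hα : α ∈ ⋀[R]^0 (Module.Dual R g)) :
    insForm X α = 0 := by
  rw [ExteriorAlgebra.exteriorPower, pow_zero] at hα
  obtain ⟨r, rfl⟩ := Submodule.mem_one.1 hα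
  exact insForm_algebraMap _ _

theorem signForm_of_mem {l : ℕ} {α : Forms R g} (hα : α ∈ ⋀[R]^l (Module.Dual R g)) :
    signForm α = (-1 : R) ^ l • α := by
  refine extPow_induction (C := fun l x => signForm x = (-1 : R) ^ l • x) ?_ ?_ ?_ hα
  · intro r; simp [signForm]
  · intro l x y hx hy; rw [map_add, hx, hy, smul_add]
  · intro v l x _ hx
    rw [signForm_mul, signForm_ι, hx, pow_succ', mul_smul, neg_smul, one_smul, mul_smul_comm,
      neg_mul, smul_neg]

theorem extPow_mul_comm {l : ℕ} {α : Forms R g} (hα : α ∈ ⋀[R]^l (Module.Dual R g))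
    (β : Forms R g) : α * β = (signForm^[l] β) * α := by
  refine extPow_induction (C := fun l x => ∀ β, x * β = (signForm^[l] β) * x) ?_ ?_ ?_ hα β
  · intro r β; exact Algebra.commutes r β
  · intro l x y hx hy β; rw [add_mul, mul_add, hx, hy]
  · intro v l x _ hx β
    rw [mul_assoc, hx, ← mul_assoc, ι_mul_comm, mul_assoc, Function.iterate_succ_apply']

theorem projForm_of_mem {l : ℕ} {α : Forms R g} (hα : α ∈ ⋀[R]^l (Module.Dual R g)) :
    projForm l α = α := by
  rw [projForm, GradedAlgebra.proj_apply]
  exact DirectSum.decompose_of_mem_same _ hα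

theorem projForm_of_mem_ne {k l : ℕ} {α : Forms R g} (hα : α ∈ ⋀[R]^k (Module.Dual R g))
    (h : k ≠ l) : projForm l α = 0 := by
  rw [projForm, GradedAlgebra.proj_apply]
  exact DirectSum.decompose_of_mem_ne _ hα h

theorem projForm_mem (l : ℕ) (α : Forms R g) : projForm l α ∈ ⋀[R]^l (Module.Dual R g) := by
  rw [projForm, GradedAlgebra.proj_apply]
  exact SetLike.coe_mem _

theorem forms_linearMap_ext {M : Type*} [AddCommMonoid M] [Module R M]
    {f f' : Forms R g →ₗ[R] M}
    (h : ∀ (l : ℕ), ∀ α ∈ ⋀[R]^l (Module.Dual R g), f α = f' α) : f = f' := by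
  refine LinearMap.ext fun α => ?_
  induction α using DirectSum.Decomposition.inductionOn
    (ℳ := fun l : ℕ => ⋀[R]^l (Module.Dual R g)) with
  | zero => simp
  | homogeneous m => exact h _ _ m.2
  | add x y hx hy => rw [map_add, map_add, hx, hy]

variable {n : ℕ} (b : Module.Basis (Fin n) R g)

/-- A basis of the `l`-th exterior power is indexed by the `l`-subsets of `Fin n`, of which there
are none for `l > n`. Hence the sum up to `n` in `divDeg` omits nothing. -/
theorem exteriorPower_eq_zero (b : Module.Basis (Fin n) R g) {l : ℕ} (hl : n < l) {α : Forms R g}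
    (hα : α ∈ ⋀[R]^l (Module.Dual R g)) : α = 0 := by
  have hs : Subsingleton (⋀[R]^l (Module.Dual R g)) := by
    have hE : IsEmpty (Set.powersetCard (Fin n) l) := ⟨fun s => by
      have h1 := s.2
      have h2 := Finset.card_le_univ s.1
      rw [Set.powersetCard.mem_iff] at h1
      rw [h1, Fintype.card_fin] at h2
      omega⟩
    exact ((b.dualBasis.exteriorPower l).repr.toEquiv.subsingleton_congr).2 inferInstance
  exact congrArg Subtype.val (Subsingleton.elim (⟨α, hα⟩ : ⋀[R]^l (Module.Dual R g)) 0)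

theorem sum_projForm (b : Module.Basis (Fin n) R g) : ∑ l ∈ Finset.range (n + 1), projForm (R := R) (g := g) l
    = LinearMap.id := by
  refine forms_linearMap_ext fun k α hα => ?_
  rw [LinearMap.sum_apply, LinearMap.id_apply]
  by_cases hk : k < n + 1
  · rw [Finset.sum_eq_single k (fun l _ hl => projForm_of_mem_ne hα (Ne.symm hl))
      (fun h => absurd (Finset.mem_range.2 hk) h), projForm_of_mem hα]
  · rw [exteriorPower_eq_zero b (by omega) hα]; simp

/-- The operator `e^i ∧ i_a(e_i)`, counting the antisymmetric degree. -/
def numForm : Forms R g →ₗ[R] Forms R g :=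
  ∑ i, LinearMap.mulLeft R (dualVec b i) ∘ₗ insForm (b i)

theorem numForm_apply (α : Forms R g) :
    numForm b α = ∑ i, dualVec b i * insForm (b i) α := by
  simp [numForm]

theorem sum_smul_dualVec (v : Module.Dual R g) :
    ∑ i, v (b i) • dualVec b i = ExteriorAlgebra.ι R v := by
  simp only [dualVec, ← map_smul, ← map_sum]
  congr 1
  exact b.sum_dual_apply_smul_coord v

/-- Euler's identity. Contracting the new factor `v` returns `v` itself, because `v(e_i) e^i = v`;
moving `e^i` past `v` costs a sign that cancels the one of the contraction, leaving the degree of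
the rest. -/
theorem numForm_of_mem {l : ℕ} {α : Forms R g} (hα : α ∈ ⋀[R]^l (Module.Dual R g)) :
    numForm b α = (l : R) • α := by
  refine extPow_induction (C := fun l x => numForm b x = (l : R) • x) ?_ ?_ ?_ hα
  · intro r; simp [numForm_apply, insForm_algebraMap]
  · intro l x y hx hy; rw [map_add, hx, hy, smul_add]
  · intro v l x _ hx
    rw [numForm_apply]
    simp only [insForm_ι_mul, mul_sub, Finset.sum_sub_distrib, mul_smul_comm]
    simp only [← smul_mul_assoc, ← Finset.sum_mul, sum_smul_dualVec]
    have h : ∑ i, dualVec b i * (ExteriorAlgebra.ι R v * insForm (b i) x)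
        = -(ExteriorAlgebra.ι R v * numForm b x) := by
      rw [numForm_apply, Finset.mul_sum, ← Finset.sum_neg_distrib]
      refine Finset.sum_congr rfl fun i _ => ?_
      rw [← mul_assoc, ← mul_assoc, ← neg_mul]
      congr 1
      exact eq_neg_of_add_eq_zero_left (ExteriorAlgebra.ι_add_mul_swap _ _)
    rw [h, hx, sub_neg_eq_add, mul_smul_comm, Nat.cast_add, add_smul, Nat.cast_one, one_smul,
      add_comm, add_mul, smul_mul_assoc]

theorem numForm_projForm (l : ℕ) : numForm b ∘ₗ projForm l = (l : R) • projForm l :=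
  LinearMap.ext fun α => numForm_of_mem b (projForm_mem l α)

theorem projForm_numForm (l : ℕ) : projForm l ∘ₗ numForm b = (l : R) • projForm l := by
  refine forms_linearMap_ext fun k α hα => ?_
  rw [LinearMap.comp_apply, numForm_of_mem b hα, map_smul, LinearMap.smul_apply]
  by_cases h : k = l
  · rw [h]
  · rw [projForm_of_mem_ne hα h, smul_zero, smul_zero]

theorem projForm_zero (α : Forms R g) :
    projForm 0 α = algebraMap R _ (ExteriorAlgebra.algebraMapInv α) := by
  have h : (projForm 0 : Forms R g →ₗ[R] Forms R g) =
      Algebra.linearMap R (Forms R g) ∘ₗ ExteriorAlgebra.algebraMapInv.toLinearMap := by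
    refine forms_linearMap_ext fun k α hα => ?_
    cases k with
    | zero =>
      rw [projForm_of_mem hα]
      rw [ExteriorAlgebra.exteriorPower, pow_zero] at hα
      obtain ⟨r, rfl⟩ := Submodule.mem_one.1 hα
      simp [ExteriorAlgebra.algebraMapInv]
    | succ k =>
      rw [projForm_of_mem_ne hα (by omega)]
      have h1 : ExteriorAlgebra.algebraMapInv α = 0 :=
        extPow_induction (C := fun k x => k ≠ 0 → ExteriorAlgebra.algebraMapInv x = 0)
          (fun _ h => absurd rfl h)
          (fun l x y hx hy h => by rw [map_add, hx h, hy h, add_zero])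
          (fun v l x _ _ _ => by simp [ExteriorAlgebra.algebraMapInv]) hα (by omega)
      simp [h1]
  exact LinearMap.congr_fun h α

end FormDegree

/-! ### Homogeneous antisymmetric degree in the Fedosov algebra. -/

section FedDegree

variable (R g : Type*) [CommRing R] [LieRing g] [LieAlgebra R g]
  (A : Type*) [Ring A] [Algebra R A]

/-- `A ⊗ Λ^ℓ g*` in `A ⊗ Λ^• g*`. -/
def CfForm (l : ℕ) : Submodule R (Cf R g A) :=
  Submodule.span R {c | ∃ a : A, ∃ α ∈ ⋀[R]^l (Module.Dual R g), a ⊗ₜ α = c}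

variable {R g A} {n : ℕ}

theorem tmul_mem_CfForm (a : A) {l : ℕ} {α : Forms R g} (hα : α ∈ ⋀[R]^l (Module.Dual R g)) :
    a ⊗ₜ[R] α ∈ CfForm R g A l := Submodule.subset_span ⟨a, α, hα, rfl⟩

theorem CfForm_induction {l : ℕ} {C : Cf R g A → Prop} (h0 : C 0)
    (hadd : ∀ x y, C x → C y → C (x + y)) (hsmul : ∀ (r : R) x, C x → C (r • x))
    (ht : ∀ (a : A), ∀ α ∈ ⋀[R]^l (Module.Dual R g), C (a ⊗ₜ α)) {c : Cf R g A}
    (hc : c ∈ CfForm R g A l) : C c := by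
  induction hc using Submodule.span_induction with
  | mem x hx => obtain ⟨a, α, hα, rfl⟩ := hx; exact ht a α hα
  | zero => exact h0
  | add x y _ _ hx hy => exact hadd x y hx hy
  | smul r x _ hx => exact hsmul r x hx

theorem lTensor_congr_CfForm {M : Type*} [AddCommGroup M] [Module R M] {l : ℕ}
    {f f' : Forms R g →ₗ[R] M}
    (h : ∀ α ∈ ⋀[R]^l (Module.Dual R g), f α = f' α) {c : Cf R g A} (hc : c ∈ CfForm R g A l) :
    LinearMap.lTensor A f c = LinearMap.lTensor A f' c :=
  CfForm_induction (C := fun c => LinearMap.lTensor A f c = LinearMap.lTensor A f' c)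
    (by simp) (fun x y hx hy => by rw [map_add, hx, hy, map_add])
    (fun r x hx => by rw [map_smul, hx, map_smul])
    (fun a α hα => by rw [LinearMap.lTensor_tmul, h α hα, LinearMap.lTensor_tmul]) hc

theorem lTensor_mem_CfForm {l l' : ℕ} {f : Forms R g →ₗ[R] Forms R g}
    (h : ∀ α ∈ ⋀[R]^l (Module.Dual R g), f α ∈ ⋀[R]^l' (Module.Dual R g)) {c : Cf R g A}
    (hc : c ∈ CfForm R g A l) : LinearMap.lTensor A f c ∈ CfForm R g A l' :=
  CfForm_induction (C := fun c => LinearMap.lTensor A f c ∈ CfForm R g A l')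
    (by simp) (fun x y hx hy => by rw [map_add]; exact add_mem hx hy)
    (fun r x hx => by rw [map_smul]; exact Submodule.smul_mem _ _ hx)
    (fun a α hα => by rw [LinearMap.lTensor_tmul]; exact tmul_mem_CfForm a (h α hα)) hc

theorem lTensor_projForm_mem (l : ℕ) (c : Cf R g A) :
    LinearMap.lTensor A (projForm l) c ∈ CfForm R g A l := by
  induction c using TensorProduct.induction_on with
  | zero => simp
  | add x y hx hy => rw [map_add]; exact add_mem hx hy
  | tmul a α => exact tmul_mem_CfForm a (projForm_mem l α)

theorem lTensor_projForm_of_mem {l : ℕ} {c : Cf R g A} (hc : c ∈ CfForm R g A l) :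
    LinearMap.lTensor A (projForm l) c = c := by
  rw [lTensor_congr_CfForm (f' := LinearMap.id) (fun α hα => projForm_of_mem hα) hc]
  simp

theorem mul_mem_CfForm {k l : ℕ} {c c' : Cf R g A} (hc : c ∈ CfForm R g A k)
    (hc' : c' ∈ CfForm R g A l) : c * c' ∈ CfForm R g A (k + l) :=
  CfForm_induction (C := fun c => c * c' ∈ CfForm R g A (k + l))
    (by simp) (fun x y hx hy => by rw [add_mul]; exact add_mem hx hy)
    (fun r x hx => by rw [smul_mul_assoc]; exact Submodule.smul_mem _ _ hx)
    (fun a α hα => CfForm_induction (C := fun c' => a ⊗ₜ[R] α * c' ∈ CfForm R g A (k + l))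
      (by simp) (fun x y hx hy => by rw [mul_add]; exact add_mem hx hy)
      (fun r x hx => by rw [mul_smul_comm]; exact Submodule.smul_mem _ _ hx)
      (fun a' β hβ => by
        rw [Algebra.TensorProduct.tmul_mul_tmul]
        refine tmul_mem_CfForm _ ?_
        rw [ExteriorAlgebra.exteriorPower, pow_add]
        exact Submodule.mul_mem_mul hα hβ) hc') hc

/-- Elements of antisymmetric degree `ℓ`. -/
def IsForm (l : ℕ) (a : Fed R g n A) : Prop := ∀ m κ, cf m κ a ∈ CfForm R g A l

theorem projA_eq_iff {l : ℕ} {a : Fed R g n A} : projA l a = a ↔ IsForm l a := by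
  constructor
  · intro h m κ
    rw [← h, projA, cf_mapCf]; exact lTensor_projForm_mem l _
  · intro h
    refine fed_ext fun m κ => ?_
    rw [projA, cf_mapCf, lTensor_projForm_of_mem (h m κ)]

namespace IsForm

variable {l k : ℕ} {a a' : Fed R g n A}

theorem zero (l : ℕ) : IsForm l (0 : Fed R g n A) := fun m κ => by
  rw [cf_zero]; exact zero_mem _

theorem add (h : IsForm l a) (h' : IsForm l a') : IsForm l (a + a') := fun m κ => by
  rw [cf_add]; exact add_mem (h m κ) (h' m κ)

theorem neg (h : IsForm l a) : IsForm l (-a) := fun m κ => by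
  rw [cf_neg]; exact neg_mem (h m κ)

theorem sub (h : IsForm l a) (h' : IsForm l a') : IsForm l (a - a') := fun m κ => by
  rw [cf_sub]; exact sub_mem (h m κ) (h' m κ)

theorem smul (h : IsForm l a) (c : R) : IsForm l (c • a) := fun m κ => by
  rw [cf_smul]; exact Submodule.smul_mem _ _ (h m κ)

theorem sum {ι : Type*} {s : Finset ι} {f : ι → Fed R g n A} (h : ∀ i ∈ s, IsForm l (f i)) :
    IsForm l (∑ i ∈ s, f i) := fun m κ => by
  rw [cf_sum]; exact Submodule.sum_mem _ fun i hi => h i hi m κ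

theorem mul (h : IsForm k a) (h' : IsForm l a') : IsForm (k + l) (a * a') := fun m κ => by
  rw [cf_mul]
  exact Submodule.sum_mem _ fun p _ => Submodule.sum_mem _ fun q _ =>
    mul_mem_CfForm (h _ _) (h' _ _)

theorem opD (h : IsForm l a) (i : Fin n) : IsForm l (opD i a) := fun m κ => by
  rw [cf_opD]; exact Submodule.smul_of_tower_mem _ _ (h _ _)

theorem opY (h : IsForm l a) (i : Fin n) : IsForm l (opY i a) := fun m κ => by
  rw [cf_opY]
  split_ifs
  · exact zero_mem _
  · exact h _ _

theorem opE (h : IsForm l a) (b : Module.Basis (Fin n) R g) (i : Fin n) :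
    IsForm (l + 1) (opE b i a) := fun m κ => by
  rw [cf_opE, add_comm]
  refine mul_mem_CfForm (tmul_mem_CfForm _ ?_) (h m κ)
  rw [ExteriorAlgebra.exteriorPower, pow_one]
  exact LinearMap.mem_range_self _ _

theorem opI (h : IsForm (l + 1) a) (b : Module.Basis (Fin n) R g) (i : Fin n) :
    IsForm l (opI b i a) := fun m κ => by
  rw [cf_opI]; exact lTensor_mem_CfForm (fun α hα => insForm_mem _ hα) (h m κ)

theorem opI_eq_zero (h : IsForm 0 a) (b : Module.Basis (Fin n) R g) (i : Fin n) :
    Fedosov.opI b i a = 0 := fed_ext fun m κ => by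
  rw [cf_opI, lTensor_congr_CfForm (f' := 0) (fun α hα => insForm_eq_zero _ hα) (h m κ)]
  simp

theorem opS_eq (h : IsForm l a) : opS a = (-1 : R) ^ l • a := fed_ext fun m κ => by
  rw [cf_opS, lTensor_congr_CfForm (f' := (-1 : R) ^ l • LinearMap.id)
    (fun α hα => signForm_of_mem hα) (h m κ), cf_smul]
  simp

theorem divT (h : IsForm l a) : IsForm l (divT a) := fun m κ => by
  rw [cf_divT]; exact h _ _

theorem one : IsForm 0 (1 : Fed R g n A) := fun m κ => by
  rw [cf_one]
  split_ifs
  · refine tmul_mem_CfForm _ ?_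
    rw [ExteriorAlgebra.exteriorPower, pow_zero]; exact Submodule.one_le.1 le_rfl
  · exact zero_mem _

theorem moyalL (p : Matrix (Fin n) (Fin n) R) (N : ℕ) (h : IsForm k a) (h' : IsForm l a') :
    IsForm (k + l) (moyalL p N a a') := by
  induction N generalizing a a' with
  | zero => exact h.mul h'
  | succ N ih =>
    rw [moyalL_succ]
    exact IsForm.sum fun i _ => IsForm.sum fun j _ => (ih (h.opD i) (h'.opD j)).smul _

end IsForm

theorem isForm_incl (ξ : PowerSeries A) : IsForm 0 (incl ξ : Fed R g n A) := fun m κ => by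
  classical
  rw [cf, incl, PowerSeries.coeff_map, RingHom.comp_apply, MvPowerSeries.coeff_C]
  split_ifs
  · refine tmul_mem_CfForm _ ?_
    rw [ExteriorAlgebra.exteriorPower, pow_zero]; exact Submodule.one_le.1 le_rfl
  · exact zero_mem _

end FedDegree

/-! ### The filtration by total degree. -/

section Filtration

variable {R g : Type*} [CommRing R] [LieRing g] [LieAlgebra R g] {n : ℕ}
  {A : Type*} [Ring A] [Algebra R A]

theorem cf_circL [Algebra ℚ R] (p : Matrix (Fin n) (Fin n) R) (m : ℕ) (κ : Fin n →₀ ℕ)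
    (a a' : Fed R g n A) : cf m κ (circL p a a') =
      ∑ N ∈ Finset.range (m + 1), wt R N • cf (m - N) κ (moyalL p N a a') := by
  rw [cf, ← circ_eq, coeff_circ, map_sum]
  rfl

theorem eq_zero_of_inFiltration {a : Fed R g n A} (h : ∀ k, InFiltration k a) : a = 0 :=
  fed_ext fun m κ => by rw [h (2 * m + κ.degree + 1) m κ (by omega), cf_zero]

namespace InFiltration

variable {l k : ℕ} {a a' : Fed R g n A}

theorem zero_left (a : Fed R g n A) : InFiltration 0 a := fun _ _ h => absurd h (by omega)

theorem zero (l : ℕ) : InFiltration l (0 : Fed R g n A) := fun m κ _ => cf_zero m κ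

theorem mono (h : InFiltration l a) (hk : k ≤ l) : InFiltration k a := fun m κ hm =>
  h m κ (by omega)

theorem add (h : InFiltration l a) (h' : InFiltration l a') : InFiltration l (a + a') :=
  fun m κ hm => by rw [cf_add, h m κ hm, h' m κ hm, add_zero]

theorem neg (h : InFiltration l a) : InFiltration l (-a) := fun m κ hm => by
  rw [cf_neg, h m κ hm, neg_zero]

theorem sub (h : InFiltration l a) (h' : InFiltration l a') : InFiltration l (a - a') :=
  fun m κ hm => by rw [cf_sub, h m κ hm, h' m κ hm, sub_zero]

theorem smul (h : InFiltration l a) (c : R) : InFiltration l (c • a) := fun m κ hm => by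
  rw [cf_smul, h m κ hm, smul_zero]

theorem sum {ι : Type*} {s : Finset ι} {f : ι → Fed R g n A}
    (h : ∀ i ∈ s, InFiltration l (f i)) : InFiltration l (∑ i ∈ s, f i) := fun m κ hm => by
  rw [cf_sum]; exact Finset.sum_eq_zero fun i hi => h i hi m κ hm

theorem mul (h : InFiltration k a) (h' : InFiltration l a') :
    InFiltration (k + l) (a * a') := fun m κ hm => by
  rw [cf_mul]
  refine Finset.sum_eq_zero fun p hp => Finset.sum_eq_zero fun q hq => ?_
  rw [Finset.HasAntidiagonal.mem_antidiagonal] at hp hq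
  have hd : q.1.degree + q.2.degree = κ.degree := by rw [← hq, map_add]
  by_cases hk : 2 * p.1 + q.1.degree < k
  · rw [h _ _ hk, zero_mul]
  · rw [h' _ _ (by omega), mul_zero]

theorem mapEnd (h : InFiltration l a) (f : Module.End R (Cf R g A)) :
    InFiltration l (mapEnd R g n A f a) := fun m κ hm => by
  rw [cf_mapEnd, h m κ hm, map_zero]

theorem opD (h : InFiltration l a) (i : Fin n) : InFiltration (l - 1) (opD i a) :=
  fun m κ hm => by
    rw [cf_opD, h, smul_zero]
    rw [map_add, Finsupp.degree_single]; omega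

theorem opY (h : InFiltration l a) (i : Fin n) : InFiltration (l + 1) (opY i a) :=
  fun m κ hm => by
    rw [cf_opY]
    split_ifs with hi
    · rfl
    · have he : κ - Finsupp.single i 1 + Finsupp.single i 1 = κ := tsub_add_cancel_of_le (by
        rw [Finsupp.single_le_iff]; omega)
      have := congrArg Finsupp.degree he
      rw [map_add, Finsupp.degree_single] at this
      exact h _ _ (by omega)

theorem opE (h : InFiltration l a) (b : Module.Basis (Fin n) R g) (i : Fin n) :
    InFiltration l (opE b i a) := by rw [opE_eq_mapEnd]; exact h.mapEnd _

theorem opI (h : InFiltration l a) (b : Module.Basis (Fin n) R g) (i : Fin n) :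
    InFiltration l (opI b i a) := h.mapEnd _

theorem opS (h : InFiltration l a) : InFiltration l (opS a) := h.mapEnd _

theorem divT (h : InFiltration (l + 2) a) : InFiltration l (divT a) := fun m κ hm => by
  rw [cf_divT]; exact h _ _ (by omega)

theorem X_mul (h : InFiltration l a) : InFiltration (l + 2) (PowerSeries.X * a) :=
  fun m κ hm => by
    cases m with
    | zero => rw [cf_X_mul_zero]
    | succ m => rw [cf_X_mul_succ]; exact h _ _ (by omega)

theorem of_X_mul (h : InFiltration (l + 2) (PowerSeries.X * a)) : InFiltration l a :=
  fun m κ hm => by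
    rw [← cf_X_mul_succ]; exact h _ _ (by omega)

/-- Each `P` removes one `y` from either factor. Truncation of the subtraction is harmless, since
filtration degree zero imposes no condition. -/
theorem moyalL (p : Matrix (Fin n) (Fin n) R) (N : ℕ) (h : InFiltration k a)
    (h' : InFiltration l a') : InFiltration (k + l - 2 * N) (moyalL p N a a') := by
  induction N generalizing k l a a' with
  | zero => exact h.mul h'
  | succ N ih =>
    rw [moyalL_succ]
    exact InFiltration.sum fun i _ => InFiltration.sum fun j _ =>
      ((ih (h.opD i) (h'.opD j)).smul _).mono (by omega)

/-- The loss of `2 N` in `μ ∘ P^N` is made up exactly by the accompanying `t^N`, as `t` has total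
degree two. -/
theorem circL [Algebra ℚ R] (p : Matrix (Fin n) (Fin n) R) (h : InFiltration k a)
    (h' : InFiltration l a') : InFiltration (k + l) (circL p a a') := fun m κ hm => by
  rw [cf_circL]
  refine Finset.sum_eq_zero fun N hN => ?_
  rw [Finset.mem_range] at hN
  rw [InFiltration.moyalL p N h h' (m - N) κ (by omega), smul_zero]

end InFiltration

theorem IsForm.circL [Algebra ℚ R] (p : Matrix (Fin n) (Fin n) R) {k l : ℕ}
    {a a' : Fed R g n A} (h : IsForm k a)
    (h' : IsForm l a') : IsForm (k + l) (circL p a a') := fun m κ => by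
  rw [cf_circL]
  refine Submodule.sum_mem _ fun N _ => ?_
  exact Submodule.smul_mem _ _ (IsForm.moyalL p N h h' _ _)

end Filtration

theorem ring_neg_mul {α : Type*} [Ring α] (x y : α) : -x * y = -(x * y) := neg_mul x y

theorem ring_mul_neg {α : Type*} [Ring α] (x y : α) : x * -y = -(x * y) := mul_neg x y

/-! ### Cancelling integers over a ring containing the rationals. -/

section Torsion

variable {R : Type*} [CommRing R] [Algebra ℚ R]

theorem rat_mul_natCast (N : ℕ) (hN : N ≠ 0) : rat R (1 / (N : ℚ)) * (N : R) = 1 := by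
  rw [← map_natCast (algebraMap ℚ R) N, ← map_mul, one_div,
    inv_mul_cancel₀ (Nat.cast_ne_zero.2 hN), map_one]

theorem eq_zero_of_natCast_smul (R : Type*) {M : Type*} [CommRing R] [Algebra ℚ R]
    [AddCommGroup M] [Module R M] {N : ℕ} (hN : N ≠ 0) {x : M} (h : (N : R) • x = 0) : x = 0 := by
  rw [← one_smul R x, ← rat_mul_natCast N hN, mul_smul, h, smul_zero]

theorem eq_zero_of_eq_neg (R : Type*) {M : Type*} [CommRing R] [Algebra ℚ R]
    [AddCommGroup M] [Module R M] {x : M} (h : x = -x) : x = 0 :=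
  eq_zero_of_natCast_smul R two_ne_zero (by
    rw [Nat.cast_two, two_smul]; nth_rewrite 1 [h]; exact neg_add_cancel x)

theorem sum_eq_zero_of_antisymm (R : Type*) {M : Type*} [CommRing R] [Algebra ℚ R]
    [AddCommGroup M] [Module R M] {n : ℕ} (f : Fin n → Fin n → M)
    (h : ∀ i j, f i j = -f j i) : ∑ i, ∑ j, f i j = 0 := by
  refine eq_zero_of_eq_neg R ?_
  simp only [← Finset.sum_neg_distrib]
  rw [Finset.sum_comm]
  exact Finset.sum_congr rfl fun i _ => Finset.sum_congr rfl fun j _ => h _ _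

end Torsion

/-! ### The Koszul complex of `δ` and its contracting homotopy. -/

section Hodge

variable {R g : Type*} [CommRing R] [Algebra ℚ R] [LieRing g] [LieAlgebra R g] {n : ℕ}
  {A : Type*} [Ring A] [Algebra R A] (b : Module.Basis (Fin n) R g)

/-- `δ` as a linear map. -/
def opDelta : Module.End R (Fed R g n A) := ∑ i, opE b i * opD i

/-- `δ^*` as a linear map. -/
def opDeltaStar : Module.End R (Fed R g n A) := ∑ i, opY i * opI b i

theorem delta_eq (a : Fed R g n A) : delta b a = opDelta b a := by
  simp only [opDelta, LinearMap.sum_apply]; rfl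

theorem deltaStar_eq (a : Fed R g n A) : deltaStar b a = opDeltaStar b a := by
  simp only [opDeltaStar, LinearMap.sum_apply]; rfl

theorem opDelta_opDelta : (opDelta b * opDelta b : Module.End R (Fed R g n A)) = 0 := by
  simp only [opDelta, Finset.sum_mul_sum]
  refine sum_eq_zero_of_antisymm R _ fun i j => ?_
  rw [mul_assoc, ← mul_assoc (opD i), opD_opE, mul_assoc, ← mul_assoc, opE_opE, opD_opD,
    ring_neg_mul, mul_assoc, mul_assoc, ← mul_assoc (opD j), opD_opE, mul_assoc]

theorem opDeltaStar_opDeltaStar :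
    (opDeltaStar b * opDeltaStar b : Module.End R (Fed R g n A)) = 0 := by
  simp only [opDeltaStar, Finset.sum_mul_sum]
  refine sum_eq_zero_of_antisymm R _ fun i j => ?_
  rw [mul_assoc, ← mul_assoc (opI b i), ← opY_opI, mul_assoc, ← mul_assoc, opI_opI, opY_opY,
    ring_mul_neg, mul_assoc, mul_assoc, ← mul_assoc (opI b j), ← opY_opI, mul_assoc]

/-- The operator multiplying by the sum of the symmetric and the antisymmetric degree. -/
def opDeg : Module.End R (Fed R g n A) :=
  ∑ i, opY i * opD i + mapEnd R g n A (LinearMap.lTensor A (numForm b))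

theorem mapEnd_numForm : mapEnd R g n A (LinearMap.lTensor A (numForm b))
    = ∑ i, opE b i * opI b i := by
  refine LinearMap.ext fun a => fed_ext fun m κ => ?_
  simp only [cf_mapEnd, LinearMap.sum_apply, Module.End.mul_apply, cf_sum, cf_opE, cf_opI]
  induction cf m κ a using TensorProduct.induction_on with
  | zero => simp
  | add x y hx hy => simp only [map_add, hx, hy, mul_add, Finset.sum_add_distrib]
  | tmul x α =>
    simp only [LinearMap.lTensor_tmul, Algebra.TensorProduct.tmul_mul_tmul, one_mul,
      numForm_apply, TensorProduct.tmul_sum]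

/-- For `i = j` the relations `[∂_i, y^j] = δ_i^j` and `{i_a(e_j), e^i} = δ_j^i` leave the counting
operators of both degrees; for `i ≠ j` the two products cancel. -/
theorem opDelta_anticomm : (opDelta b * opDeltaStar b + opDeltaStar b * opDelta b :
    Module.End R (Fed R g n A)) = opDeg b := by
  have key : ∀ i j : Fin n, (opE b i * opD i * (opY j * opI b j)
      + opY j * opI b j * (opE b i * opD i) : Module.End R (Fed R g n A))
      = if i = j then opE b i * opI b i + opY i * opD i else 0 := fun i j => by
    have h1 : (opE b i * opD i * (opY j * opI b j) : Module.End R (Fed R g n A))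
        = opE b i * (opY j * opD i + if i = j then 1 else 0) * opI b j := by
      rw [← opD_opY]; simp only [mul_assoc]
    have h2 : (opY j * opI b j * (opE b i * opD i) : Module.End R (Fed R g n A))
        = opY j * ((if j = i then 1 else 0) - opE b i * opI b j) * opD i := by
      rw [← opI_opE]; simp only [mul_assoc]
    have h3 : (opE b i * (opY j * opD i) * opI b j : Module.End R (Fed R g n A))
        = opY j * (opE b i * opI b j) * opD i := by
      rw [← mul_assoc, ← opY_opE, mul_assoc, opD_opI]; simp only [mul_assoc]
    rw [h1, h2, mul_add, add_mul, mul_sub, sub_mul, h3]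
    by_cases h : i = j
    · subst h; simp only [if_true, mul_one]; abel
    · rw [if_neg h, if_neg (Ne.symm h), if_neg h]; simp
  have h2 : (∑ i, opY i * opI b i) * ∑ i, opE b i * opD i
      = ∑ i, ∑ j, opY j * opI b j * (opE b i * opD i : Module.End R (Fed R g n A)) := by
    rw [Finset.sum_mul_sum, Finset.sum_comm]
  rw [opDelta, opDeltaStar, h2, Finset.sum_mul_sum, opDeg, mapEnd_numForm]
  simp only [← Finset.sum_add_distrib, key, Finset.sum_ite_eq, Finset.mem_univ, if_true]
  exact Finset.sum_congr rfl fun i _ => add_comm _ _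

theorem cf_opDeg (m : ℕ) (κ : Fin n →₀ ℕ) (a : Fed R g n A) : cf m κ (opDeg b a) =
    (κ.degree : R) • cf m κ a + LinearMap.lTensor A (numForm b) (cf m κ a) := by
  rw [opDeg, LinearMap.add_apply, cf_add, cf_mapEnd, LinearMap.sum_apply, cf_sum]
  congr 1
  have h : ∀ i, cf m κ ((opY i * opD i : Module.End R (Fed R g n A)) a) = (κ i : R) • cf m κ a := fun i => by
    rw [Nat.cast_smul_eq_nsmul]; exact cf_symMul_insSym m κ i a
  simp only [h, ← Finset.sum_smul, ← Nat.cast_sum, Finsupp.degree_eq_sum]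

/-- The weight of `divDeg` in total degree `j`. -/
def degWt (R : Type*) [CommRing R] [Algebra ℚ R] (j : ℕ) : R :=
  if j = 0 then 0 else rat R (1 / (j : ℚ))

theorem degWt_mul (j : ℕ) : degWt R j * (j : R) = if j = 0 then 0 else 1 := by
  rw [degWt]
  split_ifs with h
  · exact zero_mul _
  · exact rat_mul_natCast j h

/-- `divDeg` as a linear map. -/
def opW : Module.End R (Fed R g n A) where
  toFun := divDeg
  map_add' _ _ := fed_ext fun _ _ => by
    simp only [divDeg, projA, cf_add, cf_mkFed, cf_mapCf, map_add, smul_add,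
      Finset.sum_add_distrib]
  map_smul' c _ := fed_ext fun _ _ => by
    simp only [divDeg, projA, cf_smul, cf_mkFed, cf_mapCf, map_smul, Finset.smul_sum,
      RingHom.id_apply]
    exact Finset.sum_congr rfl fun _ _ => smul_comm _ _ _

theorem divDeg_eq (a : Fed R g n A) : divDeg a = opW a := rfl

theorem cf_opW (m : ℕ) (κ : Fin n →₀ ℕ) (a : Fed R g n A) : cf m κ (opW a) =
    ∑ l ∈ Finset.range (n + 1), degWt R (κ.degree + l) •
      LinearMap.lTensor A (projForm l) (cf m κ a) := by
  simp only [← divDeg_eq, divDeg, projA, cf_mkFed, cf_mapCf, degWt]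

/-- The projection on symmetric and antisymmetric degree zero. -/
def opP : Module.End R (Fed R g n A) where
  toFun a := mkFed fun m κ => if κ = 0 then LinearMap.lTensor A (projForm 0) (cf m κ a) else 0
  map_add' _ _ := fed_ext fun _ κ => by
    by_cases h : κ = 0 <;> simp [h]
  map_smul' c _ := fed_ext fun _ κ => by
    by_cases h : κ = 0 <;> simp [h]

theorem cf_opP (m : ℕ) (κ : Fin n →₀ ℕ) (a : Fed R g n A) : cf m κ (opP a) =
    if κ = 0 then LinearMap.lTensor A (projForm 0) (cf m κ a) else 0 := by
  change cf m κ (mkFed fun m κ => if κ = 0 then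
    LinearMap.lTensor A (projForm 0) (cf m κ a) else 0) = _
  rw [cf_mkFed]

theorem lTensor_sum_projForm (b : Module.Basis (Fin n) R g) (c : Cf R g A) :
    ∑ l ∈ Finset.range (n + 1), LinearMap.lTensor A (projForm l) c = c := by
  rw [← LinearMap.sum_apply]
  have : ∑ l ∈ Finset.range (n + 1), LinearMap.lTensor A (projForm (R := R) (g := g) l)
      = LinearMap.lTensor A (∑ l ∈ Finset.range (n + 1), projForm (R := R) (g := g) l) :=
    (map_sum (LinearMap.lTensorHom A) _ _).symm
  rw [this, sum_projForm b]; simp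

/-- Weight times degree is `1` except in total degree zero, where the weight is zero by convention.
Only the component with `k = l = 0` is lost, and that is the projection `opP`. -/
theorem sum_degWt (b : Module.Basis (Fin n) R g) (k : ℕ) (c : Cf R g A) :
    ∑ l ∈ Finset.range (n + 1), (degWt R (k + l) * ((k + l : ℕ) : R)) •
      LinearMap.lTensor A (projForm l) c =
    c - if k = 0 then LinearMap.lTensor A (projForm 0) c else 0 := by
  simp only [degWt_mul]
  have hc := lTensor_sum_projForm b c
  split_ifs with hk
  · subst hk
    rw [Finset.sum_range_succ'] at hc ⊢
    rw [eq_sub_iff_add_eq]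
    refine Eq.trans ?_ hc
    simp
  · rw [sub_zero]
    refine Eq.trans ?_ hc
    refine Finset.sum_congr rfl fun l _ => ?_
    rw [if_neg (by omega), one_smul]

theorem opDeg_opW : (opDeg b * opW : Module.End R (Fed R g n A)) = 1 - opP := by
  refine LinearMap.ext fun a => fed_ext fun m κ => ?_
  rw [Module.End.mul_apply, cf_opDeg, cf_opW, LinearMap.sub_apply, cf_sub, cf_opP,
    Module.End.one_apply, map_sum, Finset.smul_sum, ← Finset.sum_add_distrib]
  have h := sum_degWt b κ.degree (cf m κ a)
  simp only [Finsupp.degree_eq_zero_iff] at h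
  rw [← h]
  refine Finset.sum_congr rfl fun l _ => ?_
  rw [map_smul, ← LinearMap.comp_apply, ← LinearMap.lTensor_comp, numForm_projForm,
    LinearMap.lTensor_smul, LinearMap.smul_apply, smul_smul, smul_smul, ← add_smul]
  congr 1
  push_cast; ring

theorem opW_opDeg : (opW * opDeg b : Module.End R (Fed R g n A)) = 1 - opP := by
  refine LinearMap.ext fun a => fed_ext fun m κ => ?_
  rw [Module.End.mul_apply, cf_opW, cf_opDeg, LinearMap.sub_apply, cf_sub, cf_opP,
    Module.End.one_apply]
  have h := sum_degWt b κ.degree (cf m κ a)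
  simp only [Finsupp.degree_eq_zero_iff] at h
  rw [← h]
  refine Finset.sum_congr rfl fun l _ => ?_
  rw [map_add, map_smul, ← LinearMap.comp_apply (LinearMap.lTensor A (projForm l)),
    ← LinearMap.lTensor_comp, projForm_numForm,
    LinearMap.lTensor_smul, LinearMap.smul_apply, smul_add, smul_smul, smul_smul, ← add_smul]
  congr 1
  push_cast; ring

theorem lTensor_projForm_zero_of_mem {l : ℕ} (hl : l ≠ 0) {c : Cf R g A}
    (hc : c ∈ CfForm R g A l) : LinearMap.lTensor A (projForm 0) c = 0 := by
  rw [lTensor_congr_CfForm (f' := 0) (fun α hα => projForm_of_mem_ne hα hl) hc]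
  simp

theorem IsForm.opP_eq_zero {l : ℕ} (hl : l ≠ 0) {a : Fed R g n A} (h : IsForm l a) :
    opP a = 0 := fed_ext fun m κ => by
  rw [cf_opP, lTensor_projForm_zero_of_mem hl (h m κ)]; simp

theorem isForm_opP (a : Fed R g n A) : IsForm 0 (opP a) := fun m κ => by
  rw [cf_opP]
  split_ifs
  · exact lTensor_projForm_mem _ _
  · exact zero_mem _

theorem forms_decomp (b : Module.Basis (Fin n) R g) (a : Fed R g n A) :
    a = ∑ l ∈ Finset.range (n + 1), mapEnd R g n A (LinearMap.lTensor A (projForm l)) a :=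
  fed_ext fun m κ => by
    simp only [cf_sum, cf_mapEnd, lTensor_sum_projForm b]

theorem isForm_mapEnd_projForm (l : ℕ) (a : Fed R g n A) :
    IsForm l (mapEnd R g n A (LinearMap.lTensor A (projForm l)) a) := fun m κ => by
  rw [cf_mapEnd]; exact lTensor_projForm_mem _ _

theorem opP_opDelta : (opP * opDelta b : Module.End R (Fed R g n A)) = 0 := by
  refine LinearMap.ext fun a => ?_
  rw [forms_decomp b a, map_sum, LinearMap.zero_apply]
  refine Finset.sum_eq_zero fun l _ => ?_
  rw [Module.End.mul_apply, opDelta, LinearMap.sum_apply]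
  exact IsForm.opP_eq_zero (Nat.succ_ne_zero l) (IsForm.sum fun i _ =>
    ((isForm_mapEnd_projForm l a).opD i).opE b i)

theorem opDelta_opP : (opDelta b * opP : Module.End R (Fed R g n A)) = 0 := by
  refine LinearMap.ext fun a => ?_
  have h : ∀ i, opD i (opP a) = 0 := fun i => fed_ext fun m κ => by
    rw [cf_opD, cf_opP, if_neg, smul_zero, cf_zero]
    intro h
    simpa using DFunLike.congr_fun h i
  simp only [opDelta, Module.End.mul_apply, LinearMap.sum_apply, h, map_zero,
    Finset.sum_const_zero, LinearMap.zero_apply]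

theorem opP_opDeltaStar : (opP * opDeltaStar b : Module.End R (Fed R g n A)) = 0 := by
  refine LinearMap.ext fun a => fed_ext fun m κ => ?_
  rw [Module.End.mul_apply, cf_opP, LinearMap.zero_apply, cf_zero]
  split_ifs with h
  · subst h
    simp [opDeltaStar, cf_opY]
  · rfl

theorem opDeltaStar_opP : (opDeltaStar b * opP : Module.End R (Fed R g n A)) = 0 := by
  refine LinearMap.ext fun a => ?_
  simp only [opDeltaStar, Module.End.mul_apply, LinearMap.sum_apply,
    (isForm_opP a).opI_eq_zero, map_zero, Finset.sum_const_zero, LinearMap.zero_apply]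

/-- `opW` inverts the degree operator off the image of `opP`. An operator commuting with the degree
and vanishing against `opP` on both sides therefore commutes with the inverse as well. -/
theorem opW_commute {T : Module.End R (Fed R g n A)} (h : T * opDeg b = opDeg b * T)
    (h1 : T * opP = 0) (h2 : opP * T = 0) : opW * T = T * opW := by
  have e1 : opW * T = opW * T * (opDeg b * opW + opP) := by
    rw [opDeg_opW]; simp
  rw [e1, mul_add, mul_assoc opW T opP, h1, mul_zero, add_zero, mul_assoc, ← mul_assoc T, h,
    mul_assoc, ← mul_assoc, opW_opDeg, sub_mul, one_mul, ← mul_assoc, h2, zero_mul, sub_zero]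

theorem opW_opDelta : (opW * opDelta b : Module.End R (Fed R g n A)) = opDelta b * opW := by
  refine opW_commute b ?_ (opDelta_opP b) (opP_opDelta b)
  -- Since `δ² = 0`, both `δ (δ δ* + δ* δ)` and `(δ δ* + δ* δ) δ` reduce to `δ δ* δ`.
  rw [← opDelta_anticomm, mul_add, add_mul, ← mul_assoc, opDelta_opDelta, ← mul_assoc,
    mul_assoc (opDeltaStar b), opDelta_opDelta, mul_zero, zero_mul, zero_add, add_zero]

theorem opW_opDeltaStar :
    (opW * opDeltaStar b : Module.End R (Fed R g n A)) = opDeltaStar b * opW := by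
  refine opW_commute b ?_ (opDeltaStar_opP b) (opP_opDeltaStar b)
  rw [← opDelta_anticomm, mul_add, add_mul, ← mul_assoc, ← mul_assoc, opDeltaStar_opDeltaStar,
    mul_assoc, mul_assoc, opDeltaStar_opDeltaStar, mul_zero, zero_mul, zero_add, add_zero]

/-- `δ^{-1}` as a linear map. -/
def opInv : Module.End R (Fed R g n A) := opDeltaStar b * opW

theorem deltaInv_eq (a : Fed R g n A) : deltaInv b a = opInv b a := deltaStar_eq b (divDeg a)

/-- The Hodge decomposition for `δ`. -/
theorem hodge : (opDelta b * opInv b + opInv b * opDelta b : Module.End R (Fed R g n A))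
    = 1 - opP := by
  rw [opInv, mul_assoc, opW_opDelta, ← mul_assoc, ← mul_assoc, ← add_mul, opDelta_anticomm,
    opDeg_opW]

theorem hodge_apply (a : Fed R g n A) :
    opDelta b (opInv b a) + opInv b (opDelta b a) = a - opP a := LinearMap.congr_fun (hodge b) a

theorem opInv_opInv : (opInv b * opInv b : Module.End R (Fed R g n A)) = 0 := by
  rw [opInv, mul_assoc, ← mul_assoc opW, opW_opDeltaStar, mul_assoc, ← mul_assoc,
    opDeltaStar_opDeltaStar, zero_mul]

theorem opP_opInv : (opP * opInv b : Module.End R (Fed R g n A)) = 0 := by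
  rw [opInv, ← mul_assoc, opP_opDeltaStar, zero_mul]

theorem IsForm.opW {l : ℕ} {a : Fed R g n A} (h : IsForm l a) : IsForm l (opW a) := fun m κ => by
  rw [cf_opW]
  refine Submodule.sum_mem _ fun k _ => Submodule.smul_mem _ _ ?_
  by_cases hk : l = k
  · subst hk; exact lTensor_projForm_mem _ _
  · rw [lTensor_congr_CfForm (f' := 0) (fun α hα => projForm_of_mem_ne hα hk) (h m κ)]
    simp

theorem InFiltration.opW {l : ℕ} {a : Fed R g n A} (h : InFiltration l a) :
    InFiltration l (opW a) := fun m κ hm => by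
  rw [cf_opW, h m κ hm]; simp

theorem IsForm.opInv {l : ℕ} {a : Fed R g n A} (h : IsForm (l + 1) a) : IsForm l (opInv b a) := by
  rw [Fedosov.opInv, Module.End.mul_apply, opDeltaStar, LinearMap.sum_apply]
  exact IsForm.sum fun i _ => (h.opW.opI b i).opY i

theorem IsForm.opInv_eq_zero {a : Fed R g n A} (h : IsForm 0 a) : Fedosov.opInv b a = 0 := by
  rw [Fedosov.opInv, Module.End.mul_apply, opDeltaStar, LinearMap.sum_apply]
  exact Finset.sum_eq_zero fun i _ => by
    rw [Module.End.mul_apply, h.opW.opI_eq_zero, map_zero]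

theorem InFiltration.opInv {l : ℕ} {a : Fed R g n A} (h : InFiltration l a) :
    InFiltration (l + 1) (opInv b a) := by
  rw [Fedosov.opInv, Module.End.mul_apply, opDeltaStar, LinearMap.sum_apply]
  exact InFiltration.sum fun i _ => (h.opW.opI b i).opY i

theorem IsForm.opDelta {l : ℕ} {a : Fed R g n A} (h : IsForm l a) :
    IsForm (l + 1) (opDelta b a) := by
  rw [Fedosov.opDelta, LinearMap.sum_apply]
  exact IsForm.sum fun i _ => (h.opD i).opE b i

theorem tlinear_opDelta : TLinear (opDelta b : Module.End R (Fed R g n A)) :=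
  TLinear.sum fun i _ => (tlinear_opE b i).mul (tlinear_opD i)

theorem cf_incl (m : ℕ) (κ : Fin n →₀ ℕ) (ξ : PowerSeries A) :
    cf m κ (incl ξ : Fed R g n A) = if κ = 0 then PowerSeries.coeff m ξ ⊗ₜ 1 else 0 := by
  classical
  rw [cf, incl, PowerSeries.coeff_map, RingHom.comp_apply, MvPowerSeries.coeff_C]
  rfl

/-- This links the projection with values in `A[[t]]` to the operator `opP` of the Hodge
decomposition. -/
theorem incl_sigma (a : Fed R g n A) : (incl (sigma a) : Fed R g n A) = opP a :=
  fed_ext fun m κ => by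
    rw [cf_incl, cf_opP]
    split_ifs with h
    · subst h
      rw [sigma, PowerSeries.coeff_mk]
      induction cf m 0 a using TensorProduct.induction_on with
      | zero => simp
      | add x y hx hy => simp only [map_add, TensorProduct.add_tmul, hx, hy]
      | tmul x α =>
        rw [LinearMap.lTensor_tmul, LinearMap.lTensor_tmul, TensorProduct.rid_tmul,
          projForm_zero, Algebra.algebraMap_eq_smul_one, TensorProduct.tmul_smul,
          TensorProduct.smul_tmul']; rfl
    · rfl

theorem sigma_incl (ξ : PowerSeries A) : sigma (incl ξ : Fed R g n A) = ξ :=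
  PowerSeries.ext fun m => by
    rw [sigma, PowerSeries.coeff_mk, cf_incl, if_pos rfl]
    simp

theorem opP_incl (ξ : PowerSeries A) : opP (incl ξ : Fed R g n A) = incl ξ := by
  rw [← incl_sigma, sigma_incl]

end Hodge

/-! ### Antiderivations of the deformed product. -/

section CircDerivations

variable {R g : Type*} [CommRing R] [Algebra ℚ R] [LieRing g] [LieAlgebra R g] {n : ℕ}
  {A : Type*} [Ring A] [Algebra R A] (b : Module.Basis (Fin n) R g)
  (p : Matrix (Fin n) (Fin n) R)

theorem opS_circ (a a' : Fed R g n A) : opS (circL p a a') = circL p (opS a) (opS a') :=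
  tlinear_circ_eq p tlinear_opS fun N => moyalL_intertwine p (T := opS) opS_mul
    (fun i => (opD_opS i).symm) (fun i => (opD_opS i).symm) N a a'

theorem opE_circ (i : Fin n) (a a' : Fed R g n A) :
    opE b i (circL p a a') = circL p (opE b i a) a' :=
  tlinear_circ_eq p (tlinear_opE b i) fun N => moyalL_intertwine p (T := opE b i) (T₁ := opE b i)
    (T₂ := 1) (fun a a' => opE_mul b i a a')
    (fun j => (opD_opE b j i).symm) (fun j => by rw [one_mul, mul_one]) N a a'

theorem circ_opE (i : Fin n) (a a' : Fed R g n A) :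
    circL p (opS a) (opE b i a') = opE b i (circL p a a') :=
  (tlinear_circ_eq p (tlinear_opE b i) fun N => moyalL_intertwine p (T := opE b i) (T₁ := opS)
    (T₂ := opE b i) (fun a a' => (mul_opE b i a a').symm)
    (fun j => (opD_opS j).symm) (fun j => (opD_opE b j i).symm) N a a').symm

theorem opD_circ (i : Fin n) (a a' : Fed R g n A) :
    opD i (circL p a a') = circL p (opD i a) a' + circL p a (opD i a') :=
  tlinear_circ_eq_add p (tlinear_opD i) fun N => moyalL_opD p N i a a'

/-- Antiderivations of the deformed product. -/
def IsAntider (T : Module.End R (Fed R g n A)) : Prop :=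
  ∀ a a', T (circL p a a') = circL p (T a) a' + circL p (opS a) (T a')

variable {p}

theorem IsAntider.add {T T' : Module.End R (Fed R g n A)} (h : IsAntider p T)
    (h' : IsAntider p T') : IsAntider p (T + T') := fun a a' => by
  simp only [LinearMap.add_apply, h a a', h' a a', map_add]; abel

theorem IsAntider.neg {T : Module.End R (Fed R g n A)} (h : IsAntider p T) :
    IsAntider p (-T) := fun a a' => by
  simp only [LinearMap.neg_apply, h a a', map_neg]; abel

theorem IsAntider.sum {ι : Type*} {s : Finset ι} {T : ι → Module.End R (Fed R g n A)}
    (h : ∀ i ∈ s, IsAntider p (T i)) : IsAntider p (∑ i ∈ s, T i) := fun a a' => by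
  simp only [LinearMap.sum_apply, map_sum]
  rw [← Finset.sum_add_distrib]
  exact Finset.sum_congr rfl fun i hi => h i hi a a'

/-- `δ`, `D` and `L_A` are sums of operators `e^i ∧ T_i` with `T_i` a derivation of `∘`; the sign
comes from moving `e^i` past the first factor. -/
theorem isAntider_opE_mul (i : Fin n) {T : Module.End R (Fed R g n A)}
    (h : ∀ a a', T (circL p a a') = circL p (T a) a' + circL p a (T a')) :
    IsAntider p (opE b i * T) := fun a a' => by
  rw [Module.End.mul_apply, h, map_add, opE_circ, ← circ_opE]; rfl

theorem isAntider_opDelta : IsAntider p (opDelta b : Module.End R (Fed R g n A)) :=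
  IsAntider.sum fun i _ => isAntider_opE_mul b i (opD_circ p i)

end CircDerivations

/-! ### Coordinates of `r`, `s`, the connection and its curvature. -/

section TensorCoords

variable {R g : Type*} [CommRing R] [Algebra ℚ R] [LieRing g] [LieAlgebra R g] {n : ℕ}
  (b : Module.Basis (Fin n) R g)

theorem coords_add (p q : g ⊗[R] g) : coords b (p + q) = coords b p + coords b q := by
  ext i j; simp [coords]

theorem coords_neg (p : g ⊗[R] g) : coords b (-p) = -coords b p := by
  ext i j; simp [coords]

theorem coords_tmul (x y : g) (i j : Fin n) :
    coords b (x ⊗ₜ y) i j = b.coord i x * b.coord j y := by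
  simp [coords, Module.Basis.tensorProduct_repr_tmul_apply, mul_comm]

theorem coords_zero : coords b (0 : g ⊗[R] g) = 0 := by
  ext i j; simp [coords]

theorem coords_comm (p : g ⊗[R] g) :
    coords b (TensorProduct.comm R g g p) = (coords b p).transpose := by
  induction p using TensorProduct.induction_on with
  | zero => rw [map_zero, coords_zero]; rfl
  | add x y hx hy => rw [map_add, coords_add, hx, hy, coords_add, Matrix.transpose_add]
  | tmul x y =>
    ext i j
    rw [TensorProduct.comm_tmul, coords_tmul, Matrix.transpose_apply, coords_tmul, mul_comm]

theorem coords_transpose_of_isAntisymm {p : g ⊗[R] g} (h : IsAntisymm p) :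
    (coords b p).transpose = -coords b p := by
  rw [← coords_comm, h, coords_neg]

theorem coords_transpose_of_isSymm {p : g ⊗[R] g} (h : IsSymm p) :
    (coords b p).transpose = coords b p := by
  rw [← coords_comm, h]

theorem tensor_eq_sum (p : g ⊗[R] g) : p = ∑ i, ∑ j, coords b p i j • (b i ⊗ₜ[R] b j) := by
  conv_lhs => rw [← (b.tensorProduct b).sum_repr p]
  rw [Fintype.sum_prod_type]
  simp only [Module.Basis.tensorProduct_apply]
  rfl

theorem coord_basis (i j : Fin n) : b.coord i (b j) = if i = j then 1 else 0 := by
  rw [Module.Basis.coord_apply, Module.Basis.repr_self, Finsupp.single_apply]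
  simp [eq_comm]

theorem coord_sharp (p : g ⊗[R] g) (α : Module.Dual R g) (i : Fin n) :
    b.coord i (sharp p α) = ∑ j, coords b p i j * α (b j) := by
  conv_lhs => rw [tensor_eq_sum b p]
  simp only [sharp, map_sum, map_smul, LinearMap.lTensor_tmul, TensorProduct.rid_tmul,
    coord_basis, smul_eq_mul, mul_ite, mul_one, mul_zero]
  rw [Finset.sum_comm]
  simp

/-- The coefficients of preimages of the basis vectors under `sharp r` form a right inverse. Hence
the matrix inverse in `omega` is a genuine one and not the default zero matrix. -/
theorem coords_isUnit_det {r : g ⊗[R] g} (h : Function.Bijective (sharp r)) :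
    IsUnit (coords b r).det := by
  choose α hα using fun k => h.2 (b k)
  refine Matrix.isUnit_det_of_right_inverse (B := Matrix.of fun j k => α k (b j)) ?_
  ext i k
  rw [Matrix.mul_apply, Matrix.one_apply]
  simp only [Matrix.of_apply]
  rw [← coord_sharp, hα, coord_basis]

theorem omega_eq (r : g ⊗[R] g) (X Y : g) : omega b r X Y =
    (b.repr X : Fin n → R) ⬝ᵥ ((coords b r)⁻¹.mulVec (b.repr Y : Fin n → R)) := by
  simp only [omega, dotProduct, Matrix.mulVec, Finset.mul_sum, Module.Basis.coord_apply]
  refine Finset.sum_congr rfl fun i _ => Finset.sum_congr rfl fun j _ => ?_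
  ring

theorem omega_sub_left (r : g ⊗[R] g) (X X' Y : g) :
    omega b r (X - X') Y = omega b r X Y - omega b r X' Y := by
  simp [omega_eq, sub_dotProduct]

theorem omega_sub_right (r : g ⊗[R] g) (X Y Y' : g) :
    omega b r X (Y - Y') = omega b r X Y - omega b r X Y' := by
  simp [omega_eq, Matrix.mulVec_sub, dotProduct_sub]

theorem omega_basis_left (r : g ⊗[R] g) (i : Fin n) (Y : g) :
    omega b r (b i) Y = ∑ j, (coords b r)⁻¹ i j * b.coord j Y := by
  simp [omega, coord_basis, -Module.Basis.coord_apply]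

theorem omega_basis_right (r : g ⊗[R] g) (j : Fin n) (X : g) :
    omega b r X (b j) = ∑ i, b.coord i X * (coords b r)⁻¹ i j := by
  simp [omega, coord_basis, -Module.Basis.coord_apply, mul_comm]

theorem omega_antisymm {r : g ⊗[R] g} (h : IsAntisymm r) (X Y : g) :
    omega b r Y X = -omega b r X Y := by
  have ht : (coords b r)⁻¹.transpose = -(coords b r)⁻¹ := by
    rw [Matrix.transpose_nonsing_inv, coords_transpose_of_isAntisymm b h]
    by_cases hu : IsUnit (coords b r).det
    · refine Matrix.inv_eq_left_inv ?_
      rw [neg_mul_neg, Matrix.nonsing_inv_mul _ hu]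
    -- If the determinant is not a unit, both inverses are zero by convention and the identity still
    -- holds.
    · have hu' : ¬ IsUnit (-coords b r).det := by
        rw [← coords_transpose_of_isAntisymm b h, Matrix.det_transpose]; exact hu
      rw [Matrix.nonsing_inv_apply_not_isUnit _ hu, Matrix.nonsing_inv_apply_not_isUnit _ hu',
        neg_zero]
  rw [omega_eq, omega_eq, Matrix.dotProduct_mulVec, ← Matrix.mulVec_transpose, ht,
    dotProduct_comm, Matrix.neg_mulVec, dotProduct_neg]

variable (nab : g →ₗ[R] g →ₗ[R] g)

/-- The Christoffel symbols of `∇_{e_i}` as a matrix. -/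
def chr (i : Fin n) : Matrix (Fin n) (Fin n) R := fun j k => christoffel b nab i j k

/-- The coefficients of the curvature operator for `e_i, e_j`. -/
def curvMat (i j : Fin n) : Matrix (Fin n) (Fin n) R :=
  fun l k => b.coord k (curvOp nab (b i) (b j) (b l))

theorem nab_basis (i j : Fin n) : nab (b i) (b j) = ∑ k, chr b nab i j k • b k :=
  (b.sum_repr _).symm

theorem lie_basis (i j : Fin n) : ⁅b i, b j⁆ = ∑ k, b.coord k ⁅b i, b j⁆ • b k :=
  (b.sum_repr _).symm

/-- The rows of `chr` are indexed by the argument of the connection, so matrices multiply in the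
order opposite to the composition of operators. -/
theorem curvMat_eq (i j : Fin n) : curvMat b nab i j = chr b nab j * chr b nab i
    - chr b nab i * chr b nab j - ∑ m, b.coord m ⁅b i, b j⁆ • chr b nab m := by
  ext l k
  have h : ∀ i j l, b.coord k (nab (b i) (nab (b j) (b l)))
      = (chr b nab j * chr b nab i) l k := fun i j l => by
    rw [nab_basis b nab j l, map_sum, map_sum, Matrix.mul_apply]
    simp only [map_smul, smul_eq_mul]
    rfl
  simp only [curvMat, curvOp, map_sub, Matrix.sub_apply, h, Matrix.sum_apply, Matrix.smul_apply]
  congr 1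
  conv_lhs => rw [lie_basis b i j]
  simp only [map_sum, map_smul, LinearMap.sum_apply, LinearMap.smul_apply]
  rfl

/-- The action of an endomorphism on `g ⊗ g` by derivations. -/
def tensorAct (f : g →ₗ[R] g) : g ⊗[R] g →ₗ[R] g ⊗[R] g :=
  LinearMap.rTensor g f + LinearMap.lTensor g f

theorem tensorAct_commutator (f f' : g →ₗ[R] g) (p : g ⊗[R] g) :
    tensorAct (f ∘ₗ f' - f' ∘ₗ f) p
      = tensorAct f (tensorAct f' p) - tensorAct f' (tensorAct f p) := by
  induction p using TensorProduct.induction_on with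
  | zero => simp
  | add x y hx hy => simp only [map_add, hx, hy]; abel
  | tmul x y =>
    simp only [tensorAct, LinearMap.add_apply, LinearMap.rTensor_tmul, LinearMap.lTensor_tmul,
      map_add, LinearMap.sub_apply, LinearMap.comp_apply, TensorProduct.sub_tmul,
      TensorProduct.tmul_sub]
    abel

theorem tensorAct_sub (f f' : g →ₗ[R] g) (p : g ⊗[R] g) :
    tensorAct (f - f') p = tensorAct f p - tensorAct f' p := by
  simp only [tensorAct, LinearMap.rTensor_sub, LinearMap.lTensor_sub, LinearMap.add_apply,
    LinearMap.sub_apply]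
  abel

theorem coords_tensorAct (f : g →ₗ[R] g) (p : g ⊗[R] g) (k l : Fin n) :
    coords b (tensorAct f p) k l
      = ∑ i, coords b p i l * b.coord k (f (b i)) + ∑ i, coords b p k i * b.coord l (f (b i)) := by
  have hx : ∀ (x : g) (k : Fin n), b.coord k (f x) = ∑ i, b.coord i x * b.coord k (f (b i)) :=
    fun x k => by
      conv_lhs => rw [← b.sum_repr x]
      simp only [map_sum, map_smul, smul_eq_mul]
      rfl
  induction p using TensorProduct.induction_on with
  | zero => simp [coords_zero]
  | add x y hx hy =>
    simp only [map_add, coords_add, Matrix.add_apply, hx, hy, add_mul, Finset.sum_add_distrib]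
    abel
  | tmul x y =>
    simp only [tensorAct, LinearMap.add_apply, LinearMap.rTensor_tmul, LinearMap.lTensor_tmul,
      coords_add, Matrix.add_apply, coords_tmul]
    rw [hx x, hx y, Finset.sum_mul, Finset.mul_sum]
    congr 1
    · exact Finset.sum_congr rfl fun i _ => by ring
    · exact Finset.sum_congr rfl fun i _ => by ring

variable {b nab}

theorem cov_const_coords {s : g ⊗[R] g} (h : IsCovConst nab s) (m k l : Fin n) :
    ∑ i, coords b s i l * chr b nab m i k + ∑ i, coords b s k i * chr b nab m i l = 0 := by
  have := coords_tensorAct b (nab (b m)) s k l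
  rw [show tensorAct (nab (b m)) s = 0 from h (b m), coords_zero] at this
  exact this.symm

/-- The curvature operator is a commutator of covariant derivatives minus a covariant derivative.
Each `∇_X` annihilates `s`, so the curvature annihilates it too. -/
theorem curv_cov_const_coords {s : g ⊗[R] g} (h : IsCovConst nab s) (i j k l : Fin n) :
    ∑ m, coords b s m l * curvMat b nab i j m k + ∑ m, coords b s k m * curvMat b nab i j m l
      = 0 := by
  have h' : ∀ X, tensorAct (nab X) s = 0 := h
  have := coords_tensorAct b
    (nab (b i) ∘ₗ nab (b j) - nab (b j) ∘ₗ nab (b i) - nab ⁅b i, b j⁆) s k l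
  rw [tensorAct_sub, tensorAct_commutator, h', h', h', map_zero, map_zero, sub_zero, sub_zero,
    coords_zero] at this
  exact this.symm

/-- Invariance of `ω` is carried over to `r`: multiplying `Γ ω + ω Γᵀ = 0` by `r` on both sides
gives `r Γ + Γᵀ r = 0`. -/
theorem symplectic_coords {r : g ⊗[R] g} (hu : IsUnit (coords b r).det)
    (h : IsSymplecticTorsionFree b r nab) (m k l : Fin n) :
    ∑ i, coords b r i l * chr b nab m i k + ∑ i, coords b r k i * chr b nab m i l = 0 := by
  have h1 : chr b nab m * (coords b r)⁻¹ + (coords b r)⁻¹ * (chr b nab m).transpose = 0 := by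
    ext i j
    have := h.symplectic (b m) (b i) (b j)
    rw [omega_basis_right, omega_basis_left] at this
    simp only [Matrix.add_apply, Matrix.mul_apply, Matrix.transpose_apply]
    exact this
  have h2 : coords b r * chr b nab m + (chr b nab m).transpose * coords b r = 0 := by
    have := congrArg (fun M => coords b r * M * coords b r) h1
    simp only [mul_add, add_mul, mul_zero, zero_mul] at this
    rwa [← mul_assoc, mul_assoc (coords b r * chr b nab m), Matrix.nonsing_inv_mul _ hu, mul_one,
      ← mul_assoc (coords b r) (coords b r)⁻¹, Matrix.mul_nonsing_inv _ hu, one_mul] at this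
  have := congrFun (congrFun h2 k) l
  simp only [Matrix.add_apply, Matrix.mul_apply, Matrix.transpose_apply, Matrix.zero_apply] at this
  rw [add_comm]
  simpa only [mul_comm] using this

/-- Every `∇_X` is skew for `ω`, hence so is the curvature operator. With the antisymmetry of `ω`,
the form `ω(Z, R̃ U)` becomes symmetric, as needed for a quadratic element in the `y`. -/
theorem curvTensor_symm {r : g ⊗[R] g} (ha : IsAntisymm r)
    (h : IsSymplecticTorsionFree b r nab) (Z U X Y : g) :
    curvTensor b r nab Z U X Y = curvTensor b r nab U Z X Y := by
  have e : ∀ X Y Z, omega b r (nab X Y) Z = -omega b r Y (nab X Z) := fun X Y Z =>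
    eq_neg_of_add_eq_zero_left (h.symplectic X Y Z)
  rw [curvTensor, curvTensor, ← neg_neg (omega b r U _), ← omega_antisymm b ha, curvOp, curvOp,
    omega_sub_left, omega_sub_left, omega_sub_right, omega_sub_right]
  simp only [e]
  ring

theorem torsion_coords {r : g ⊗[R] g} (h : IsSymplecticTorsionFree b r nab) (i j k : Fin n) :
    b.coord k ⁅b i, b j⁆ = chr b nab i j k - chr b nab j i k := by
  have := congrArg (b.coord k) (sub_eq_zero.1 (h.torsion_free (b i) (b j)))
  rw [← this, map_sub]; rfl

/-- The first Bianchi identity. -/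
theorem bianchi {r : g ⊗[R] g} (h : IsSymplecticTorsionFree b r nab) (X Y Z : g) :
    curvOp nab X Y Z + curvOp nab Y Z X + curvOp nab Z X Y = 0 := by
  have t : ∀ X Y, nab X Y = nab Y X + ⁅X, Y⁆ := fun X Y => by
    have := h.torsion_free X Y
    rw [sub_sub, sub_eq_zero] at this
    exact this
  have j := lie_jacobi X Y Z
  simp only [curvOp]
  -- Vanishing torsion lets the second covariant derivatives cancel in pairs, and what survives is
  -- the Jacobi sum.
  rw [t X Z, t Y X, t Z Y, map_add, map_add, map_add, t ⁅X, Y⁆ Z, t ⁅Y, Z⁆ X, t ⁅Z, X⁆ Y,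
    ← lie_skew X Z, ← lie_skew Y X, ← lie_skew Z Y, map_neg, map_neg, map_neg,
    ← lie_skew Z ⁅X, Y⁆, ← lie_skew X ⁅Y, Z⁆, ← lie_skew Y ⁅Z, X⁆] at *
  rw [← j]
  abel

end TensorCoords

/-! ### The operator `D` and its square. -/

section Connection

variable {R g : Type*} [CommRing R] [Algebra ℚ R] [LieRing g] [LieAlgebra R g] {n : ℕ}
  {A : Type*} [Ring A] [Algebra R A] (b : Module.Basis (Fin n) R g)

/-- The derivation `M_{jk} (y^j i_s(e_k) + e^j i_a(e_k))` for a matrix `M`. -/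
def opHat (M : Matrix (Fin n) (Fin n) R) : Module.End R (Fed R g n A) :=
  ∑ j, ∑ k, M j k • (opY j * opD k + opE b j * opI b k)

theorem opHat_apply (M : Matrix (Fin n) (Fin n) R) (a : Fed R g n A) : opHat b M a =
    ∑ j, ∑ k, M j k • (opY j (opD k a) + opE b j (opI b k a)) := by
  simp only [opHat, LinearMap.sum_apply, LinearMap.smul_apply]; rfl

theorem opHat_add (M M' : Matrix (Fin n) (Fin n) R) :
    (opHat b (M + M') : Module.End R (Fed R g n A)) = opHat b M + opHat b M' := by
  simp only [opHat, Matrix.add_apply, add_smul, Finset.sum_add_distrib]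

theorem opHat_smul (c : R) (M : Matrix (Fin n) (Fin n) R) :
    (opHat b (c • M) : Module.End R (Fed R g n A)) = c • opHat b M := by
  simp only [opHat, Matrix.smul_apply, smul_eq_mul, mul_smul, Finset.smul_sum]

/-- `opHat` as a linear map. -/
def opHatL : Matrix (Fin n) (Fin n) R →ₗ[R] Module.End R (Fed R g n A) where
  toFun := opHat b
  map_add' := opHat_add b
  map_smul' := opHat_smul b

theorem opHatL_apply (M : Matrix (Fin n) (Fin n) R) :
    (opHatL b M : Module.End R (Fed R g n A)) = opHat b M := rfl

theorem opY_opD' (j m : Fin n) (a : Fed R g n A) :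
    opD m (opY j a) = opY j (opD m a) + if m = j then a else 0 := by
  have := LinearMap.congr_fun (opD_opY (R := R) (g := g) (A := A) m j) a
  rw [LinearMap.add_apply, Module.End.mul_apply, Module.End.mul_apply] at this
  rw [this]; split_ifs <;> rfl

theorem opI_opE' (j m : Fin n) (a : Fed R g n A) :
    opI b m (opE b j a) = (if m = j then a else 0) - opE b j (opI b m a) := by
  have := LinearMap.congr_fun (opI_opE (R := R) (g := g) (A := A) b m j) a
  rw [LinearMap.sub_apply, Module.End.mul_apply, Module.End.mul_apply] at this
  rw [this]; split_ifs <;> rfl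

theorem opE_comm' (i j : Fin n) (a : Fed R g n A) :
    opE b i (opE b j a) = -opE b j (opE b i a) := LinearMap.congr_fun (opE_opE b i j) a

theorem opI_comm' (i j : Fin n) (a : Fed R g n A) :
    opI b i (opI b j a) = -opI b j (opI b i a) := LinearMap.congr_fun (opI_opI b i j) a

theorem opD_opE' (i j : Fin n) (a : Fed R g n A) : opD i (opE b j a) = opE b j (opD i a) :=
  LinearMap.congr_fun (opD_opE b i j) a

theorem opD_opI' (i j : Fin n) (a : Fed R g n A) : opD i (opI b j a) = opI b j (opD i a) :=
  LinearMap.congr_fun (opD_opI b i j) a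

theorem opY_opE' (i j : Fin n) (a : Fed R g n A) : opY i (opE b j a) = opE b j (opY i a) :=
  LinearMap.congr_fun (opY_opE b i j) a

theorem opY_opI' (i j : Fin n) (a : Fed R g n A) : opY i (opI b j a) = opI b j (opY i a) :=
  LinearMap.congr_fun (opY_opI b i j) a

theorem opY_comm' (i j : Fin n) (a : Fed R g n A) : opY i (opY j a) = opY j (opY i a) :=
  LinearMap.congr_fun (opY_opY i j) a

theorem opS_opE' (i : Fin n) (a : Fed R g n A) : opS (opE b i a) = -opE b i (opS a) :=
  LinearMap.congr_fun (opS_opE b i) a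

theorem opS_opI' (i : Fin n) (a : Fed R g n A) : opS (opI b i a) = -opI b i (opS a) :=
  LinearMap.congr_fun (opS_opI b i) a

theorem opS_opS' (a : Fed R g n A) : opS (opS a) = a := LinearMap.congr_fun opS_opS a

theorem opD_opS' (i : Fin n) (a : Fed R g n A) : opD i (opS a) = opS (opD i a) :=
  LinearMap.congr_fun (opD_opS i) a

theorem opY_opS' (i : Fin n) (a : Fed R g n A) : opY i (opS a) = opS (opY i a) :=
  LinearMap.congr_fun (opY_opS i) a

variable (M M' : Matrix (Fin n) (Fin n) R) (a : Fed R g n A)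

theorem sum_smul_ite {X : Type*} [AddCommGroup X] [Module R X] (m : Fin n)
    (f : Fin n → Fin n → X) :
    ∑ j, ∑ k, M j k • (if m = j then f j k else 0) = ∑ k, M m k • f m k := by
  rw [Finset.sum_eq_single m]
  · simp
  · intro j _ hj; simp [Ne.symm hj]
  · simp

theorem sum_smul_ite' {X : Type*} [AddCommGroup X] [Module R X] (m : Fin n)
    (f : Fin n → Fin n → X) :
    ∑ j, ∑ k, M j k • (if k = m then f j k else 0) = ∑ j, M j m • f j m := by
  refine Finset.sum_congr rfl fun j _ => ?_
  rw [Finset.sum_eq_single m]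
  · simp
  · intro k _ hk; simp [hk]
  · simp

theorem opD_opHat (m : Fin n) : opD m (opHat b M a) =
    opHat b M (opD m a) + ∑ k, M m k • opD k a := by
  simp only [opHat_apply, map_sum, map_smul, map_add, opY_opD', opD_opE', opD_opI']
  rw [← sum_smul_ite M m (fun _ k => opD k a), ← Finset.sum_add_distrib]
  refine Finset.sum_congr rfl fun j _ => ?_
  rw [← Finset.sum_add_distrib]
  refine Finset.sum_congr rfl fun k _ => ?_
  rw [← smul_add, opD_comm_apply]
  congr 1; abel

theorem opI_opHat (m : Fin n) : opI b m (opHat b M a) =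
    opHat b M (opI b m a) + ∑ k, M m k • opI b k a := by
  simp only [opHat_apply, map_sum, map_smul, map_add, opI_opE']
  rw [← sum_smul_ite M m (fun _ k => opI b k a), ← Finset.sum_add_distrib]
  refine Finset.sum_congr rfl fun j _ => ?_
  rw [← Finset.sum_add_distrib]
  refine Finset.sum_congr rfl fun k _ => ?_
  rw [← smul_add, ← opY_opI', ← opD_opI', opI_comm' b m k, map_neg]
  congr 1; abel

theorem opHat_opY (m : Fin n) : opHat b M (opY m a) =
    opY m (opHat b M a) + ∑ j, M j m • opY j a := by
  simp only [opHat_apply, map_sum, map_smul, map_add, opY_opD', ← opY_opI']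
  rw [← sum_smul_ite' M m (fun j _ => opY j a), ← Finset.sum_add_distrib]
  refine Finset.sum_congr rfl fun j _ => ?_
  rw [← Finset.sum_add_distrib]
  refine Finset.sum_congr rfl fun k _ => ?_
  rw [← smul_add, opY_comm' m j, opY_opE', apply_ite (opY j), map_zero]
  congr 1; abel

theorem opHat_opE (m : Fin n) : opHat b M (opE b m a) =
    opE b m (opHat b M a) + ∑ j, M j m • opE b j a := by
  simp only [opHat_apply, map_sum, map_smul, map_add, map_sub, opI_opE', opD_opE', opY_opE']
  rw [← sum_smul_ite' M m (fun j _ => opE b j a), ← Finset.sum_add_distrib]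
  refine Finset.sum_congr rfl fun j _ => ?_
  rw [← Finset.sum_add_distrib]
  refine Finset.sum_congr rfl fun k _ => ?_
  rw [← smul_add, opE_comm' b m j, apply_ite (opE b j), map_zero]
  congr 1; abel

/-- Matrices act as linear vector fields on both the symmetric and the antisymmetric variables, and
this respects commutators. It computes the curvature of `∇` on the whole algebra. -/
theorem opHat_commutator : opHat b M (opHat b M' a) =
    opHat b M' (opHat b M a) + opHat b (M * M' - M' * M) a := by
  have h1 : ∀ (f : Fin n → Fin n → Fed R g n A), ∑ j, ∑ k, M' j k • ∑ m, M m j • f m k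
      = ∑ j, ∑ k, (M * M') j k • f j k := fun f => by
    simp only [Matrix.mul_apply, Finset.sum_smul, Finset.smul_sum, smul_smul]
    rw [Finset.sum_comm]
    rw [Finset.sum_comm (s := Finset.univ (α := Fin n)) (t := Finset.univ (α := Fin n))
      (f := fun j k => ∑ i, (M j i * M' i k) • f j k)]
    refine Finset.sum_congr rfl fun k _ => ?_
    rw [Finset.sum_comm]
    exact Finset.sum_congr rfl fun j _ => Finset.sum_congr rfl fun m _ => by rw [mul_comm]
  have h2 : ∀ (f : Fin n → Fin n → Fed R g n A), ∑ j, ∑ k, M' j k • ∑ m, M k m • f j m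
      = ∑ j, ∑ k, (M' * M) j k • f j k := fun f => by
    simp only [Matrix.mul_apply, Finset.sum_smul, Finset.smul_sum, smul_smul]
    exact Finset.sum_congr rfl fun j _ => Finset.sum_comm
  have hD : ∀ k, opHat b M (opD k a) = opD k (opHat b M a) - ∑ m, M k m • opD m a := fun k => by
    rw [opD_opHat]; abel
  have hI : ∀ k, opHat b M (opI b k a) = opI b k (opHat b M a) - ∑ m, M k m • opI b m a :=
    fun k => by rw [opI_opHat]; abel
  rw [opHat_apply b M' a, opHat_apply b M' (opHat b M a), opHat_apply b (M * M' - M' * M)]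
  simp only [map_sum, map_smul, map_add, opHat_opY, opHat_opE, hD, hI, map_sub, smul_add,
    smul_sub, Finset.sum_add_distrib, Finset.sum_sub_distrib, Matrix.sub_apply, sub_smul]
  rw [← h1, ← h1, ← h2, ← h2]
  abel

theorem mul_opE' (i : Fin n) (a a' : Fed R g n A) :
    a * opE b i a' = opE b i (opS a * a') := by
  rw [← mul_opE, opS_opS']

theorem opHat_sub (M M' : Matrix (Fin n) (Fin n) R) (a : Fed R g n A) :
    opHat b (M - M') a = opHat b M a - opHat b M' a :=
  LinearMap.congr_fun ((opHatL b).map_sub M M') a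

theorem opHat_mul (a a' : Fed R g n A) :
    opHat b M (a * a') = opHat b M a * a' + a * opHat b M a' := by
  simp only [opHat_apply, Finset.sum_mul, Finset.mul_sum, ← Finset.sum_add_distrib,
    smul_mul_assoc, mul_smul_comm, ← smul_add]
  refine Finset.sum_congr rfl fun j _ => Finset.sum_congr rfl fun k _ => congrArg _ ?_
  rw [opD_mul, opI_mul, map_add, map_add, add_mul, mul_add, mul_opE', opE_mul, mul_opY,
    opY_apply, ← mul_assoc, ← opY_apply]
  abel

theorem opS_opHat : opS (opHat b M a) = opHat b M (opS a) := by
  simp only [opHat_apply, map_sum, map_smul, map_add, ← opY_opS', opS_opE', opS_opI',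
    opD_opS', map_neg, neg_neg]

variable (nab : g →ₗ[R] g →ₗ[R] g)

/-- `∇_{e_i}` as a linear map. -/
def opNab (i : Fin n) : Module.End R (Fed R g n A) := -opHat b (chr b nab i)

theorem opNab_apply (i : Fin n) (a : Fed R g n A) :
    opNab b nab i a = -opHat b (chr b nab i) a := rfl

theorem nabla_eq (i : Fin n) (a : Fed R g n A) : nabla b nab i a = opNab b nab i a := by
  rw [opNab_apply, opHat_apply]; rfl

/-- `D` as a linear map. -/
def opCov : Module.End R (Fed R g n A) := ∑ i, opE b i * opNab b nab i

theorem opCov_apply (a : Fed R g n A) :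
    opCov b nab a = ∑ i, opE b i (opNab b nab i a) := by
  simp only [opCov, LinearMap.sum_apply]; rfl

theorem covD_eq (a : Fed R g n A) : covD b nab a = opCov b nab a := by
  simp only [opCov_apply, covD, nabla_eq, wedge_eq]

theorem opDelta_apply (a : Fed R g n A) : opDelta b a = ∑ i, opE b i (opD i a) := by
  simp only [opDelta, LinearMap.sum_apply]; rfl

theorem opNab_opE (i m : Fin n) (a : Fed R g n A) : opNab b nab i (opE b m a) =
    opE b m (opNab b nab i a) - ∑ j, chr b nab i j m • opE b j a := by
  rw [opNab_apply, opNab_apply, opHat_opE, map_neg]; abel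

theorem opNab_opD (i m : Fin n) (a : Fed R g n A) : opNab b nab i (opD m a) =
    opD m (opNab b nab i a) + ∑ k, chr b nab i m k • opD k a := by
  rw [opNab_apply, opNab_apply, map_neg, opD_opHat]; abel

theorem opNab_mul (i : Fin n) (a a' : Fed R g n A) :
    opNab b nab i (a * a') = opNab b nab i a * a' + a * opNab b nab i a' := by
  simp only [opNab_apply, opHat_mul, neg_mul, mul_neg, neg_add]

theorem tlinear_opHat : TLinear (opHat b M : Module.End R (Fed R g n A)) :=
  TLinear.sum fun _ _ => TLinear.sum fun _ _ =>
    (((tlinear_opY _).mul (tlinear_opD _)).add ((tlinear_opE b _).mul (tlinear_opI b _))).smul _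

theorem tlinear_opCov : TLinear (opCov b nab : Module.End R (Fed R g n A)) :=
  TLinear.sum fun _ _ => (tlinear_opE b _).mul (tlinear_opHat b _).neg

theorem isAntider_opCov {p : Matrix (Fin n) (Fin n) R}
    (hp : ∀ m k l, ∑ i, p i l * chr b nab m i k + ∑ i, p k i * chr b nab m i l = 0) :
    IsAntider p (opCov b nab : Module.End R (Fed R g n A)) :=
  IsAntider.sum fun m _ => isAntider_opE_mul b m fun a a' =>
    tlinear_circ_eq_add p (tlinear_opHat b _).neg fun N =>
      moyalL_derivation p (T := opNab b nab m) (opNab_mul b nab m) (chr b nab m)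
        (fun i => LinearMap.ext fun a => by
          simp only [Module.End.mul_apply, LinearMap.add_apply, LinearMap.sum_apply,
            LinearMap.smul_apply, opNab_opD])
        (hp m) N a a'

/-- `δ` and `D` anticommute. -/
theorem opDelta_opCov (a : Fed R g n A) :
    opDelta b (opCov b nab a) + opCov b nab (opDelta b a) = 0 := by
  simp only [opDelta_apply, opCov_apply, map_sum, opD_opE', opNab_opE, opNab_opD, map_add,
    map_sub, Finset.sum_add_distrib, Finset.sum_sub_distrib]
  have h1 : ∑ x, ∑ y, opE b y (opE b x (opD y (opNab b nab x a)))
      = -∑ x, ∑ y, opE b y (opE b x (opD x (opNab b nab y a))) := by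
    rw [Finset.sum_comm]
    simp only [← Finset.sum_neg_distrib]
    exact Finset.sum_congr rfl fun i _ => Finset.sum_congr rfl fun j _ => opE_comm' b _ _ _
  -- The symbols coming from `∂_x` and those coming from `e^x` cancel after relabelling. As `∇` acts
  -- on both factors, `δ` is parallel, and no symmetry of the symbols enters.
  have h2 : ∑ x, ∑ y, ∑ z, opE b y (opE b x (chr b nab y x z • opD z a))
      = ∑ x, ∑ y, ∑ z, opE b y (chr b nab y z x • opE b z (opD x a)) := by
    rw [Finset.sum_comm]
    rw [Finset.sum_comm (f := fun x y => ∑ z, opE b y (chr b nab y z x • opE b z (opD x a)))]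
    refine Finset.sum_congr rfl fun i _ => ?_
    rw [Finset.sum_comm]
    exact Finset.sum_congr rfl fun i _ => Finset.sum_congr rfl fun j _ => by rw [map_smul]
  rw [h1, h2]
  abel

/-- Against `e^i ∧ e^j` only the antisymmetric part of the coefficients counts. Doubling keeps the
formula free of halves. -/
theorem two_smul_sum_antisymm (f : Fin n → Fin n → Fed R g n A) :
    (2 : R) • ∑ i, ∑ j, opE b i (opE b j (f i j))
      = ∑ i, ∑ j, opE b i (opE b j (f i j - f j i)) := by
  simp only [map_sub, Finset.sum_sub_distrib, two_smul]
  rw [sub_eq_add_neg]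
  congr 1
  rw [Finset.sum_comm]
  simp only [← Finset.sum_neg_distrib]
  exact Finset.sum_congr rfl fun i _ => Finset.sum_congr rfl fun j _ => opE_comm' b _ _ _

theorem opCov_opE_sum (f : Fin n → Fed R g n A) : opCov b nab (∑ j, opE b j (f j)) =
    ∑ i, ∑ j, opE b i (opE b j (opNab b nab i (f j) - ∑ m, chr b nab i j m • f m)) := by
  rw [opCov_apply]
  refine Finset.sum_congr rfl fun i _ => ?_
  simp only [map_sum, opNab_opE, map_sub, Finset.sum_sub_distrib, map_smul]
  rw [Finset.sum_comm (f := fun x y => chr b nab i y x • opE b i (opE b y (f x)))]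

/-- Absence of torsion turns `Γ_{ij}^m - Γ_{ji}^m` into structure constants, which complete the
commutator to the curvature. The minus sign is that of the dual action on `g*`. -/
theorem opNab_commutator {r : g ⊗[R] g} (h : IsSymplecticTorsionFree b r nab) (i j : Fin n)
    (a : Fed R g n A) : (opNab b nab i (opNab b nab j a) - ∑ m, chr b nab i j m • opNab b nab m a)
      - (opNab b nab j (opNab b nab i a) - ∑ m, chr b nab j i m • opNab b nab m a)
      = -opHat b (curvMat b nab i j) a := by
  have h1 : ∑ m, chr b nab i j m • opNab b nab m a - ∑ m, chr b nab j i m • opNab b nab m a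
      = -opHat b (∑ m, b.coord m ⁅b i, b j⁆ • chr b nab m) a := by
    rw [← opHatL_apply, map_sum, LinearMap.sum_apply, ← Finset.sum_sub_distrib,
      ← Finset.sum_neg_distrib]
    refine Finset.sum_congr rfl fun m _ => ?_
    rw [map_smul, LinearMap.smul_apply, torsion_coords h, ← sub_smul, opNab_apply, smul_neg]; rfl
  have h2 := opHat_commutator b (chr b nab i) (chr b nab j) a
  rw [sub_sub_sub_comm, h1, curvMat_eq, opNab_apply, opNab_apply, opNab_apply, opNab_apply, map_neg,
    map_neg, h2, opHat_sub, opHat_sub, opHat_sub]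
  abel

/-- This is the curvature acting on the form factor. The product `e^i e^j e^l` is invariant under
cyclic permutations, so the coefficients may be averaged over them and vanish by `bianchi`. -/
theorem sum_curvMat_cyclic {r : g ⊗[R] g} (h : IsSymplecticTorsionFree b r nab)
    (f : Fin n → Fed R g n A) :
    ∑ i, ∑ j, ∑ l, ∑ k, curvMat b nab i j l k • opE b i (opE b j (opE b l (f k))) = 0 := by
  set F : Fin n → Fin n → Fin n → Fed R g n A := fun i j l =>
    ∑ k, curvMat b nab i j l k • opE b i (opE b j (opE b l (f k))) with hF
  have hcyc : ∀ i j l, F i j l + F j l i + F l i j = 0 := fun i j l => by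
    have e (x : Fed R g n A) : opE b j (opE b l (opE b i x)) = opE b i (opE b j (opE b l x)) := by
      rw [opE_comm' b l i, map_neg, opE_comm' b j i, neg_neg]
    have e' (x : Fed R g n A) : opE b l (opE b i (opE b j x)) = opE b i (opE b j (opE b l x)) := by
      rw [opE_comm' b l i, opE_comm' b l j, map_neg, neg_neg]
    have hF1 : F j l i = ∑ k, curvMat b nab j l i k • opE b i (opE b j (opE b l (f k))) :=
      Finset.sum_congr rfl fun k _ => by rw [e]
    have hF2 : F l i j = ∑ k, curvMat b nab l i j k • opE b i (opE b j (opE b l (f k))) :=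
      Finset.sum_congr rfl fun k _ => by rw [e']
    rw [hF1, hF2, hF]
    simp only [← Finset.sum_add_distrib, ← add_smul]
    refine Finset.sum_eq_zero fun k _ => ?_
    have := congrArg (b.coord k) (bianchi h (b i) (b j) (b l))
    rw [map_add, map_add, map_zero] at this
    rw [show curvMat b nab i j l k + curvMat b nab j l i k + curvMat b nab l i j k = 0 from this,
      zero_smul]
  have h1 : ∑ i, ∑ j, ∑ l, F j l i = ∑ i, ∑ j, ∑ l, F i j l := by
    rw [Finset.sum_comm]
    exact Finset.sum_congr rfl fun j _ => Finset.sum_comm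
  have h2 : ∑ i, ∑ j, ∑ l, F l i j = ∑ i, ∑ j, ∑ l, F i j l := by
    rw [Finset.sum_congr rfl fun i _ => Finset.sum_comm, Finset.sum_comm]
  -- The sum equals each of its two cyclic relabellings, so the vanishing cyclic sum is three times
  -- the original one.
  refine eq_zero_of_natCast_smul R three_ne_zero ?_
  have h3 : ∑ i, ∑ j, ∑ l, (F i j l + F j l i + F l i j) = 0 := by simp only [hcyc]; simp
  simp only [Finset.sum_add_distrib, h1, h2] at h3
  rw [← h3]
  simp only [Nat.cast_ofNat, hF]
  rw [show (3 : R) = 1 + 1 + 1 by norm_num, add_smul, add_smul, one_smul]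

/-- The square of `D` is given by the curvature. -/
theorem two_smul_opCov_opCov {r : g ⊗[R] g} (h : IsSymplecticTorsionFree b r nab)
    (a : Fed R g n A) : (2 : R) • opCov b nab (opCov b nab a) =
      -∑ i, ∑ j, ∑ l, ∑ k, curvMat b nab i j l k • opE b i (opE b j (opY l (opD k a))) := by
  rw [opCov_apply b nab a, opCov_opE_sum, two_smul_sum_antisymm]
  simp only [opNab_commutator b nab h, opHat_apply, map_neg, Finset.sum_neg_distrib, map_sum,
    map_smul, map_add, smul_add, Finset.sum_add_distrib]
  -- The part of the curvature acting on forms drops out by the first Bianchi identity; only its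
  -- action on the symmetric factor remains.
  rw [sum_curvMat_cyclic b nab h fun k => opI b k a, add_zero]

end Connection

/-! ### The operator `L_A`. -/

section Action

variable {R g : Type*} [CommRing R] [Algebra ℚ R] [LieRing g] [LieAlgebra R g] {n : ℕ}
  {A : Type*} [Ring A] [Algebra R A] (b : Module.Basis (Fin n) R g) (T : DerivationAction R g A)

/-- The action of `e_i` on the coefficients in `A`. -/
def opAct (i : Fin n) : Module.End R (Fed R g n A) :=
  mapEnd R g n A (LinearMap.rTensor (Forms R g) (T.act (b i)))

theorem cf_opAct (m : ℕ) (κ : Fin n →₀ ℕ) (i : Fin n) (a : Fed R g n A) :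
    cf m κ (opAct b T i a) = LinearMap.rTensor (Forms R g) (T.act (b i)) (cf m κ a) :=
  cf_mapEnd _ _ _ _

/-- `L_A` as a linear map. -/
def opLeft : Module.End R (Fed R g n A) := ∑ i, opE b i * opAct b T i

theorem opLeft_apply (a : Fed R g n A) : opLeft b T a = ∑ i, opE b i (opAct b T i a) := by
  simp only [opLeft, LinearMap.sum_apply]; rfl

theorem leftOp_eq (a : Fed R g n A) : leftOp b T a = opLeft b T a := by
  rw [opLeft_apply]; rfl

theorem opAct_mapEnd_lTensor (i : Fin n) (f : Forms R g →ₗ[R] Forms R g) (a : Fed R g n A) :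
    opAct b T i (mapEnd R g n A (LinearMap.lTensor A f) a)
      = mapEnd R g n A (LinearMap.lTensor A f) (opAct b T i a) := fed_ext fun m κ => by
  simp only [cf_opAct, cf_mapEnd]
  rw [← LinearMap.comp_apply, ← LinearMap.comp_apply, LinearMap.rTensor_comp_lTensor,
    LinearMap.lTensor_comp_rTensor]

theorem opAct_opI (i j : Fin n) (a : Fed R g n A) :
    opAct b T i (opI b j a) = opI b j (opAct b T i a) := opAct_mapEnd_lTensor _ _ _ _ _

theorem opAct_opS (i : Fin n) (a : Fed R g n A) :
    opAct b T i (opS a) = opS (opAct b T i a) := opAct_mapEnd_lTensor _ _ _ _ _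

theorem opE_eq_lTensor (j : Fin n) : (opE b j : Module.End R (Fed R g n A)) =
    mapEnd R g n A (LinearMap.lTensor A (LinearMap.mulLeft R (dualVec b j))) := by
  rw [opE_eq_mapEnd]
  congr 1
  refine TensorProduct.ext' fun a α => ?_
  rw [LinearMap.mulLeft_apply, Algebra.TensorProduct.tmul_mul_tmul, one_mul,
    LinearMap.lTensor_tmul, LinearMap.mulLeft_apply]

theorem opAct_opE (i j : Fin n) (a : Fed R g n A) :
    opAct b T i (opE b j a) = opE b j (opAct b T i a) := by
  rw [opE_eq_lTensor, opAct_mapEnd_lTensor]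

theorem opAct_opD (i j : Fin n) (a : Fed R g n A) :
    opAct b T i (opD j a) = opD j (opAct b T i a) :=
  (LinearMap.congr_fun (opD_mapEnd j (LinearMap.rTensor (Forms R g) (T.act (b i)))) a).symm

theorem opAct_opY (i j : Fin n) (a : Fed R g n A) :
    opAct b T i (opY j a) = opY j (opAct b T i a) :=
  (LinearMap.congr_fun (opY_mapEnd j (LinearMap.rTensor (Forms R g) (T.act (b i)))) a).symm

theorem opAct_opHat (i : Fin n) (M : Matrix (Fin n) (Fin n) R) (a : Fed R g n A) :
    opAct b T i (opHat b M a) = opHat b M (opAct b T i a) := by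
  simp only [opHat_apply, map_sum, map_smul, map_add, opAct_opY, opAct_opD, opAct_opE, opAct_opI]

theorem opAct_opNab (nab : g →ₗ[R] g →ₗ[R] g) (i j : Fin n) (a : Fed R g n A) :
    opAct b T i (opNab b nab j a) = opNab b nab j (opAct b T i a) := by
  rw [opNab_apply, opNab_apply, map_neg, opAct_opHat]

theorem act_basis_commutator (i j : Fin n) (x : A) : T.act (b i) (T.act (b j) x)
    - T.act (b j) (T.act (b i) x) = ∑ m, b.coord m ⁅b i, b j⁆ • T.act (b m) x := by
  rw [← T.act_lie]
  conv_lhs => rw [lie_basis b i j]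
  simp only [map_sum, map_smul, LinearMap.sum_apply, LinearMap.smul_apply]

theorem opAct_commutator (i j : Fin n) (a : Fed R g n A) : opAct b T i (opAct b T j a)
    - opAct b T j (opAct b T i a) = ∑ m, b.coord m ⁅b i, b j⁆ • opAct b T m a :=
  fed_ext fun m κ => by
    simp only [cf_sub, cf_sum, cf_smul, cf_opAct]
    induction cf m κ a using TensorProduct.induction_on with
    | zero => simp
    | add x y hx hy =>
      simp only [map_add, smul_add, Finset.sum_add_distrib, ← hx, ← hy]; abel
    | tmul x α =>
      simp only [LinearMap.rTensor_tmul, ← TensorProduct.sub_tmul, act_basis_commutator,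
        TensorProduct.sum_tmul, TensorProduct.smul_tmul']

theorem rTensor_act_mul (X : g) (c c' : Cf R g A) :
    LinearMap.rTensor (Forms R g) (T.act X) (c * c') =
      LinearMap.rTensor (Forms R g) (T.act X) c * c'
        + c * LinearMap.rTensor (Forms R g) (T.act X) c' := by
  induction c using TensorProduct.induction_on with
  | zero => simp
  | add x y hx hy => simp only [add_mul, map_add, hx, hy]; abel
  | tmul a α =>
    induction c' using TensorProduct.induction_on with
    | zero => simp
    | add x y hx hy => simp only [mul_add, map_add, hx, hy]; abel
    | tmul a' α' =>
      simp only [Algebra.TensorProduct.tmul_mul_tmul, LinearMap.rTensor_tmul, T.leibniz,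
        TensorProduct.add_tmul]

theorem opAct_mul (i : Fin n) (a a' : Fed R g n A) :
    opAct b T i (a * a') = opAct b T i a * a' + a * opAct b T i a' := by
  refine fed_ext fun m κ => ?_
  simp only [cf_opAct, cf_mul, map_sum, rTensor_act_mul, cf_add, Finset.sum_add_distrib]

theorem tlinear_opLeft : TLinear (opLeft b T : Module.End R (Fed R g n A)) :=
  TLinear.sum fun _ _ => (tlinear_opE b _).mul (tlinear_mapEnd _)

theorem isAntider_opLeft {p : Matrix (Fin n) (Fin n) R} :
    IsAntider p (opLeft b T : Module.End R (Fed R g n A)) :=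
  IsAntider.sum fun m _ => isAntider_opE_mul b m fun a a' =>
    tlinear_circ_eq_add p (tlinear_mapEnd _) fun N =>
      moyalL_derivation p (T := opAct b T m) (opAct_mul b T m) 0
        (fun i => LinearMap.ext fun a => by
          simp [Module.End.mul_apply, opAct_opD])
        (by simp) N a a'

theorem opDelta_opLeft (a : Fed R g n A) :
    opDelta b (opLeft b T a) + opLeft b T (opDelta b a) = 0 := by
  simp only [opDelta_apply, opLeft_apply, map_sum, opD_opE', opAct_opE, opAct_opD]
  rw [add_comm, Finset.sum_comm, ← Finset.sum_add_distrib]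
  refine Finset.sum_eq_zero fun i _ => ?_
  rw [← Finset.sum_add_distrib]
  refine Finset.sum_eq_zero fun j _ => ?_
  rw [opE_comm' b j i, add_neg_cancel]

/-- The left side is the sum of `e^i e^j (e_i ▷ e_j ▷ - Γ_{ij}^m e_m ▷)`. Antisymmetrised, the
actions give `[e_i, e_j] ▷`, and by vanishing torsion so do the Christoffel terms. -/
theorem opCov_opLeft {nab : g →ₗ[R] g →ₗ[R] g} {r : g ⊗[R] g}
    (h : IsSymplecticTorsionFree b r nab) (a : Fed R g n A) :
    opCov b nab (opLeft b T a) + opLeft b T (opCov b nab a) + opLeft b T (opLeft b T a) = 0 := by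
  have e1 : opLeft b T (opCov b nab a) =
      -∑ i, ∑ j, opE b i (opE b j (opNab b nab i (opAct b T j a))) := by
    simp only [opLeft_apply, opCov_apply, map_sum, opAct_opE, opAct_opNab]
    simp only [← Finset.sum_neg_distrib]
    exact Finset.sum_congr rfl fun i _ => Finset.sum_congr rfl fun j _ => opE_comm' b _ _ _
  have e2 : opLeft b T (opLeft b T a) =
      ∑ i, ∑ j, opE b i (opE b j (opAct b T i (opAct b T j a))) := by
    simp only [opLeft_apply, map_sum, opAct_opE]
    exact Finset.sum_comm
  have e3 : opCov b nab (opLeft b T a) + opLeft b T (opCov b nab a) + opLeft b T (opLeft b T a)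
      = ∑ i, ∑ j, opE b i (opE b j
        (opAct b T i (opAct b T j a) - ∑ m, chr b nab i j m • opAct b T m a)) := by
    rw [e1, e2, opLeft_apply, opCov_opE_sum]
    simp only [map_sub, Finset.sum_sub_distrib]
    abel
  refine eq_zero_of_natCast_smul R two_ne_zero ?_
  rw [e3, Nat.cast_two, two_smul_sum_antisymm]
  refine Finset.sum_eq_zero fun i _ => Finset.sum_eq_zero fun j _ => ?_
  rw [sub_sub_sub_comm, opAct_commutator, ← Finset.sum_sub_distrib]
  simp only [torsion_coords h, sub_smul, sub_self, map_zero]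

end Action

/-! ### The curvature element generates the square of `D`. -/

section Curvature

variable {R g : Type*} [CommRing R] [Algebra ℚ R] [LieRing g] [LieAlgebra R g] {n : ℕ}
  {A : Type*} [Ring A] [Algebra R A] (p : Matrix (Fin n) (Fin n) R)

theorem moyalL_zero_left (N : ℕ) (a' : Fed R g n A) : moyalL p N 0 a' = 0 := by
  rw [map_zero, LinearMap.zero_apply]

/-- For a factor of degree at most one in the `y` the exponential series stops after its linear
term. -/
theorem circ_of_opD_opD_left {a : Fed R g n A} (h : ∀ i j, opD i (opD j a) = 0)
    (a' : Fed R g n A) : circL p a a' =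
      a * a' + PowerSeries.X * (wt R 1 • ∑ i, ∑ j, p i j • (opD i a * opD j a')) := by
  have hN : ∀ N, moyalL p (N + 2) a a' = 0 := fun N => by
    rw [moyalL_succ]
    refine Finset.sum_eq_zero fun i _ => Finset.sum_eq_zero fun j _ => ?_
    rw [moyalL_succ]
    simp only [h, moyalL_zero_left, smul_zero, Finset.sum_const_zero]
  refine PowerSeries.ext fun m => ?_
  rw [← circ_eq, coeff_circ, map_add]
  cases m with
  | zero => simp [wt, moyalL_zero]
  | succ m =>
    rw [PowerSeries.coeff_succ_X_mul, Finset.sum_range_succ', Finset.sum_range_succ',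
      Finset.sum_eq_zero fun N _ => by rw [hN, map_zero, smul_zero], zero_add, add_comm]
    simp [wt, moyalL_zero, moyalL_succ]

theorem circ_of_opD_opD_right {a' : Fed R g n A} (h : ∀ i j, opD i (opD j a') = 0)
    (a : Fed R g n A) : circL p a a' =
      a * a' + PowerSeries.X * (wt R 1 • ∑ i, ∑ j, p i j • (opD i a * opD j a')) := by
  have hN : ∀ N, moyalL p (N + 2) a a' = 0 := fun N => by
    rw [moyalL_succ]
    refine Finset.sum_eq_zero fun i _ => Finset.sum_eq_zero fun j _ => ?_
    rw [moyalL_succ]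
    simp only [h, map_zero, smul_zero, Finset.sum_const_zero]
  refine PowerSeries.ext fun m => ?_
  rw [← circ_eq, coeff_circ, map_add]
  cases m with
  | zero => simp [wt, moyalL_zero]
  | succ m =>
    rw [PowerSeries.coeff_succ_X_mul, Finset.sum_range_succ', Finset.sum_range_succ',
      Finset.sum_eq_zero fun N _ => by rw [hN, map_zero, smul_zero], zero_add, add_comm]
    simp [wt, moyalL_zero, moyalL_succ]

theorem circ_of_opD_left {a : Fed R g n A} (h : ∀ i, opD i a = 0) (a' : Fed R g n A) :
    circL p a a' = a * a' := by
  rw [circ_of_opD_opD_left p (fun i j => by rw [h, map_zero])]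
  simp [h]

theorem circ_of_opD_right {a' : Fed R g n A} (h : ∀ i, opD i a' = 0) (a : Fed R g n A) :
    circL p a a' = a * a' := by
  rw [circ_of_opD_opD_right p (fun i j => by rw [h, map_zero])]
  simp [h]

theorem opD_one (i : Fin n) : opD i (1 : Fed R g n A) = 0 := by
  have h := opD_mul i (1 : Fed R g n A) 1
  rw [one_mul, one_mul, mul_one, left_eq_add] at h
  exact h

theorem opD_opD_elY (i j k : Fin n) : opD i (opD j (elY k : Fed R g n A)) = 0 := by
  rw [opD_elY]; split_ifs
  · exact opD_one i
  · exact map_zero _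

theorem elY_circ (k : Fin n) (a : Fed R g n A) : circL p (elY k) a =
    opY k a + PowerSeries.X * (wt R 1 • ∑ j, p k j • opD j a) := by
  rw [circ_of_opD_opD_left p fun i j => opD_opD_elY i j k, opY_apply]
  simp [opD_elY, ite_mul]

theorem circ_elY (k : Fin n) (a : Fed R g n A) : circL p a (elY k) =
    opY k a + PowerSeries.X * (wt R 1 • ∑ j, p j k • opD j a) := by
  rw [circ_of_opD_opD_right p fun i j => opD_opD_elY i j k, opY_apply, elY_comm]
  simp [opD_elY, mul_ite]

theorem wt_one_two : wt R 1 * 2 = 1 := by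
  have := rat_mul_natCast (R := R) 2 two_ne_zero
  simpa [wt] using this

/-- In the commutator the symmetric tensor cancels and the antisymmetric one is counted twice, which
absorbs the factor one half. Thus brackets with `y^k` are the partial derivatives contracted with
`r`. -/
theorem elY_circ_sub {p pr ps : Matrix (Fin n) (Fin n) R} (h : p = pr + ps)
    (hr : ∀ i j, pr j i = -pr i j) (hs : ∀ i j, ps j i = ps i j) (k : Fin n) (a : Fed R g n A) :
    circL p (elY k) a - circL p a (elY k) = PowerSeries.X * ∑ j, pr k j • opD j a := by
  rw [elY_circ, circ_elY, add_sub_add_left_eq_sub, ← mul_sub, ← smul_sub, ← Finset.sum_sub_distrib,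
    Finset.smul_sum]
  refine congrArg (HMul.hMul PowerSeries.X) ?_
  refine Finset.sum_congr rfl fun j _ => ?_
  rw [← sub_smul, smul_smul, h, Matrix.add_apply, Matrix.add_apply, hs, hr k j]
  congr 1
  linear_combination pr k j * wt_one_two (R := R)

theorem sum_smul_antisymm {c : Matrix (Fin n) (Fin n) R} (hc : ∀ i j, c i j + c j i = 0)
    {f : Fin n → Fin n → Fed R g n A} (hf : ∀ i j, f i j = f j i) :
    ∑ i, ∑ j, c i j • f i j = 0 :=
  sum_eq_zero_of_antisymm R _ fun i j => by
    rw [hf, ← neg_smul, eq_neg_of_add_eq_zero_left (hc i j)]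

/-- The quadratic element `c_{kl} y^k y^l`. -/
def quad (c : Matrix (Fin n) (Fin n) R) : Fed R g n A := ∑ k, ∑ l, c k l • opY k (elY l)

theorem opY_elY_bracket {p pr ps : Matrix (Fin n) (Fin n) R} (h : p = pr + ps)
    (hr : ∀ i j, pr j i = -pr i j) (hs : ∀ i j, ps j i = ps i j) (k l : Fin n) (a : Fed R g n A) :
    circL p (opY k (elY l)) a - circL p a (opY k (elY l)) =
      PowerSeries.X * ((∑ j, pr l j • opY k (opD j a) + ∑ j, pr k j • opY l (opD j a))
        + PowerSeries.X * (wt R 1 • ∑ j, ∑ m, (pr l j * p k m + pr k j * p m l) •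
          opD m (opD j a))) := by
  -- The quadratic monomial differs from `y^k ∘ y^l` by a central multiple of `t`, so its bracket
  -- follows from the Leibniz rule and `elY_circ_sub`.
  have hY : ∀ k l, opY k (elY l) = circL p (elY k) (elY l : Fed R g n A)
      - PowerSeries.X * (wt R 1 • p k l • 1) := fun k l => by
    rw [elY_circ]; simp [opD_elY]
  have hcen : ∀ k l, circL p (PowerSeries.X * (wt R 1 • p k l • 1)) a
      = circL p a (PowerSeries.X * (wt R 1 • p k l • 1)) := fun k l => by
    rw [circ_X_left, circ_X_right]
    simp only [map_smul, LinearMap.smul_apply]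
    rw [circ_of_opD_left p opD_one, circ_of_opD_right p opD_one, one_mul, mul_one]
  have e : circL p (circL p (elY k) (elY l)) a - circL p a (circL p (elY k) (elY l)) =
      circL p (elY k) (circL p (elY l) a - circL p a (elY l))
        + circL p (circL p (elY k) a - circL p a (elY k)) (elY l) := by
    rw [map_sub, map_sub, LinearMap.sub_apply, ← circ_assoc, ← circ_assoc, ← circ_assoc]
    abel
  rw [hY, map_sub, map_sub, LinearMap.sub_apply, hcen, sub_sub_sub_cancel_right, e,
    elY_circ_sub h hr hs, elY_circ_sub h hr hs, circ_X_right, circ_X_left, ← mul_add]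
  refine congrArg (HMul.hMul PowerSeries.X) ?_
  simp only [map_sum, map_smul, LinearMap.sum_apply, LinearMap.smul_apply, elY_circ, circ_elY]
  simp only [smul_add, Finset.sum_add_distrib, add_smul, mul_add, Finset.mul_sum,
    Finset.smul_sum, mul_smul, ← mul_smul_comm]
  simp only [smul_comm (wt R 1)]
  abel

theorem sum_four_swap {M : Type*} [AddCommMonoid M] (f : Fin n → Fin n → Fin n → Fin n → M) :
    ∑ k, ∑ l, ∑ j, ∑ m, f k l j m = ∑ j, ∑ m, ∑ k, ∑ l, f k l j m :=
  calc _ = ∑ k, ∑ j, ∑ l, ∑ m, f k l j m := Finset.sum_congr rfl fun _ _ => Finset.sum_comm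
    _ = ∑ j, ∑ k, ∑ l, ∑ m, f k l j m := Finset.sum_comm
    _ = ∑ j, ∑ k, ∑ m, ∑ l, f k l j m := Finset.sum_congr rfl fun _ _ =>
        Finset.sum_congr rfl fun _ _ => Finset.sum_comm
    _ = _ := Finset.sum_congr rfl fun _ _ => Finset.sum_comm

/-- In the second order part of the bracket the contributions of `r` to `p` cancel, and those of `s`
form a matrix that is antisymmetric because `M` preserves `s` (`hMs`). Second derivatives are
symmetric, so the contraction vanishes. -/
theorem quad_bracket_aux {p pr ps c M : Matrix (Fin n) (Fin n) R} (h : p = pr + ps)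
    (hr : ∀ i j, pr j i = -pr i j) (hs : ∀ i j, ps j i = ps i j) (hc : ∀ k l, c k l = c l k)
    (hM : ∀ l j, ∑ k, c k l * pr k j = M l j)
    (hMs : ∀ m j, ∑ l, ps l m * M l j + ∑ l, ps l j * M l m = 0) (a : Fed R g n A) :
    ∑ k, ∑ l, c k l • ∑ j, ∑ m, (pr l j * p k m + pr k j * p m l) • opD m (opD j a) = 0 := by
  have hN : ∀ j m, ∑ k, ∑ l, c k l * (pr l j * p k m + pr k j * p m l)
      = 2 * ∑ l, ps l m * M l j := fun j m => by
    simp only [mul_add, Finset.sum_add_distrib]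
    have e1 : ∑ k, ∑ l, c k l * (pr l j * p k m) = ∑ l, M l j * p l m := by
      refine Finset.sum_congr rfl fun k _ => ?_
      rw [← hM, Finset.sum_mul]
      exact Finset.sum_congr rfl fun l _ => by rw [hc k l]; ring
    have e2 : ∑ k, ∑ l, c k l * (pr k j * p m l) = ∑ l, M l j * p m l := by
      rw [Finset.sum_comm]
      refine Finset.sum_congr rfl fun l _ => ?_
      rw [← hM, Finset.sum_mul]
      exact Finset.sum_congr rfl fun k _ => by ring
    rw [e1, e2, ← Finset.sum_add_distrib, Finset.mul_sum]
    refine Finset.sum_congr rfl fun l _ => ?_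
    rw [h, Matrix.add_apply, Matrix.add_apply, hr l m, hs l m]; ring
  have e : ∑ k, ∑ l, c k l • ∑ j, ∑ m, (pr l j * p k m + pr k j * p m l) • opD m (opD j a)
      = ∑ j, ∑ m, (∑ k, ∑ l, c k l * (pr l j * p k m + pr k j * p m l)) • opD m (opD j a) := by
    simp only [Finset.smul_sum, smul_smul, Finset.sum_smul]
    exact sum_four_swap fun k l j m =>
      (c k l * (pr l j * p k m + pr k j * p m l)) • opD m (opD j a)
  rw [e]
  simp only [hN]
  exact sum_smul_antisymm (c := fun j m => 2 * ∑ l, ps l m * M l j)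
    (fun j m => by rw [← mul_add, hMs, mul_zero]) fun j m => opD_comm_apply _ _ _

theorem quad_bracket {p pr ps c M : Matrix (Fin n) (Fin n) R} (h : p = pr + ps)
    (hr : ∀ i j, pr j i = -pr i j) (hs : ∀ i j, ps j i = ps i j) (hc : ∀ k l, c k l = c l k)
    (hM : ∀ l j, ∑ k, c k l * pr k j = M l j)
    (hMs : ∀ m j, ∑ l, ps l m * M l j + ∑ l, ps l j * M l m = 0) (a : Fed R g n A) :
    circL p (quad c) a - circL p a (quad c)
      = PowerSeries.X * ((2 : R) • ∑ l, ∑ j, M l j • opY l (opD j a)) := by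
  have t2 : ∑ k, ∑ l, c k l • ∑ j, pr k j • opY l (opD j a) = ∑ l, ∑ j, M l j • opY l (opD j a) := by
    rw [Finset.sum_comm]
    refine Finset.sum_congr rfl fun l _ => ?_
    simp only [Finset.smul_sum, smul_smul]
    rw [Finset.sum_comm]
    exact Finset.sum_congr rfl fun j _ => by rw [← Finset.sum_smul, hM]
  have t1 : ∑ k, ∑ l, c k l • ∑ j, pr l j • opY k (opD j a) = ∑ l, ∑ j, M l j • opY l (opD j a) := by
    rw [← t2, Finset.sum_comm]
    exact Finset.sum_congr rfl fun k _ => Finset.sum_congr rfl fun l _ => by rw [hc]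
  have hq : circL p (quad c) a - circL p a (quad c) =
      ∑ k, ∑ l, c k l • (circL p (opY k (elY l)) a - circL p a (opY k (elY l))) := by
    simp only [quad, map_sum, LinearMap.sum_apply, map_smul, LinearMap.smul_apply, smul_sub,
      Finset.sum_sub_distrib]
  have t3 := quad_bracket_aux h hr hs hc hM hMs a
  rw [hq]
  simp only [opY_elY_bracket h hr hs, ← mul_smul_comm, ← Finset.mul_sum]
  refine congrArg (HMul.hMul PowerSeries.X) ?_
  simp only [smul_add, Finset.sum_add_distrib, t1, t2, ← mul_smul_comm, ← Finset.mul_sum,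
    smul_comm _ (wt R 1), ← Finset.smul_sum, t3, smul_zero, mul_zero, add_zero]
  rw [two_smul]

/-- The element `c_{kl} y^k y^l e^i e^j`. -/
def curvEl (b : Module.Basis (Fin n) R g) (c : Fin n → Fin n → Matrix (Fin n) (Fin n) R) :
    Fed R g n A := ∑ i, ∑ j, opE b i (opE b j (quad (c i j)))

theorem circ_opE_opE (b : Module.Basis (Fin n) R g) (i j : Fin n) (a a' : Fed R g n A) :
    circL p a (opE b i (opE b j a')) = opE b i (opE b j (circL p a a')) := by
  rw [← circ_opE, ← circ_opE, opS_opS']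

/-- The coefficients of the curvature. -/
def curvCoeff (b : Module.Basis (Fin n) R g) (r : g ⊗[R] g) (nab : g →ₗ[R] g →ₗ[R] g)
    (i j : Fin n) : Matrix (Fin n) (Fin n) R :=
  fun k l => rat R (1 / 4) * curvTensor b r nab (b k) (b l) (b i) (b j)

theorem rat_four : rat R (1 / 4) * 4 = 1 := by
  have := rat_mul_natCast (R := R) 4 four_ne_zero
  simpa using this

section

variable {b : Module.Basis (Fin n) R g} {r s : g ⊗[R] g} {nab : g →ₗ[R] g →ₗ[R] g}

theorem coords_antisymm (h : IsAntisymm r) (i j : Fin n) : coords b r j i = -coords b r i j :=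
  congrFun (congrFun (coords_transpose_of_isAntisymm b h) i) j

theorem coords_symm (h : IsSymm s) (i j : Fin n) : coords b s j i = coords b s i j :=
  congrFun (congrFun (coords_transpose_of_isSymm b h) i) j

/-- Contracting `ω` with `r` restores the curvature operator from the curvature tensor. The sign is
that of exchanging the indices of `r`. -/
theorem curvCoeff_mul (hr : IsNondegRMatrix b r) (i j l m : Fin n) :
    ∑ k, curvCoeff b r nab i j k l * coords b r k m = -rat R (1 / 4) * curvMat b nab i j l m := by
  have e : ∀ k, curvCoeff b r nab i j k l * coords b r k m
      = -rat R (1 / 4) * ∑ q, coords b r m k * (coords b r)⁻¹ k q * curvMat b nab i j l q :=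
    fun k => by
      rw [curvCoeff, curvTensor, omega_basis_left, coords_antisymm hr.antisymm m k, Finset.mul_sum,
        Finset.mul_sum, Finset.sum_mul]
      refine Finset.sum_congr rfl fun q _ => ?_
      rw [curvMat]; ring
  simp only [e, ← Finset.mul_sum]
  congr 1
  rw [Finset.sum_comm]
  simp only [← Finset.sum_mul]
  have h1 : ∀ q, ∑ k, coords b r m k * (coords b r)⁻¹ k q = (1 : Matrix (Fin n) (Fin n) R) m q :=
    fun q => by rw [← Matrix.mul_nonsing_inv _ (coords_isUnit_det b hr.nondeg), Matrix.mul_apply]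
  simp only [h1, Matrix.one_apply]
  simp

/-- The bracket with `R` is `t D²`. The commutator is ungraded because `R` has even form degree, and
the quarter in `R` is balanced by the two of `quad_bracket` and the two of `two_smul_opCov_opCov`.
Invariance of `s` under the curvature removes the second order terms. -/
theorem curvEl_bracket (hr : IsNondegRMatrix b r) (hs : IsSymm s)
    (hnab : IsSymplecticTorsionFree b r nab) (hnabs : IsCovConst nab s) (a : Fed R g n A) :
    circL (coords b (r + s)) (curvEl b (curvCoeff b r nab)) a
      - circL (coords b (r + s)) a (curvEl b (curvCoeff b r nab))
      = PowerSeries.X * opCov b nab (opCov b nab a) := by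
  have hq : ∀ i j, circL (coords b (r + s)) (quad (curvCoeff b r nab i j)) a
      - circL (coords b (r + s)) a (quad (curvCoeff b r nab i j))
      = PowerSeries.X * ((2 : R) • ∑ l, ∑ m, (-rat R (1 / 4) * curvMat b nab i j l m) •
        opY l (opD m a)) := fun i j =>
    quad_bracket (coords_add b r s) (coords_antisymm hr.antisymm) (coords_symm hs)
      (fun k l => by rw [curvCoeff, curvTensor_symm hr.antisymm hnab]; rfl)
      (fun l m => curvCoeff_mul hr i j l m)
      (fun m k => by
        have := curv_cov_const_coords (b := b) hnabs i j k m
        have h1 : ∀ l, coords b s l m * (-rat R (1 / 4) * curvMat b nab i j l k) =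
          -rat R (1 / 4) * (coords b s l m * curvMat b nab i j l k) := fun l => by ring
        have h2 : ∀ l, coords b s l k * (-rat R (1 / 4) * curvMat b nab i j l m) =
          -rat R (1 / 4) * (coords b s k l * curvMat b nab i j l m) := fun l => by
            rw [coords_symm hs k l]; ring
        simp only [h1, h2, ← Finset.mul_sum, ← mul_add, this, mul_zero]) a
  simp only [curvEl, map_sum, LinearMap.sum_apply, ← opE_circ, circ_opE_opE]
  rw [← Finset.sum_sub_distrib]
  simp only [← Finset.sum_sub_distrib, ← map_sub, hq]
  have h4 : (4 : R) • (rat R (1 / 4) • opCov b nab (opCov b nab a)) = opCov b nab (opCov b nab a) := by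
    rw [smul_smul, mul_comm, rat_four, one_smul]
  have h5 : opCov b nab (opCov b nab a) = (2 * rat R (1 / 4)) • ((2 : R) • opCov b nab (opCov b nab a)) := by
    rw [smul_smul, show 2 * rat R (1 / 4) * 2 = rat R (1 / 4) * 4 by ring, rat_four, one_smul]
  rw [h5, two_smul_opCov_opCov b nab hnab]
  simp only [(tlinear_opE b _) _, ← Finset.mul_sum]
  refine congrArg (HMul.hMul PowerSeries.X) ?_
  simp only [map_smul, map_sum, mul_smul, neg_smul, ← Finset.smul_sum, Finset.sum_neg_distrib,
    smul_neg, map_neg]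

end

end Curvature

/-! ### Bianchi identities for the curvature element. -/

section Bianchi

variable {R g : Type*} [CommRing R] [Algebra ℚ R] [LieRing g] [LieAlgebra R g] {n : ℕ}
  {A : Type*} [Ring A] [Algebra R A]

theorem eq_zero_of_opD {a : Fed R g n A} (h : ∀ i, opD i a = 0) (h0 : ∀ m, cf m 0 a = 0) :
    a = 0 := fed_ext fun m κ => by
  rw [cf_zero]
  by_cases hκ : κ = 0
  · rw [hκ, h0]
  · obtain ⟨i, hi⟩ : ∃ i, κ i ≠ 0 := by
      by_contra! hc
      exact hκ (Finsupp.ext hc)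
    have he : κ - Finsupp.single i 1 + Finsupp.single i 1 = κ := tsub_add_cancel_of_le (by
      rw [Finsupp.single_le_iff]; omega)
    have := cf_opD m (κ - Finsupp.single i 1) i a
    rw [h i, cf_zero, he] at this
    refine eq_zero_of_natCast_smul R (N := (κ - Finsupp.single i 1 : Fin n →₀ ℕ) i + 1) (by omega) ?_
    rw [Nat.cast_smul_eq_nsmul, ← this]

variable {b : Module.Basis (Fin n) R g} {r s : g ⊗[R] g} {nab : g →ₗ[R] g →ₗ[R] g}

/-- Commuting with `y^k` forces `r^{kj} ∂_j a = 0`; inverting `r` kills every partial derivative. -/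
theorem opD_eq_zero_of_commute (hr : IsNondegRMatrix b r) (hs : IsSymm s) {a : Fed R g n A}
    (h : ∀ k, circL (coords b (r + s)) a (elY k) = circL (coords b (r + s)) (elY k) a)
    (i : Fin n) : opD i a = 0 := by
  have h1 : ∀ k, ∑ j, coords b r k j • opD j a = 0 := fun k => X_mul_cancel (by
    rw [← elY_circ_sub (coords_add b r s) (coords_antisymm hr.antisymm) (coords_symm hs), h,
      sub_self, mul_zero])
  have h2 : ∑ k, (coords b r)⁻¹ i k • ∑ j, coords b r k j • opD j a = opD i a := by
    simp only [Finset.smul_sum, smul_smul]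
    rw [Finset.sum_comm]
    simp only [← Finset.sum_smul, ← Matrix.mul_apply,
      Matrix.nonsing_inv_mul _ (coords_isUnit_det b hr.nondeg), Matrix.one_apply]
    simp
  rw [← h2]
  simp [h1]

theorem opY_one (k : Fin n) : opY k (1 : Fed R g n A) = elY k := by rw [opY_apply, mul_one]

theorem isForm_elY (k : Fin n) : IsForm 0 (elY k : Fed R g n A) := by
  rw [← opY_one]; exact IsForm.one.opY k

theorem opS_elY (k : Fin n) : opS (elY k : Fed R g n A) = elY k := by
  rw [(isForm_elY k).opS_eq, pow_zero, one_smul]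

theorem isForm_quad (c : Matrix (Fin n) (Fin n) R) : IsForm 0 (quad c : Fed R g n A) :=
  IsForm.sum fun _ _ => IsForm.sum fun _ _ => ((isForm_elY _).opY _).smul _

theorem isForm_curvEl (c : Fin n → Fin n → Matrix (Fin n) (Fin n) R) :
    IsForm 2 (curvEl b c : Fed R g n A) :=
  IsForm.sum fun _ _ => IsForm.sum fun _ _ => ((isForm_quad _).opE b _).opE b _

theorem inFiltration_elY (k : Fin n) : InFiltration 1 (elY k : Fed R g n A) := by
  rw [← opY_one]; exact (InFiltration.zero_left 1).opY k

theorem inFiltration_quad (c : Matrix (Fin n) (Fin n) R) :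
    InFiltration 2 (quad c : Fed R g n A) :=
  InFiltration.sum fun _ _ => InFiltration.sum fun _ _ => ((inFiltration_elY _).opY _).smul _

theorem inFiltration_curvEl (c : Fin n → Fin n → Matrix (Fin n) (Fin n) R) :
    InFiltration 2 (curvEl b c : Fed R g n A) :=
  InFiltration.sum fun _ _ => InFiltration.sum fun _ _ => ((inFiltration_quad _).opE b _).opE b _

theorem cf_opY_zero (m : ℕ) (k : Fin n) (a : Fed R g n A) : cf m 0 (opY k a) = 0 := by
  simp [cf_opY]

theorem cf_quad_zero (m : ℕ) (c : Matrix (Fin n) (Fin n) R) : cf m 0 (quad c : Fed R g n A) = 0 := by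
  simp [quad, cf_opY_zero]

theorem cf_opD_quad_zero (m : ℕ) (i : Fin n) (c : Matrix (Fin n) (Fin n) R) :
    cf m 0 (opD i (quad c : Fed R g n A)) = 0 := by
  simp only [quad, map_sum, map_smul, opY_opD', cf_sum, cf_smul, cf_add, cf_opY_zero, cf_ite,
    cf_elY]
  refine Finset.sum_eq_zero fun k _ => Finset.sum_eq_zero fun l _ => ?_
  have : (0 : Fin n →₀ ℕ) ≠ Finsupp.single l 1 := fun h => by
    have := DFunLike.congr_fun h l
    simp at this
  simp [this]

theorem opS_curvEl (c : Fin n → Fin n → Matrix (Fin n) (Fin n) R) :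
    opS (curvEl b c : Fed R g n A) = curvEl b c := by
  rw [(isForm_curvEl c).opS_eq]; simp

theorem cf_opDelta_curvEl_zero (m : ℕ) (c : Fin n → Fin n → Matrix (Fin n) (Fin n) R) :
    cf m 0 (opDelta b (curvEl b c : Fed R g n A)) = 0 := by
  simp only [opDelta_apply, curvEl, map_sum, opD_opE', cf_sum, cf_opE, cf_opD_quad_zero, mul_zero,
    Finset.sum_const_zero]

theorem cf_opCov_zero {m : ℕ} {a : Fed R g n A} (h : cf m 0 a = 0) :
    cf m 0 (opCov b nab a) = 0 := by
  simp [opCov_apply, opNab_apply, opHat_apply, cf_opE, cf_opI, cf_opY_zero, h]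

theorem cf_curvEl_zero (m : ℕ) (c : Fin n → Fin n → Matrix (Fin n) (Fin n) R) :
    cf m 0 (curvEl b c : Fed R g n A) = 0 := by
  simp [curvEl, cf_opE, cf_quad_zero]

/-- Applying `T` to `[R, y^k] = t D² y^k` gives `[TR, y^k] + [R, T y^k] = t D² T y^k`, whose right
side is again `[R, T y^k]`. So `TR` commutes with all `y^k` and is free of `y` by nondegeneracy;
since its part in symmetric degree zero is zero, it vanishes. With `T = δ` and `T = D` this yields
both Bianchi identities without index computations. -/
theorem eq_zero_of_isAntider (hr : IsNondegRMatrix b r) (hs : IsSymm s)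
    (hnab : IsSymplecticTorsionFree b r nab) (hnabs : IsCovConst nab s)
    {T : Module.End R (Fed R g n A)} (hT : IsAntider (coords b (r + s)) T) (hX : TLinear T)
    (hD : ∀ a, T (opCov b nab (opCov b nab a)) = opCov b nab (opCov b nab (T a)))
    (h0 : ∀ m, cf m 0 (T (curvEl b (curvCoeff b r nab))) = 0) :
    T (curvEl b (curvCoeff b r nab)) = 0 := by
  refine eq_zero_of_opD (opD_eq_zero_of_commute hr hs fun k => ?_) h0
  have h1 := congrArg T (curvEl_bracket hr hs hnab hnabs (elY k : Fed R g n A))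
  rw [map_sub, hT, hT, opS_curvEl, opS_elY, hX, hD, ← curvEl_bracket hr hs hnab hnabs] at h1
  rw [← sub_eq_zero, ← sub_eq_zero.2 h1]
  abel

theorem opDelta_curvEl (hr : IsNondegRMatrix b r) (hs : IsSymm s)
    (hnab : IsSymplecticTorsionFree b r nab) (hnabs : IsCovConst nab s) :
    opDelta b (curvEl b (curvCoeff b r nab) : Fed R g n A) = 0 :=
  eq_zero_of_isAntider hr hs hnab hnabs (isAntider_opDelta b) (tlinear_opDelta b)
    (fun a => by
      -- Anticommuting with `D` twice amounts to commuting with `D²`.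
      rw [eq_neg_of_add_eq_zero_left (opDelta_opCov b nab _),
        eq_neg_of_add_eq_zero_left (opDelta_opCov b nab _), map_neg, neg_neg])
    fun m => cf_opDelta_curvEl_zero m _

theorem coords_add_derivation (hr : IsNondegRMatrix b r)
    (hnab : IsSymplecticTorsionFree b r nab) (hnabs : IsCovConst nab s) (m k l : Fin n) :
    ∑ i, coords b (r + s) i l * chr b nab m i k + ∑ i, coords b (r + s) k i * chr b nab m i l
      = 0 := by
  have h1 := symplectic_coords (coords_isUnit_det b hr.nondeg) hnab m k l
  have h2 := cov_const_coords (b := b) hnabs m k l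
  simp only [coords_add, Matrix.add_apply, add_mul, Finset.sum_add_distrib]
  linear_combination h1 + h2

theorem opCov_curvEl (hr : IsNondegRMatrix b r) (hs : IsSymm s)
    (hnab : IsSymplecticTorsionFree b r nab) (hnabs : IsCovConst nab s) :
    opCov b nab (curvEl b (curvCoeff b r nab) : Fed R g n A) = 0 :=
  eq_zero_of_isAntider hr hs hnab hnabs
    (isAntider_opCov b nab (coords_add_derivation hr hnab hnabs)) (tlinear_opCov b nab)
    (fun _ => rfl) fun m => cf_opCov_zero (cf_curvEl_zero m _)

theorem curvature_eq : curvature b r nab = curvEl b (curvCoeff b r nab) := by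
  simp only [curvature, curvEl, quad, symMul_eq, wedge_eq, map_sum, map_smul]
  rw [sum_four_swap]
  refine Finset.sum_congr rfl fun i _ => Finset.sum_congr rfl fun j _ => Finset.sum_congr rfl
    fun k _ => Finset.sum_congr rfl fun l _ => ?_
  rw [← opY_one, opY_opE', opY_opE', opY_opE', opY_opE']
  rfl

end Bianchi

/-! ### Passing from `W ⊗ Λ` to `A ⊗ W ⊗ Λ`. -/

section Extend

variable {R g : Type*} [CommRing R] [LieRing g] [LieAlgebra R g] {n : ℕ}
  (A : Type*) [Ring A] [Algebra R A]

/-- The map `c ↦ 1 ⊗ c` on coefficients. -/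
def cfExt : Cf R g R →ₐ[R] Cf R g A :=
  Algebra.TensorProduct.map (Algebra.ofId R A) (AlgHom.id R (Forms R g))

theorem cfExt_tmul (c : R) (α : Forms R g) :
    cfExt A (c ⊗ₜ[R] α) = algebraMap R A c ⊗ₜ[R] α := rfl

theorem cfExt_self (c : Cf R g R) : cfExt R c = c := by
  induction c using TensorProduct.induction_on with
  | zero => exact map_zero _
  | add x y hx hy => rw [map_add, hx, hy]
  | tmul x α => rfl

theorem cfExt_lTensor (f : Forms R g →ₗ[R] Forms R g) (c : Cf R g R) :
    cfExt A (LinearMap.lTensor R f c) = LinearMap.lTensor A f (cfExt A c) := by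
  induction c using TensorProduct.induction_on with
  | zero => simp
  | add x y hx hy => simp only [map_add, hx, hy]
  | tmul x α => rfl

theorem cf_extend (m : ℕ) (κ : Fin n →₀ ℕ) (a : Fed R g n R) :
    cf m κ (extend A a) = cfExt A (cf m κ a) := rfl

/-- `extend` as a linear map. -/
def extL : Fed R g n R →ₗ[R] Fed R g n A where
  toFun := extend A
  map_add' _ _ := map_add _ _ _
  map_smul' c a := fed_ext fun m κ => by
    rw [cf_extend, cf_smul, map_smul]; rfl

theorem cf_extL (m : ℕ) (κ : Fin n →₀ ℕ) (a : Fed R g n R) :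
    cf m κ (extL A a) = cfExt A (cf m κ a) := rfl

theorem extL_self (a : Fed R g n R) : extL R a = a := fed_ext fun m κ => by
  rw [cf_extL, cfExt_self]

theorem extL_mul (a a' : Fed R g n R) : extL A (a * a') = extL A a * extL A a' :=
  map_mul (PowerSeries.map (MvPowerSeries.map (cfExt A).toRingHom)) a a'

theorem extL_one : extL A (1 : Fed R g n R) = 1 :=
  map_one (PowerSeries.map (MvPowerSeries.map (cfExt A : Cf R g R →ₐ[R] Cf R g A).toRingHom))

theorem extL_mapEnd (f : Forms R g →ₗ[R] Forms R g) (a : Fed R g n R) :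
    extL A (mapEnd R g n R (LinearMap.lTensor R f) a)
      = mapEnd R g n A (LinearMap.lTensor A f) (extL A a) := fed_ext fun m κ => by
  rw [cf_extL, cf_mapEnd, cf_mapEnd, cfExt_lTensor, cf_extL]

theorem extL_opD (i : Fin n) (a : Fed R g n R) : extL A (opD i a) = opD i (extL A a) :=
  fed_ext fun m κ => by
    rw [cf_extL, cf_opD, cf_opD, map_nsmul, cf_extL]

theorem extL_opY (i : Fin n) (a : Fed R g n R) : extL A (opY i a) = opY i (extL A a) :=
  fed_ext fun m κ => by
    rw [cf_extL, cf_opY, cf_opY]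
    split_ifs
    · exact map_zero _
    · rw [cf_extL]

theorem extL_opE (b : Module.Basis (Fin n) R g) (i : Fin n) (a : Fed R g n R) :
    extL A (opE b i a) = opE b i (extL A a) := fed_ext fun m κ => by
  rw [cf_extL, cf_opE, cf_opE, map_mul, cfExt_tmul, map_one, cf_extL]

theorem extL_opI (b : Module.Basis (Fin n) R g) (i : Fin n) (a : Fed R g n R) :
    extL A (opI b i a) = opI b i (extL A a) := extL_mapEnd A _ _

theorem extL_elY (i : Fin n) : extL A (elY i : Fed R g n R) = elY i := by
  rw [← mul_one (elY i), ← opY_apply, extL_opY, extL_one, opY_apply, mul_one]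

theorem cfExt_mem {l : ℕ} {c : Cf R g R} (hc : c ∈ CfForm R g R l) :
    cfExt A c ∈ CfForm R g A l :=
  CfForm_induction (C := fun c => cfExt A c ∈ CfForm R g A l)
    (by rw [map_zero]; exact zero_mem _) (fun x y hx hy => by rw [map_add]; exact add_mem hx hy)
    (fun r x hx => by rw [map_smul]; exact Submodule.smul_mem _ _ hx)
    (fun a α hα => tmul_mem_CfForm _ hα) hc

variable {A} in
theorem IsForm.extL {l : ℕ} {a : Fed R g n R} (h : IsForm l a) : IsForm l (extL A a) :=
  fun m κ => cfExt_mem A (h m κ)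

variable {A} in
theorem InFiltration.extL {k : ℕ} {a : Fed R g n R} (h : InFiltration k a) :
    InFiltration k (extL A a) := fun m κ hm => by
  rw [cf_extL, h m κ hm, map_zero]

/-- An extended element has only scalars in its `A`-factor. These are central even if `A` is
noncommutative, so only the sign from the forms remains. -/
theorem cfExt_mul_comm {l : ℕ} {c : Cf R g R} (hc : c ∈ CfForm R g R l) (c' : Cf R g A) :
    cfExt A c * c' = LinearMap.lTensor A (signForm ^ l) c' * cfExt A c :=
  CfForm_induction (C := fun c => cfExt A c * c' =
      LinearMap.lTensor A (signForm ^ l) c' * cfExt A c)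
    (by rw [map_zero, zero_mul, mul_zero])
    (fun x y hx hy => by rw [map_add, add_mul, hx, hy, mul_add])
    (fun r x hx => by rw [map_smul, smul_mul_assoc, hx, mul_smul_comm])
    (fun a α hα => by
      induction c' using TensorProduct.induction_on with
      | zero => simp
      | add x y hx hy => rw [mul_add, hx, hy, map_add, add_mul]
      | tmul a' β =>
        rw [cfExt_tmul, LinearMap.lTensor_tmul, Algebra.TensorProduct.tmul_mul_tmul,
          Algebra.TensorProduct.tmul_mul_tmul, extPow_mul_comm hα, Algebra.commutes, Module.End.pow_apply]) hc

theorem extL_mul_comm {l : ℕ} {x : Fed R g n R} (h : IsForm l x) (a : Fed R g n A) :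
    extL A x * a = mapEnd R g n A (LinearMap.lTensor A (signForm ^ l)) a * extL A x :=
  fed_ext fun m κ => by
    rw [cf_mul, cf_mul, ← Finset.Nat.sum_antidiagonal_swap]
    refine Finset.sum_congr rfl fun p _ => ?_
    rw [Finsupp.sum_antidiagonal_swap κ fun u v => cf p.swap.1 u (extL A x) * cf p.swap.2 v a]
    refine Finset.sum_congr rfl fun q _ => ?_
    rw [cf_extL, cfExt_mul_comm A (h _ _), cf_mapEnd]; rfl

theorem extL_mul_comm_one {x : Fed R g n R} (h : IsForm 1 x) (a : Fed R g n A) :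
    extL A x * a = opS a * extL A x := by
  rw [extL_mul_comm A h, pow_one]; rfl

theorem extL_mul_comm_two {x : Fed R g n R} (h : IsForm 2 x) (a : Fed R g n A) :
    extL A x * a = a * extL A x := by
  rw [extL_mul_comm A h, show (signForm ^ 2 : Module.End R (Forms R g)) = 1 from
    LinearMap.ext fun α => signForm_signForm α]
  congr 1
  refine fed_ext fun m κ => ?_
  rw [cf_mapEnd]; exact LinearMap.congr_fun (LinearMap.lTensor_id A (Forms R g)) _

end Extend

/-! ### Compatibility of the extension with the operators. -/

section ExtendCirc

variable {R g : Type*} [CommRing R] [Algebra ℚ R] [LieRing g] [LieAlgebra R g] {n : ℕ}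
  (A : Type*) [Ring A] [Algebra R A] (b : Module.Basis (Fin n) R g)

theorem extL_moyalL (p : Matrix (Fin n) (Fin n) R) (N : ℕ) (a a' : Fed R g n R) :
    extL A (moyalL p N a a') = moyalL p N (extL A a) (extL A a') := by
  induction N generalizing a a' with
  | zero => exact extL_mul A a a'
  | succ N ih => simp only [moyalL_succ, map_sum, map_smul, ih, extL_opD]

theorem extL_circL (p : Matrix (Fin n) (Fin n) R) (a a' : Fed R g n R) :
    extL A (circL p a a') = circL p (extL A a) (extL A a') := fed_ext fun m κ => by
  simp only [cf_extL, cf_circL, map_sum, map_smul, ← extL_moyalL]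

theorem extL_opDelta (a : Fed R g n R) : extL A (opDelta b a) = opDelta b (extL A a) := by
  simp only [opDelta_apply, map_sum, extL_opE, extL_opD]

theorem extL_opCov (nab : g →ₗ[R] g →ₗ[R] g) (a : Fed R g n R) :
    extL A (opCov b nab a) = opCov b nab (extL A a) := by
  simp only [opCov_apply, opNab_apply, opHat_apply, map_sum, map_neg, map_smul, map_add,
    extL_opE, extL_opD, extL_opY, extL_opI]

theorem extL_curvEl (c : Fin n → Fin n → Matrix (Fin n) (Fin n) R) :
    extL A (curvEl b c) = curvEl b c := by
  simp only [curvEl, quad, map_sum, map_smul, extL_opE, extL_opY, extL_elY]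

variable {A}

theorem act_algebraMap (T : DerivationAction R g A) (X : g) (c : R) :
    T.act X (algebraMap R A c) = 0 := by
  have h := T.leibniz X 1 1
  rw [one_mul, one_mul, mul_one, left_eq_add] at h
  rw [Algebra.algebraMap_eq_smul_one, map_smul, h, smul_zero]

/-- A derivation annihilates scalars. Hence `L_A` kills `ϱ`, and its anticommutator with `ad(ϱ)` is
zero. -/
theorem opAct_extL (T : DerivationAction R g A) (i : Fin n) (a : Fed R g n R) :
    opAct b T i (extL A a) = 0 := fed_ext fun m κ => by
  rw [cf_opAct, cf_extL, cf_zero]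
  induction cf m κ a using TensorProduct.induction_on with
  | zero => simp
  | add x y hx hy => rw [map_add, map_add, hx, hy, add_zero]
  | tmul x α => rw [cfExt_tmul, LinearMap.rTensor_tmul, act_algebraMap, TensorProduct.zero_tmul]

theorem opLeft_extL (T : DerivationAction R g A) (a : Fed R g n R) :
    opLeft b T (extL A a) = 0 := by
  simp [opLeft_apply, opAct_extL]

end ExtendCirc

/-! ### The series of closed two-forms. -/

section ClosedForms

variable {R g : Type*} [CommRing R] [Algebra ℚ R] [LieRing g] [LieAlgebra R g] {n : ℕ}
  {b : Module.Basis (Fin n) R g} {Om : PowerSeries (Forms R g)}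

theorem cf_ofForms (m : ℕ) (κ : Fin n →₀ ℕ) (Om : PowerSeries (Forms R g)) :
    cf m κ (ofForms Om : Fed R g n R) =
      if κ = 0 then (1 : R) ⊗ₜ[R] PowerSeries.coeff m Om else 0 := by
  classical
  rw [cf, ofForms, PowerSeries.coeff_map, RingHom.comp_apply, MvPowerSeries.coeff_C]
  rfl

theorem opD_ofForms (i : Fin n) : opD i (ofForms Om : Fed R g n R) = 0 := fed_ext fun m κ => by
  rw [cf_opD, cf_ofForms, if_neg, smul_zero, cf_zero]
  intro h
  have := DFunLike.congr_fun h i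
  simp at this

theorem isForm_ofForms (h : IsClosedSeries b Om) : IsForm 2 (ofForms Om : Fed R g n R) :=
  fun m κ => by
    rw [cf_ofForms]
    split_ifs
    · exact tmul_mem_CfForm _ (h.two_form m)
    · exact zero_mem _

theorem inFiltration_ofForms (h : IsClosedSeries b Om) :
    InFiltration 2 (ofForms Om : Fed R g n R) := fun m κ hm => by
  obtain rfl : m = 0 := by omega
  rw [cf_ofForms, h.coeff_zero, TensorProduct.tmul_zero, ite_self]

theorem opDelta_ofForms : opDelta b (ofForms Om : Fed R g n R) = 0 := by
  simp [opDelta_apply, opD_ofForms]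

/-- On elements without `y`, antisymmetrising the Christoffel symbols of a torsion-free connection
yields structure constants, so `D` becomes the Chevalley-Eilenberg differential. -/
theorem opCov_ofForms {r : g ⊗[R] g} {nab : g →ₗ[R] g →ₗ[R] g}
    (hnab : IsSymplecticTorsionFree b r nab) (h : IsClosedSeries b Om) :
    opCov b nab (ofForms Om : Fed R g n R) = 0 := by
  have h1 : opCov b nab (ofForms Om : Fed R g n R) =
      -∑ i, ∑ j, opE b i (opE b j (∑ k, chr b nab i j k • opI b k (ofForms Om))) := by
    simp only [opCov_apply, opNab_apply, opHat_apply, opD_ofForms, map_zero, zero_add, map_neg,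
      map_sum, map_smul, Finset.sum_neg_distrib]
  refine eq_zero_of_natCast_smul R two_ne_zero ?_
  rw [h1, smul_neg, Nat.cast_two, two_smul_sum_antisymm]
  simp only [← Finset.sum_sub_distrib, ← sub_smul, ← torsion_coords hnab]
  rw [neg_eq_zero]
  refine fed_ext fun m κ => ?_
  simp only [cf_sum, cf_opE, cf_smul, cf_opI, cf_ofForms, cf_zero]
  split_ifs with hκ
  -- The factor `-2` clears the `-1/2` in `deltaCE`.
  · have hc := congrArg (fun α => (1 : R) ⊗ₜ[R] ((-2 : R) • α)) (h.closed m)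
    simp only [smul_zero, TensorProduct.tmul_zero] at hc
    rw [← hc]
    simp only [LinearMap.lTensor_tmul, deltaCE, ← TensorProduct.tmul_smul, ← TensorProduct.tmul_sum,
      Algebra.TensorProduct.tmul_mul_tmul, one_mul]
    congr 1
    simp only [Finset.sum_mul, Finset.mul_sum, smul_mul_assoc, mul_smul_comm, Finset.smul_sum,
      smul_smul, ← mul_assoc]
    have h2 : (-2 : R) * -rat R (1 / 2) = 1 := by
      have := rat_mul_natCast (R := R) 2 two_ne_zero
      rw [Nat.cast_two, Nat.cast_two] at this
      linear_combination this
    simp only [h2, one_mul]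
    rw [Finset.sum_comm (f := fun k i => ∑ j, b.coord k ⁅b i, b j⁆ •
      (dualVec b i * dualVec b j * insForm (b k) (PowerSeries.coeff m Om)))]
    exact Finset.sum_congr rfl fun i _ => Finset.sum_comm
  · simp

end ClosedForms

/-! ### Fixed points in the complete filtration. -/

section FixedPoint

variable {R g : Type*} [CommRing R] [LieRing g] [LieAlgebra R g] {n : ℕ}
  {A : Type*} [Ring A] [Algebra R A]

/-- Maps that raise the filtration of differences have a fixed point. -/
theorem exists_fixedPoint {S : Fed R g n A → Prop} {Φ : Fed R g n A → Fed R g n A}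
    (h0 : S 0) (hS : ∀ a, (∀ k, ∃ a', S a' ∧ InFiltration k (a - a')) → S a)
    (hΦ : ∀ a, S a → S (Φ a))
    (hc : ∀ k a a', S a → S a' → InFiltration k (a - a') → InFiltration (k + 1) (Φ a - Φ a')) :
    ∃ a, S a ∧ Φ a = a := by
  set x : ℕ → Fed R g n A := fun k => Φ^[k] 0
  have hx : ∀ k, x (k + 1) = Φ (x k) := fun k => Function.iterate_succ_apply' Φ k 0
  have hSx : ∀ k, S (x k) := fun k => by
    induction k with
    | zero => exact h0
    | succ k ih => rw [hx]; exact hΦ _ ih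
  have hstep : ∀ k, InFiltration k (x (k + 1) - x k) := fun k => by
    induction k with
    | zero => exact InFiltration.zero_left _
    | succ k ih =>
      have h := hc _ _ _ (hSx _) (hSx _) ih
      rwa [← hx, ← hx] at h
  have hfar : ∀ k j, InFiltration k (x (k + j) - x k) := fun k j => by
    induction j with
    | zero => rw [add_zero, sub_self]; exact InFiltration.zero _
    | succ j ih =>
      have h := ((hstep (k + j)).mono (Nat.le_add_right k j)).add ih
      rwa [sub_add_sub_cancel] at h
  -- The coefficient of `t^m y^κ` is stationary from this iterate on: later ones differ only in
  -- total degree above `2 m + |κ|`. The limit is read off coefficientwise.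
  set a : Fed R g n A := mkFed fun m κ => cf m κ (x (2 * m + κ.degree + 1))
  have ha : ∀ k, InFiltration k (a - x k) := fun k m κ hm => by
    obtain ⟨j, rfl⟩ := Nat.exists_eq_add_of_le (Nat.succ_le_of_lt hm)
    have h := hfar (2 * m + κ.degree + 1) j m κ (by omega)
    rw [cf_sub, sub_eq_zero] at h
    rw [cf_sub, cf_mkFed, Nat.succ_eq_add_one, h, sub_self]
  have hSa : S a := hS a fun k => ⟨x k, hSx k, ha k⟩
  refine ⟨a, hSa, sub_eq_zero.1 (eq_zero_of_inFiltration fun k => ?_)⟩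
  have h := ((hc k _ _ hSa (hSx k) (ha k)).mono (Nat.le_succ k)).sub
    ((ha (k + 1)).mono (Nat.le_succ k))
  rwa [hx, sub_sub_sub_cancel_right] at h

theorem fixedPoint_unique {S : Fed R g n A → Prop} {Φ : Fed R g n A → Fed R g n A}
    (hc : ∀ k a a', S a → S a' → InFiltration k (a - a') → InFiltration (k + 1) (Φ a - Φ a'))
    {a a' : Fed R g n A} (ha : S a) (ha' : S a') (h : Φ a = a) (h' : Φ a' = a') : a = a' := by
  refine sub_eq_zero.1 (eq_zero_of_inFiltration fun k => ?_)
  induction k with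
  | zero => exact InFiltration.zero_left _
  | succ k ih =>
    have := hc k a a' ha ha' ih
    rwa [h, h'] at this

/-- This is how all defects are eliminated: an element equal to its own image under a degree-raising
operator lies in every filtration step. -/
theorem eq_zero_of_raise {a : Fed R g n A}
    (h : ∀ k, InFiltration k a → InFiltration (k + 1) a) : a = 0 :=
  eq_zero_of_inFiltration fun k => by
    induction k with
    | zero => exact InFiltration.zero_left _
    | succ k ih => exact h k ih

theorem inFiltration_of_approx {l : ℕ} {a : Fed R g n A}
    (h : ∀ k, ∃ a', InFiltration l a' ∧ InFiltration k (a - a')) : InFiltration l a := by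
  obtain ⟨a', h1, h2⟩ := h l
  rw [← sub_add_cancel a a']; exact h2.add h1

theorem isForm_of_approx {l : ℕ} {a : Fed R g n A}
    (h : ∀ k, ∃ a', IsForm l a' ∧ InFiltration k (a - a')) : IsForm l a := fun m κ => by
  obtain ⟨a', h1, h2⟩ := h (2 * m + κ.degree + 1)
  have := h2 m κ (by omega)
  rw [cf_sub, sub_eq_zero] at this
  rw [this]; exact h1 m κ

end FixedPoint

/-! ### Degree estimates for `D` and `L_A`. -/

section Operators

variable {R g : Type*} [CommRing R] [Algebra ℚ R] [LieRing g] [LieAlgebra R g] {n : ℕ}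
  {A : Type*} [Ring A] [Algebra R A] (b : Module.Basis (Fin n) R g)

/-- Division by `t` as a linear map. -/
def opDivT : Module.End R (Fed R g n A) where
  toFun := divT
  map_add' _ _ := fed_ext fun _ _ => by simp only [cf_divT, cf_add]
  map_smul' _ _ := fed_ext fun _ _ => by simp only [cf_divT, cf_smul, RingHom.id_apply]

theorem divT_eq (a : Fed R g n A) : divT a = opDivT a := rfl

theorem coeff_zero_circL (p : Matrix (Fin n) (Fin n) R) (a a' : Fed R g n A) :
    PowerSeries.coeff 0 (circL p a a') = PowerSeries.coeff 0 (a * a') := by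
  rw [← circ_eq, coeff_circ]
  simp [wt, moyalL_zero]

theorem InFiltration.opNab {k : ℕ} {a : Fed R g n A} (nab : g →ₗ[R] g →ₗ[R] g) (i : Fin n)
    (h : InFiltration k a) : InFiltration k (opNab b nab i a) := by
  rw [opNab_apply, opHat_apply]
  refine (InFiltration.sum fun j _ => InFiltration.sum fun l _ => InFiltration.smul
    (InFiltration.add (InFiltration.mono ((h.opD l).opY j) (by omega)) ((h.opI b l).opE b j)) _).neg

theorem InFiltration.opCov {k : ℕ} {a : Fed R g n A} (nab : g →ₗ[R] g →ₗ[R] g)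
    (h : InFiltration k a) : InFiltration k (opCov b nab a) := by
  rw [opCov_apply]
  exact InFiltration.sum fun i _ => (h.opNab b nab i).opE b i

theorem InFiltration.opLeft {k : ℕ} {a : Fed R g n A} (T : DerivationAction R g A)
    (h : InFiltration k a) : InFiltration k (opLeft b T a) := by
  rw [opLeft_apply]
  exact InFiltration.sum fun i _ => (h.mapEnd _).opE b i

theorem IsForm.opEI {l : ℕ} {a : Fed R g n A} (h : IsForm l a) (i j : Fin n) :
    IsForm l (Fedosov.opE b i (Fedosov.opI b j a)) := by
  cases l with
  | zero => rw [h.opI_eq_zero, map_zero]; exact IsForm.zero _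
  | succ l => exact (h.opI b j).opE b i

theorem IsForm.opNab {l : ℕ} {a : Fed R g n A} (nab : g →ₗ[R] g →ₗ[R] g) (i : Fin n)
    (h : IsForm l a) : IsForm l (opNab b nab i a) := by
  rw [opNab_apply, opHat_apply]
  exact (IsForm.sum fun j _ => IsForm.sum fun k _ => IsForm.smul
    (IsForm.add ((h.opD k).opY j) (h.opEI b j k)) _).neg

theorem IsForm.opCov {l : ℕ} {a : Fed R g n A} (nab : g →ₗ[R] g →ₗ[R] g)
    (h : IsForm l a) : IsForm (l + 1) (opCov b nab a) := by
  rw [opCov_apply]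
  exact IsForm.sum fun i _ => (h.opNab b nab i).opE b i

theorem rTensor_mem_CfForm (f : A →ₗ[R] A) {l : ℕ} {c : Cf R g A} (hc : c ∈ CfForm R g A l) :
    LinearMap.rTensor (Forms R g) f c ∈ CfForm R g A l :=
  CfForm_induction (C := fun c => LinearMap.rTensor (Forms R g) f c ∈ CfForm R g A l)
    (by simp) (fun x y hx hy => by rw [map_add]; exact add_mem hx hy)
    (fun r x hx => by rw [map_smul]; exact Submodule.smul_mem _ _ hx)
    (fun a α hα => tmul_mem_CfForm _ hα) hc

theorem IsForm.opLeft {l : ℕ} {a : Fed R g n A} (T : DerivationAction R g A)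
    (h : IsForm l a) : IsForm (l + 1) (opLeft b T a) := by
  rw [opLeft_apply]
  refine IsForm.sum fun i _ => IsForm.opE (fun m κ => ?_) b i
  rw [cf_opAct]; exact rTensor_mem_CfForm _ (h m κ)

end Operators

/-! ### Existence and uniqueness of `ϱ`. -/

section FedosovElement

variable {R g : Type*} [CommRing R] [Algebra ℚ R] [LieRing g] [LieAlgebra R g] {n : ℕ}
  {A : Type*} [Ring A] [Algebra R A]
  {b : Module.Basis (Fin n) R g} {r s : g ⊗[R] g} {nab : g →ₗ[R] g →ₗ[R] g}
  {Om : PowerSeries (Forms R g)}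

/-- The right hand side `R + Dx + (1/t) x ∘ x + Ω` of Fedosov's equation. -/
def fedosovRhs (b : Module.Basis (Fin n) R g) (r s : g ⊗[R] g) (nab : g →ₗ[R] g →ₗ[R] g)
    (Om : PowerSeries (Forms R g)) (x : Fed R g n R) : Fed R g n R :=
  curvEl b (curvCoeff b r nab) + opCov b nab x + opDivT (circL (coords b (r + s)) x x)
    + ofForms Om

/-- The iteration `x ↦ δ⁻¹ (R + Dx + (1/t) x ∘ x + Ω)`. -/
def fedosovMap (b : Module.Basis (Fin n) R g) (r s : g ⊗[R] g) (nab : g →ₗ[R] g →ₗ[R] g)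
    (Om : PowerSeries (Forms R g)) (x : Fed R g n R) : Fed R g n R :=
  opInv b (fedosovRhs b r s nab Om x)

/-- One-forms of total degree at least two. -/
def IsCandidate (x : Fed R g n R) : Prop := InFiltration 2 x ∧ IsForm 1 x

theorem IsCandidate.fedosovRhs_form (hOm : IsClosedSeries b Om) {x : Fed R g n R}
    (hx : IsCandidate x) : IsForm 2 (fedosovRhs b r s nab Om x) :=
  (((isForm_curvEl _).add (hx.2.opCov b nab)).add (IsForm.circL _ hx.2 hx.2).divT).add
    (isForm_ofForms hOm)

theorem IsCandidate.fedosovRhs_filtration (hOm : IsClosedSeries b Om) {x : Fed R g n R}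
    (hx : IsCandidate x) : InFiltration 2 (fedosovRhs b r s nab Om x) :=
  (((inFiltration_curvEl _).add (hx.1.opCov b nab)).add
    (InFiltration.circL _ hx.1 hx.1).divT).add (inFiltration_ofForms hOm)

theorem IsCandidate.fedosovMap (hOm : IsClosedSeries b Om) {x : Fed R g n R}
    (hx : IsCandidate x) : IsCandidate (fedosovMap b r s nab Om x) :=
  ⟨((hx.fedosovRhs_filtration hOm).opInv b).mono (by omega), (hx.fedosovRhs_form hOm).opInv b⟩

/-- Division by `t` costs two degrees, but candidates have degree at least two, so `x ↦ (1/t) x ∘ x`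
keeps the degree of differences. The gain of one comes from `δ⁻¹`. -/
theorem fedosovMap_contracts (k : ℕ) (x x' : Fed R g n R) (hx : IsCandidate x)
    (hx' : IsCandidate x') (h : InFiltration k (x - x')) :
    InFiltration (k + 1) (fedosovMap b r s nab Om x - fedosovMap b r s nab Om x') := by
  -- The quadratic term is polarised as `x ∘ (x - x') + (x - x') ∘ x'`, which respects the
  -- noncommutative order.
  have e : fedosovRhs b r s nab Om x - fedosovRhs b r s nab Om x' = opCov b nab (x - x')
      + opDivT (circL (coords b (r + s)) x (x - x') + circL (coords b (r + s)) (x - x') x') := by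
    simp only [fedosovRhs, map_sub, map_add, LinearMap.sub_apply]; abel
  rw [fedosovMap, fedosovMap, ← map_sub, e]
  refine InFiltration.opInv b ((h.opCov b nab).add ?_)
  rw [← divT_eq]
  refine InFiltration.divT ?_
  exact ((InFiltration.circL _ hx.1 h).mono (by omega)).add (InFiltration.circL _ h hx'.1)

/-- A one-form squares to zero under the undeformed graded commutative product. So `x ∘ x` is
divisible by `t`, and `divT` is an honest division. -/
theorem coeff_zero_circ_self {p : Matrix (Fin n) (Fin n) R} {x : Fed R g n R} (hx : IsForm 1 x) :
    PowerSeries.coeff 0 (circL p x x) = 0 := by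
  have h := extL_mul_comm_one R hx x
  rw [extL_self, hx.opS_eq, pow_one, neg_smul, one_smul, neg_mul] at h
  rw [coeff_zero_circL, eq_zero_of_eq_neg R h, map_zero]

theorem X_mul_divT_circ_self {p : Matrix (Fin n) (Fin n) R} {x : Fed R g n R} (hx : IsForm 1 x) :
    PowerSeries.X * opDivT (circL p x x) = circL p x x := by
  rw [← divT_eq, X_mul_divT (coeff_zero_circ_self hx)]

theorem circ_ofForms_comm (p : Matrix (Fin n) (Fin n) R) (hOm : IsClosedSeries b Om)
    (a : Fed R g n A) : circL p (extL A (ofForms Om)) a = circL p a (extL A (ofForms Om)) := by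
  have h : ∀ i, opD i (extL A (ofForms Om : Fed R g n R)) = 0 := fun i => by
    rw [← extL_opD, opD_ofForms, map_zero]
  rw [circ_of_opD_left p h, circ_of_opD_right p h]
  exact extL_mul_comm_two A (isForm_ofForms hOm) a

theorem circ_divT_self_comm {p : Matrix (Fin n) (Fin n) R} {x : Fed R g n R} (hx : IsForm 1 x) :
    circL p (opDivT (circL p x x)) x = circL p x (opDivT (circL p x x)) :=
  X_mul_cancel (by rw [← circ_X_left, ← circ_X_right, X_mul_divT_circ_self hx, circ_assoc])

theorem isAntider_opCov_of (hr : IsNondegRMatrix b r)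
    (hnab : IsSymplecticTorsionFree b r nab) (hnabs : IsCovConst nab s) :
    IsAntider (coords b (r + s)) (opCov b nab : Module.End R (Fed R g n A)) :=
  isAntider_opCov b nab (coords_add_derivation hr hnab hnabs)

theorem IsForm.opS_eq_neg {x : Fed R g n A} (hx : IsForm 1 x) : opS x = -x := by
  rw [hx.opS_eq, pow_one, neg_smul, one_smul]

/-- Identities involving `1/t` are stated after multiplication by `t`, where they concern `∘` alone.
Comparison with `fedosovRhs_bracket` shows that `tD` and the bracket with `x` agree on the right
hand side of Fedosov's equation. -/
theorem X_mul_opCov_fedosovRhs (hr : IsNondegRMatrix b r) (hs : IsSymm s)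
    (hnab : IsSymplecticTorsionFree b r nab) (hnabs : IsCovConst nab s)
    (hOm : IsClosedSeries b Om) {x : Fed R g n R} (hx : IsForm 1 x) :
    PowerSeries.X * opCov b nab (fedosovRhs b r s nab Om x) =
      PowerSeries.X * opCov b nab (opCov b nab x)
      + (circL (coords b (r + s)) (opCov b nab x) x
        - circL (coords b (r + s)) x (opCov b nab x)) := by
  rw [fedosovRhs, map_add, map_add, map_add, opCov_curvEl hr hs hnab hnabs,
    opCov_ofForms hnab hOm, zero_add, add_zero, mul_add, ← tlinear_opCov b nab (opDivT _),
    X_mul_divT_circ_self hx, isAntider_opCov_of hr hnab hnabs, hx.opS_eq_neg, map_neg,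
    LinearMap.neg_apply, sub_eq_add_neg]

theorem fedosovRhs_bracket (hr : IsNondegRMatrix b r) (hs : IsSymm s)
    (hnab : IsSymplecticTorsionFree b r nab) (hnabs : IsCovConst nab s)
    (hOm : IsClosedSeries b Om) {x : Fed R g n R} (hx : IsForm 1 x) :
    circL (coords b (r + s)) (fedosovRhs b r s nab Om x) x
        - circL (coords b (r + s)) x (fedosovRhs b r s nab Om x) =
      PowerSeries.X * opCov b nab (opCov b nab x)
      + (circL (coords b (r + s)) (opCov b nab x) x
        - circL (coords b (r + s)) x (opCov b nab x)) := by
  have hW := circ_ofForms_comm (coords b (r + s)) hOm x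
  rw [extL_self] at hW
  rw [← curvEl_bracket hr hs hnab hnabs, fedosovRhs]
  simp only [map_add, LinearMap.add_apply]
  rw [hW, circ_divT_self_comm hx]
  abel

theorem X_mul_opDelta_fedosovRhs (hr : IsNondegRMatrix b r) (hs : IsSymm s)
    (hnab : IsSymplecticTorsionFree b r nab) (hnabs : IsCovConst nab s) {x : Fed R g n R}
    (hx : IsForm 1 x) : PowerSeries.X * opDelta b (fedosovRhs b r s nab Om x) =
      -(PowerSeries.X * opCov b nab (opDelta b x))
      + (circL (coords b (r + s)) (opDelta b x) x
        - circL (coords b (r + s)) x (opDelta b x)) := by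
  rw [fedosovRhs, map_add, map_add, map_add, opDelta_curvEl hr hs hnab hnabs, opDelta_ofForms,
    zero_add, add_zero, mul_add, ← tlinear_opDelta b (opDivT _), X_mul_divT_circ_self hx,
    isAntider_opDelta b, hx.opS_eq_neg, eq_neg_of_add_eq_zero_left (opDelta_opCov b nab x),
    map_neg, LinearMap.neg_apply, mul_neg, sub_eq_add_neg]

/-- The Bianchi identity for the defect of Fedosov's equation. -/
theorem X_mul_opDelta_defect (hr : IsNondegRMatrix b r) (hs : IsSymm s)
    (hnab : IsSymplecticTorsionFree b r nab) (hnabs : IsCovConst nab s)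
    (hOm : IsClosedSeries b Om) {x B : Fed R g n R} (hx : IsForm 1 x)
    (hB : B = fedosovRhs b r s nab Om x - opDelta b x) :
    PowerSeries.X * opDelta b B = PowerSeries.X * opCov b nab B
      - (circL (coords b (r + s)) B x - circL (coords b (r + s)) x B) := by
  have h1 := X_mul_opCov_fedosovRhs hr hs hnab hnabs hOm hx
  rw [← fedosovRhs_bracket hr hs hnab hnabs hOm hx] at h1
  have h2 := X_mul_opDelta_fedosovRhs (Om := Om) hr hs hnab hnabs hx
  have h3 : opDelta b (opDelta b x) = 0 := LinearMap.congr_fun (opDelta_opDelta b) x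
  rw [hB, map_sub, map_sub, map_sub, map_sub, LinearMap.sub_apply, h3, sub_zero, mul_sub, h1, h2]
  abel

theorem exists_fedosovElement (hr : IsNondegRMatrix b r) (hs : IsSymm s)
    (hnab : IsSymplecticTorsionFree b r nab) (hnabs : IsCovConst nab s)
    (hOm : IsClosedSeries b Om) : ∃ x, IsFedosovElement b r s nab Om x := by
  obtain ⟨x, hx, hfix⟩ := exists_fixedPoint (S := IsCandidate) (Φ := fedosovMap b r s nab Om)
    ⟨InFiltration.zero _, IsForm.zero _⟩
    (fun a h => ⟨inFiltration_of_approx fun k => (h k).imp fun _ h => ⟨h.1.1, h.2⟩,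
      isForm_of_approx fun k => (h k).imp fun _ h => ⟨h.1.2, h.2⟩⟩)
    (fun _ h => h.fedosovMap hOm) fedosovMap_contracts
  -- The fixed point is in the image of `δ⁻¹`, whose square is zero.
  have hnorm : opInv b x = 0 := by
    rw [← hfix]; exact LinearMap.congr_fun (opInv_opInv b) _
  have hinv : opInv b (opDelta b x) = x := by
    have h := hodge_apply b x
    rwa [hnorm, map_zero, zero_add, hx.2.opP_eq_zero one_ne_zero, sub_zero] at h
  obtain ⟨B, hB⟩ : ∃ B, B = fedosovRhs b r s nab Om x - opDelta b x := ⟨_, rfl⟩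
  have hB2 : IsForm 2 B := by
    rw [hB]; exact (hx.fedosovRhs_form hOm).sub (hx.2.opDelta b)
  have hBinv : opInv b B = 0 := by
    rw [hB, map_sub, hinv, sub_eq_zero]; exact hfix
  have hBB : opInv b (opDelta b B) = B := by
    have h := hodge_apply b B
    rwa [hBinv, map_zero, zero_add, hB2.opP_eq_zero two_ne_zero, sub_zero] at h
  -- The defect satisfies `B = δ⁻¹δB`, and the Bianchi identity expresses `δB` through terms of no
  -- lower degree than `B`.
  have hB0 : B = 0 := eq_zero_of_raise fun k hk => by
    rw [← hBB]
    refine InFiltration.opInv b (InFiltration.of_X_mul ?_)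
    rw [X_mul_opDelta_defect hr hs hnab hnabs hOm hx.2 hB]
    exact (hk.opCov b nab).X_mul.sub
      ((InFiltration.circL _ hk hx.1).sub ((InFiltration.circL _ hx.1 hk).mono (by omega)))
  refine ⟨x, hx.1, projA_eq_iff.2 hx.2, ?_, by rw [deltaInv_eq, hnorm]⟩
  rw [delta_eq, eq_comm, ← sub_eq_zero, ← hB0, hB, fedosovRhs, curvature_eq, covD_eq, circ_eq]
  rfl

theorem IsFedosovElement.opDelta_eq {x : Fed R g n R} (h : IsFedosovElement b r s nab Om x) :
    opDelta b x = fedosovRhs b r s nab Om x := by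
  rw [← delta_eq, h.equation, fedosovRhs, curvature_eq, covD_eq, circ_eq]; rfl

theorem IsFedosovElement.isForm {x : Fed R g n R} (h : IsFedosovElement b r s nab Om x) :
    IsForm 1 x := projA_eq_iff.1 h.one_form

/-- Because `δ⁻¹ϱ = 0` and one-forms have no part in degree zero, the Hodge decomposition turns
Fedosov's equation into the fixed point equation. Uniqueness then comes from contraction. -/
theorem IsFedosovElement.fedosovMap_eq {x : Fed R g n R}
    (h : IsFedosovElement b r s nab Om x) : fedosovMap b r s nab Om x = x := by
  have h1 := hodge_apply b x
  rwa [← deltaInv_eq, h.normalization, map_zero, zero_add, h.isForm.opP_eq_zero one_ne_zero,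
    sub_zero, h.opDelta_eq] at h1

theorem IsFedosovElement.unique {x x' : Fed R g n R} (h : IsFedosovElement b r s nab Om x)
    (h' : IsFedosovElement b r s nab Om x') : x' = x :=
  fixedPoint_unique (S := IsCandidate) fedosovMap_contracts ⟨h'.filtration, h'.isForm⟩
    ⟨h.filtration, h.isForm⟩ h'.fedosovMap_eq h.fedosovMap_eq

end FedosovElement

/-! ### Fedosov's derivation and its flatness. -/

section Flat

variable {R g : Type*} [CommRing R] [Algebra ℚ R] [LieRing g] [LieAlgebra R g] {n : ℕ}
  {A : Type*} [Ring A] [Algebra R A]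

/-- The graded commutator `a ↦ x ∘ a - (-1)^ℓ a ∘ x` with `x` of antisymmetric degree one. -/
def opBr (p : Matrix (Fin n) (Fin n) R) (x : Fed R g n A) : Module.End R (Fed R g n A) :=
  circL p x - (circL p).flip x ∘ₗ opS

theorem opBr_apply (p : Matrix (Fin n) (Fin n) R) (x a : Fed R g n A) :
    opBr p x a = circL p x a - circL p (opS a) x := rfl

/-- `(1/t) ad(x)` as a linear map. -/
def opAd (p : Matrix (Fin n) (Fin n) R) (x : Fed R g n A) : Module.End R (Fed R g n A) :=
  opDivT * opBr p x

theorem opAd_apply (p : Matrix (Fin n) (Fin n) R) (x a : Fed R g n A) :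
    opAd p x a = opDivT (opBr p x a) := rfl

theorem adOverT_eq (p : Matrix (Fin n) (Fin n) R) (x a : Fed R g n A) :
    adOverT p x a = opAd p x a := rfl

/-- In order zero in `t` the product is undeformed, and a scalar-valued one-form graded commutes
with everything. The graded commutator is therefore divisible by `t`. -/
theorem X_mul_opAd {p : Matrix (Fin n) (Fin n) R} {x : Fed R g n R} (hx : IsForm 1 x)
    (a : Fed R g n A) : PowerSeries.X * opAd p (extL A x) a = opBr p (extL A x) a := by
  rw [opAd_apply, ← divT_eq, X_mul_divT]
  rw [opBr_apply, map_sub, coeff_zero_circL, coeff_zero_circL, extL_mul_comm_one A hx, sub_self]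

variable {p : Matrix (Fin n) (Fin n) R} {x : Fed R g n A}

theorem tlinear_opBr : TLinear (opBr p x) := fun a => by
  rw [opBr_apply, opBr_apply, circ_X_right, tlinear_opS, circ_X_left, mul_sub]

theorem tlinear_opAd {x : Fed R g n R} (hx : IsForm 1 x) : TLinear (opAd p (extL A x)) :=
  fun a => X_mul_cancel (by
    rw [X_mul_opAd hx, tlinear_opBr, X_mul_opAd hx])

theorem isAntider_opBr : IsAntider p (opBr p x) := fun a a' => by
  simp only [opBr_apply, map_sub, LinearMap.sub_apply, opS_circ, ← circ_assoc]
  abel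

theorem isAntider_opAd {x : Fed R g n R} (hx : IsForm 1 x) :
    IsAntider p (opAd p (extL A x)) := fun a a' => X_mul_cancel (by
  rw [X_mul_opAd hx, isAntider_opBr, mul_add, ← circ_X_left, ← circ_X_right,
    X_mul_opAd hx, X_mul_opAd hx])

theorem InFiltration.opBr {k : ℕ} {a : Fed R g n A} (hx : InFiltration 2 x)
    (h : InFiltration k a) : InFiltration (k + 2) (opBr p x a) := by
  rw [opBr_apply]
  exact ((InFiltration.circL p hx h).mono (by omega)).sub (InFiltration.circL p h.opS hx)

theorem InFiltration.opAd {k : ℕ} {a : Fed R g n A} (hx : InFiltration 2 x)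
    (h : InFiltration k a) : InFiltration k (opAd p x a) := by
  rw [opAd_apply, ← divT_eq]
  exact (InFiltration.opBr hx h).divT

theorem IsForm.opAd {l : ℕ} {a : Fed R g n A} (hx : IsForm 1 x) (h : IsForm l a) :
    IsForm (l + 1) (opAd p x a) := by
  rw [opAd_apply, ← divT_eq, opBr_apply]
  have h1 := IsForm.circL p hx h
  rw [add_comm] at h1
  have h2 : IsForm l (Fedosov.opS a) := by rw [h.opS_eq]; exact h.smul _
  exact (h1.sub (IsForm.circL p h2 hx)).divT

/-- Graded commutation of an odd antiderivation with an inner one yields the inner derivation of `T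
x`, which is even; hence the plain commutator. -/
theorem opBr_anticomm (hx : IsForm 1 x) {T : Module.End R (Fed R g n A)} (hT : IsAntider p T)
    (hS : ∀ a, opS (T a) = -T (opS a)) (a : Fed R g n A) :
    T (opBr p x a) + opBr p x (T a) = circL p (T x) a - circL p a (T x) := by
  simp only [opBr_apply, map_sub, hT x, hT (opS a), hS, hx.opS_eq_neg, opS_opS', map_neg,
    LinearMap.neg_apply]
  abel

/-- For odd `x`, associativity gives `ad(x)² = ad(x ∘ x)`: the mixed terms `x ∘ a ∘ x` cancel. -/
theorem opBr_opBr (hx : IsForm 1 x) (a : Fed R g n A) : opBr p x (opBr p x a)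
    = circL p (circL p x x) a - circL p a (circL p x x) := by
  simp only [opBr_apply, map_sub, opS_circ, hx.opS_eq_neg, opS_opS', map_neg,
    LinearMap.neg_apply, circ_assoc]
  abel

variable {b : Module.Basis (Fin n) R g} {r s : g ⊗[R] g} {nab : g →ₗ[R] g →ₗ[R] g}
  {Om : PowerSeries (Forms R g)} (T : DerivationAction R g A)

theorem opS_opDelta (a : Fed R g n A) : opS (opDelta b a) = -opDelta b (opS a) := by
  simp only [opDelta_apply, map_sum, opS_opE', opD_opS', Finset.sum_neg_distrib]

theorem opS_opCov (a : Fed R g n A) : opS (opCov b nab a) = -opCov b nab (opS a) := by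
  simp only [opCov_apply, map_sum, opS_opE', opNab_apply, map_neg, opS_opHat,
    Finset.sum_neg_distrib]

theorem opS_opLeft (a : Fed R g n A) : opS (opLeft b T a) = -opLeft b T (opS a) := by
  simp only [opLeft_apply, map_sum, opS_opE', opAct_opS, Finset.sum_neg_distrib]

/-- `D + L_A + (1/t) ad(x)` as a linear map. -/
def opPert (b : Module.Basis (Fin n) R g) (r s : g ⊗[R] g) (nab : g →ₗ[R] g →ₗ[R] g)
    (x : Fed R g n R) : Module.End R (Fed R g n A) :=
  opCov b nab + opLeft b T + opAd (coords b (r + s)) (extL A x)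

theorem opPert_apply (x : Fed R g n R) (a : Fed R g n A) : opPert T b r s nab x a =
    opCov b nab a + opLeft b T a + opAd (coords b (r + s)) (extL A x) a := rfl

theorem perturbation_eq (x : Fed R g n R) (a : Fed R g n A) :
    perturbation b T r s nab x a = opPert T b r s nab x a := by
  rw [perturbation, covD_eq, leftOp_eq, adOverT_eq]; rfl

theorem InFiltration.opPert {k : ℕ} {x : Fed R g n R} (hx : InFiltration 2 x) {a : Fed R g n A}
    (h : InFiltration k a) : InFiltration k (opPert T b r s nab x a) :=
  ((h.opCov b nab).add (h.opLeft b T)).add (InFiltration.opAd hx.extL h)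

theorem IsForm.opPert {l : ℕ} {x : Fed R g n R} (hx : IsForm 1 x) {a : Fed R g n A}
    (h : IsForm l a) : IsForm (l + 1) (opPert T b r s nab x a) :=
  ((h.opCov b nab).add (h.opLeft b T)).add (IsForm.opAd hx.extL h)

/-- Fedosov's derivation `-δ + D + L_A + (1/t) ad(x)`. -/
def opFed (b : Module.Basis (Fin n) R g) (r s : g ⊗[R] g) (nab : g →ₗ[R] g →ₗ[R] g)
    (x : Fed R g n R) : Module.End R (Fed R g n A) :=
  -opDelta b + opPert T b r s nab x

theorem opFed_apply (x : Fed R g n R) (a : Fed R g n A) : opFed T b r s nab x a =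
    -opDelta b a + opPert T b r s nab x a := rfl

theorem isAntider_opFed (hr : IsNondegRMatrix b r) (hnab : IsSymplecticTorsionFree b r nab)
    (hnabs : IsCovConst nab s) {x : Fed R g n R} (hx : IsForm 1 x) :
    IsAntider (coords b (r + s)) (opFed T b r s nab x) :=
  (isAntider_opDelta b).neg.add (((isAntider_opCov_of hr hnab hnabs).add
    (isAntider_opLeft b T)).add (isAntider_opAd hx))

theorem X_mul_extL_divT {x : Fed R g n R} (hx : IsForm 1 x) :
    PowerSeries.X * extL A (opDivT (circL p x x)) = circL p (extL A x) (extL A x) := by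
  rw [← extL_circL]
  conv_rhs => rw [← X_mul_divT_circ_self hx]
  refine fed_ext fun m κ => ?_
  rw [cf_extL]
  cases m with
  | zero => rw [cf_X_mul_zero, cf_X_mul_zero, map_zero]
  | succ m => rw [cf_X_mul_succ, cf_X_mul_succ, cf_extL]

theorem X_mul_opDelta_extL {x : Fed R g n R} (h : IsFedosovElement b r s nab Om x) :
    PowerSeries.X * opDelta b (extL A x) = PowerSeries.X * curvEl b (curvCoeff b r nab)
      + PowerSeries.X * opCov b nab (extL A x) + circL (coords b (r + s)) (extL A x) (extL A x)
      + PowerSeries.X * extL A (ofForms Om) := by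
  rw [← extL_opDelta, h.opDelta_eq, fedosovRhs, map_add, map_add, map_add, extL_curvEl,
    extL_opCov, mul_add, mul_add, mul_add, X_mul_extL_divT h.isForm]

theorem X_mul_opFed {x : Fed R g n R} (hx : IsForm 1 x) (a : Fed R g n A) :
    PowerSeries.X * opFed T b r s nab x a =
      -(PowerSeries.X * opDelta b a) + PowerSeries.X * opCov b nab a
        + PowerSeries.X * opLeft b T a + opBr (coords b (r + s)) (extL A x) a := by
  rw [opFed_apply, opPert_apply, mul_add, mul_add, mul_add, X_mul_opAd hx, mul_neg]
  abel

theorem tlinear_opFed {x : Fed R g n R} (hx : IsForm 1 x) :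
    TLinear (opFed T b r s nab x) :=
  (tlinear_opDelta b).neg.add (((tlinear_opCov b nab).add (tlinear_opLeft b T)).add
    (tlinear_opAd hx))

/-- The square is multiplied by `t²`, one `t` for each `ad(x)/t`. The terms `δ²`, `{δ, D}`, `{δ,
L_A}` and `{D, L_A} + L_A²` have dropped out. -/
theorem X_mul_X_mul_opFed (hnab : IsSymplecticTorsionFree b r nab) {x : Fed R g n R}
    (hx : IsForm 1 x) (a : Fed R g n A) :
    PowerSeries.X * (PowerSeries.X * opFed T b r s nab x (opFed T b r s nab x a)) =
      PowerSeries.X * (PowerSeries.X * opCov b nab (opCov b nab a))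
      - PowerSeries.X * (opDelta b (opBr (coords b (r + s)) (extL A x) a)
        + opBr (coords b (r + s)) (extL A x) (opDelta b a))
      + PowerSeries.X * (opCov b nab (opBr (coords b (r + s)) (extL A x) a)
        + opBr (coords b (r + s)) (extL A x) (opCov b nab a))
      + PowerSeries.X * (opLeft b T (opBr (coords b (r + s)) (extL A x) a)
        + opBr (coords b (r + s)) (extL A x) (opLeft b T a))
      + opBr (coords b (r + s)) (extL A x) (opBr (coords b (r + s)) (extL A x) a) := by
  obtain ⟨N, hN⟩ : ∃ N, N = opBr (coords b (r + s)) (extL A x) := ⟨_, rfl⟩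
  have hNX : TLinear N := hN ▸ tlinear_opBr
  have h1 : ∀ a, PowerSeries.X * opFed T b r s nab x a =
      -(PowerSeries.X * opDelta b a) + PowerSeries.X * opCov b nab a
        + PowerSeries.X * opLeft b T a + N a := fun a => by rw [hN]; exact X_mul_opFed T hx a
  have hδδ : opDelta b (opDelta b a) = 0 := LinearMap.congr_fun (opDelta_opDelta b) a
  have h2 := opDelta_opCov b nab a
  have h3 := opDelta_opLeft b T a
  have h4 := congrArg (fun u => PowerSeries.X * (PowerSeries.X * u)) (opCov_opLeft b T hnab a)
  simp only [mul_add, mul_zero] at h4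
  rw [← hN, ← tlinear_opFed T hx, h1, h1]
  simp only [map_add, map_neg, tlinear_opDelta b _, tlinear_opCov b nab _, tlinear_opLeft b T _,
    hNX _, hδδ, mul_add, mul_neg, mul_zero, neg_zero, zero_add,
    eq_neg_of_add_eq_zero_left h2, eq_neg_of_add_eq_zero_left h3]
  rw [← sub_eq_zero, ← h4]
  abel

/-- What is left of the square is inner, generated by `R - δϱ + Dϱ + (1/t) ϱ ∘ ϱ` up to powers of
`t`. Fedosov's equation makes this `-Ω`, which is central. -/
theorem curvature_cancel (p : Matrix (Fin n) (Fin n) R) {a Z W y₁ y₂ y₃ u : Fed R g n A}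
    (hδ : PowerSeries.X * y₁ = PowerSeries.X * Z + PowerSeries.X * y₂ + y₃ + PowerSeries.X * W)
    (hW : circL p W a = circL p a W)
    (hZ : circL p Z a - circL p a Z = PowerSeries.X * u) :
    PowerSeries.X * (PowerSeries.X * u) - PowerSeries.X * (circL p y₁ a - circL p a y₁)
      + PowerSeries.X * (circL p y₂ a - circL p a y₂) + (circL p y₃ a - circL p a y₃) = 0 := by
  have h1 : PowerSeries.X * circL p y₁ a = PowerSeries.X * circL p Z a
      + PowerSeries.X * circL p y₂ a + circL p y₃ a + PowerSeries.X * circL p W a := by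
    rw [← circ_X_left p y₁, hδ]
    simp only [map_add, LinearMap.add_apply, circ_X_left]
  have h2 : PowerSeries.X * circL p a y₁ = PowerSeries.X * circL p a Z
      + PowerSeries.X * circL p a y₂ + circL p a y₃ + PowerSeries.X * circL p a W := by
    rw [← circ_X_right p a y₁, hδ]
    simp only [map_add, circ_X_right]
  rw [← hZ, mul_sub, mul_sub, mul_sub, h1, h2, hW]
  abel

theorem opFed_opFed (hr : IsNondegRMatrix b r) (hs : IsSymm s)
    (hnab : IsSymplecticTorsionFree b r nab) (hnabs : IsCovConst nab s)
    (hOm : IsClosedSeries b Om) {x : Fed R g n R} (h : IsFedosovElement b r s nab Om x)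
    (a : Fed R g n A) : opFed T b r s nab x (opFed T b r s nab x a) = 0 := by
  have hxA : IsForm 1 (extL A x) := h.isForm.extL
  refine X_mul_cancel (X_mul_cancel ?_)
  rw [X_mul_X_mul_opFed T hnab h.isForm a, opBr_anticomm hxA (isAntider_opDelta b) opS_opDelta a,
    opBr_anticomm hxA (isAntider_opCov_of hr hnab hnabs) opS_opCov a,
    opBr_anticomm hxA (isAntider_opLeft b T) (opS_opLeft T) a, opBr_opBr hxA, opLeft_extL,
    map_zero, map_zero, LinearMap.zero_apply, sub_zero, mul_zero, mul_zero, add_zero]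
  exact curvature_cancel (coords b (r + s)) (X_mul_opDelta_extL h)
    (circ_ofForms_comm (coords b (r + s)) hOm a) (curvEl_bracket hr hs hnab hnabs a)

end Flat

/-! ### The Fedosov-Taylor series and associativity of `⋆`. -/

section Tau

variable {R g : Type*} [CommRing R] [Algebra ℚ R] [LieRing g] [LieAlgebra R g] {n : ℕ}
  {A : Type*} [Ring A] [Algebra R A]
  {b : Module.Basis (Fin n) R g} {r s : g ⊗[R] g} {nab : g →ₗ[R] g →ₗ[R] g}
  {Om : PowerSeries (Forms R g)} (T : DerivationAction R g A) {x : Fed R g n R}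

theorem tauStep_eq (a : Fed R g n A) : tauStep b T r s nab x a =
    opInv b (opPert T b r s nab x a) + opPert T b r s nab x (opInv b a) := by
  rw [tauStep, deltaInv_eq, deltaInv_eq, perturbation_eq, perturbation_eq]

/-- `δ⁻¹` kills form degree zero, so half of the graded commutator disappears and the series for `τ`
becomes a geometric series in `opTau`. -/
theorem tauStep_of_isForm {a : Fed R g n A} (h : IsForm 0 a) : tauStep b T r s nab x a =
    opInv b (opPert T b r s nab x a) := by
  rw [tauStep_eq, h.opInv_eq_zero, map_zero, add_zero]

/-- The operator `δ⁻¹ (D + L_A + (1/t) ad(x))`. -/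
def opTau (b : Module.Basis (Fin n) R g) (r s : g ⊗[R] g) (nab : g →ₗ[R] g →ₗ[R] g)
    (x : Fed R g n R) : Module.End R (Fed R g n A) :=
  opInv b * opPert T b r s nab x

theorem opTau_apply (a : Fed R g n A) :
    opTau T b r s nab x a = opInv b (opPert T b r s nab x a) := rfl

theorem InFiltration.opTau {k : ℕ} (hx : InFiltration 2 x) {a : Fed R g n A}
    (h : InFiltration k a) : InFiltration (k + 1) (opTau T b r s nab x a) :=
  (InFiltration.opPert T hx h).opInv b

theorem IsForm.opTau (hx : IsForm 1 x) {a : Fed R g n A} (h : IsForm 0 a) :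
    IsForm 0 (opTau T b r s nab x a) := (IsForm.opPert T hx h).opInv b

theorem isForm_opTau_iterate (hx : IsForm 1 x) (ξ : PowerSeries A) (k : ℕ) :
    IsForm 0 ((opTau T b r s nab x)^[k] (incl ξ)) := by
  induction k with
  | zero => exact isForm_incl ξ
  | succ k ih => rw [Function.iterate_succ_apply']; exact IsForm.opTau T hx ih

theorem inFiltration_opTau_iterate (hx : InFiltration 2 x) (ξ : PowerSeries A) (k : ℕ) :
    InFiltration k ((opTau T b r s nab x)^[k] (incl ξ)) := by
  induction k with
  | zero => exact InFiltration.zero_left _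
  | succ k ih => rw [Function.iterate_succ_apply']; exact InFiltration.opTau T hx ih

theorem tauStep_iterate (hx : IsForm 1 x) (ξ : PowerSeries A) (k : ℕ) :
    (tauStep b T r s nab x)^[k] (incl ξ) = (opTau T b r s nab x)^[k] (incl ξ) := by
  induction k with
  | zero => rfl
  | succ k ih =>
    rw [Function.iterate_succ_apply', Function.iterate_succ_apply', ih,
      tauStep_of_isForm T (isForm_opTau_iterate T hx ξ k), opTau_apply]

/-- The `j`-th summand starts in total degree `j`, so in each coefficient the formal sum has finite
support and agrees with a partial sum. -/
theorem tau_approx (hx : InFiltration 2 x) (hx1 : IsForm 1 x) (ξ : PowerSeries A) (k : ℕ) :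
    InFiltration k (tau b T r s nab x ξ
      - ∑ j ∈ Finset.range k, (opTau T b r s nab x)^[j] (incl ξ)) := fun m κ hm => by
  rw [cf_sub, tau, cf_mkFed, cf_sum, sub_eq_zero]
  simp only [tauStep_iterate T hx1]
  refine finsum_eq_sum_of_support_subset _ fun j hj => ?_
  rw [Finset.coe_range, Set.mem_Iio]
  by_contra hjk
  exact hj (inFiltration_opTau_iterate T hx ξ j m κ (by omega))

theorem isForm_tau (hx : IsFedosovElement b r s nab Om x) (ξ : PowerSeries A) :
    IsForm 0 (tau b T r s nab x ξ) := isForm_of_approx fun k =>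
  ⟨_, IsForm.sum fun j _ => isForm_opTau_iterate T hx.isForm ξ j,
    tau_approx T hx.filtration hx.isForm ξ k⟩

theorem tau_eq (hx : IsFedosovElement b r s nab Om x) (ξ : PowerSeries A) :
    tau b T r s nab x ξ = incl ξ + opTau T b r s nab x (tau b T r s nab x ξ) := by
  refine sub_eq_zero.1 (eq_zero_of_inFiltration fun k => ?_)
  have htau := tau_approx (b := b) (r := r) (s := s) (nab := nab) T hx.filtration hx.isForm ξ
  have e := ((htau (k + 1)).mono (Nat.le_succ k)).sub
    ((InFiltration.opTau T hx.filtration (htau k) (b := b) (r := r) (s := s)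
      (nab := nab)).mono (Nat.le_succ k))
  rw [map_sub, map_sum, Finset.sum_range_succ'] at e
  simp only [Function.iterate_succ_apply', Function.iterate_zero_apply] at e
  convert e using 1
  abel

/-- `tau` is determined by its fixed point equation. -/
theorem eq_tau (hx : IsFedosovElement b r s nab Om x) {ξ : PowerSeries A} {a : Fed R g n A}
    (ha : a = incl ξ + opTau T b r s nab x a) : a = tau b T r s nab x ξ := by
  refine sub_eq_zero.1 (eq_zero_of_raise fun k hk => ?_)
  have e : a - tau b T r s nab x ξ = opTau T b r s nab x (a - tau b T r s nab x ξ) := by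
    rw [map_sub]
    nth_rewrite 1 [ha, tau_eq T hx]
    rw [add_sub_add_left_eq_sub]
  rw [e]
  exact InFiltration.opTau T hx.filtration hk

theorem opP_tau (hx : IsFedosovElement b r s nab Om x) (ξ : PowerSeries A) :
    opP (tau b T r s nab x ξ) = incl ξ := by
  rw [tau_eq T hx, map_add, opP_incl, opTau_apply, ← Module.End.mul_apply, opP_opInv, LinearMap.zero_apply,
    add_zero]

theorem sigma_tau (hx : IsFedosovElement b r s nab Om x) (ξ : PowerSeries A) :
    sigma (tau b T r s nab x ξ) = ξ := by
  rw [← sigma_incl (sigma _) (R := R) (g := g) (n := n), incl_sigma, opP_tau T hx, sigma_incl]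

/-- Again a defect argument: `B` is a one-form with `δ⁻¹B = 0`, and flatness gives `δB = (D + L_A +
(1/t) ad(ϱ)) B`. Thus `B` is reproduced by a degree-raising operator. -/
theorem opFed_tau (hr : IsNondegRMatrix b r) (hs : IsSymm s)
    (hnab : IsSymplecticTorsionFree b r nab) (hnabs : IsCovConst nab s)
    (hOm : IsClosedSeries b Om) (hx : IsFedosovElement b r s nab Om x) (ξ : PowerSeries A) :
    opFed T b r s nab x (tau b T r s nab x ξ) = 0 := by
  obtain ⟨B, hB⟩ : ∃ B, B = opFed T b r s nab x (tau b T r s nab x ξ) := ⟨_, rfl⟩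
  have h0 := isForm_tau T hx ξ
  have hB1 : IsForm 1 B := by
    rw [hB, opFed_apply]
    exact (h0.opDelta b).neg.add (IsForm.opPert T hx.isForm h0)
  have hinv : opInv b B = 0 := by
    have h1 := hodge_apply b (tau b T r s nab x ξ)
    rw [h0.opInv_eq_zero, map_zero, zero_add, opP_tau T hx] at h1
    rw [hB, opFed_apply, map_add, map_neg, h1]
    nth_rewrite 1 [tau_eq T hx]
    rw [opTau_apply]; abel
  have hBB : opInv b (opDelta b B) = B := by
    have h := hodge_apply b B
    rwa [hinv, map_zero, zero_add, hB1.opP_eq_zero one_ne_zero, sub_zero] at h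
  have hFB : opDelta b B = opPert T b r s nab x B := by
    have := opFed_opFed T hr hs hnab hnabs hOm hx (tau b T r s nab x ξ)
    rw [← hB, opFed_apply, neg_add_eq_zero] at this
    exact this
  rw [← hB]
  exact eq_zero_of_raise fun k hk => by
    rw [← hBB, hFB]
    exact (InFiltration.opPert T hx.filtration hk).opInv b

/-- For a flat element of form degree zero, the Hodge decomposition is precisely the fixed point
equation of `τ` with initial value `σ(a)`. -/
theorem tau_sigma_of_flat (hx : IsFedosovElement b r s nab Om x) {a : Fed R g n A}
    (h0 : IsForm 0 a) (ha : opFed T b r s nab x a = 0) : tau b T r s nab x (sigma a) = a := by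
  refine (eq_tau T hx ?_).symm
  have h1 := hodge_apply b a
  rw [opFed_apply, neg_add_eq_zero] at ha
  rw [h0.opInv_eq_zero, map_zero, zero_add, ha] at h1
  rw [opTau_apply, h1, incl_sigma]; abel

theorem star_eq (ξ η : PowerSeries A) : star b T r s nab x ξ η =
    sigma (circL (coords b (r + s)) (tau b T r s nab x ξ) (tau b T r s nab x η)) := rfl

/-- Flat elements are closed under `∘`, being the kernel of an antiderivation. So `τ(ξ) ∘ τ(η)` is
recovered from its projection, and `⋆` inherits associativity. -/
theorem tau_star (hr : IsNondegRMatrix b r) (hs : IsSymm s)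
    (hnab : IsSymplecticTorsionFree b r nab) (hnabs : IsCovConst nab s)
    (hOm : IsClosedSeries b Om) (hx : IsFedosovElement b r s nab Om x) (ξ η : PowerSeries A) :
    tau b T r s nab x (star b T r s nab x ξ η) =
      circL (coords b (r + s)) (tau b T r s nab x ξ) (tau b T r s nab x η) := by
  have h := isAntider_opFed (s := s) T hr hnab hnabs hx.isForm (tau b T r s nab x ξ)
    (tau b T r s nab x η)
  rw [opFed_tau T hr hs hnab hnabs hOm hx, opFed_tau T hr hs hnab hnabs hOm hx, map_zero, map_zero,
    LinearMap.zero_apply, add_zero] at h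
  rw [star_eq]
  have h0 := IsForm.circL (coords b (r + s)) (isForm_tau T hx ξ) (isForm_tau T hx η)
  rw [add_zero] at h0
  exact tau_sigma_of_flat T hx h0 h

theorem star_assoc (hr : IsNondegRMatrix b r) (hs : IsSymm s)
    (hnab : IsSymplecticTorsionFree b r nab) (hnabs : IsCovConst nab s)
    (hOm : IsClosedSeries b Om) (hx : IsFedosovElement b r s nab Om x) (ξ η ζ : PowerSeries A) :
    star b T r s nab x (star b T r s nab x ξ η) ζ =
      star b T r s nab x ξ (star b T r s nab x η ζ) := by
  rw [star_eq T (star b T r s nab x ξ η) ζ, star_eq T ξ (star b T r s nab x η ζ),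
    tau_star T hr hs hnab hnabs hOm hx, tau_star T hr hs hnab hnabs hOm hx, circ_assoc]

end Tau

/-! ### Linearity in `t`, the unit, and the first order term. -/

section Linearity

variable {R g : Type*} [CommRing R] [Algebra ℚ R] [LieRing g] [LieAlgebra R g] {n : ℕ}
  {A : Type*} [Ring A] [Algebra R A]
  {b : Module.Basis (Fin n) R g} {r s : g ⊗[R] g} {nab : g →ₗ[R] g →ₗ[R] g}
  {Om : PowerSeries (Forms R g)} (T : DerivationAction R g A) {x : Fed R g n R}

theorem tlinear_opW : TLinear (opW : Module.End R (Fed R g n A)) := fun a =>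
  fed_ext fun m κ => by
    cases m with
    | zero => rw [cf_X_mul_zero, cf_opW, cf_X_mul_zero]; simp
    | succ m => rw [cf_X_mul_succ, cf_opW, cf_X_mul_succ, cf_opW]

theorem tlinear_opInv : TLinear (opInv b : Module.End R (Fed R g n A)) :=
  TLinear.mul (TLinear.sum fun i _ => (tlinear_opY i).mul (tlinear_opI b i)) tlinear_opW

theorem tlinear_opTau (hx : IsForm 1 x) : TLinear (opTau T b r s nab x) :=
  tlinear_opInv.mul (((tlinear_opCov b nab).add (tlinear_opLeft b T)).add (tlinear_opAd hx))

theorem incl_add (ξ η : PowerSeries A) :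
    (incl (ξ + η) : Fed R g n A) = incl ξ + incl η := map_add _ _ _

theorem incl_X_mul (ξ : PowerSeries A) :
    (incl (PowerSeries.X * ξ) : Fed R g n A) = PowerSeries.X * incl ξ := by
  rw [incl, map_mul, PowerSeries.map_X]; rfl

theorem tau_add (hx : IsFedosovElement b r s nab Om x) (ξ η : PowerSeries A) :
    tau b T r s nab x (ξ + η) = tau b T r s nab x ξ + tau b T r s nab x η := by
  refine (eq_tau T hx ?_).symm
  rw [map_add, incl_add]
  nth_rewrite 1 [tau_eq T hx ξ, tau_eq T hx η]
  abel

theorem tau_X_mul (hx : IsFedosovElement b r s nab Om x) (ξ : PowerSeries A) :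
    tau b T r s nab x (PowerSeries.X * ξ) = PowerSeries.X * tau b T r s nab x ξ := by
  refine (eq_tau T hx ?_).symm
  rw [tlinear_opTau T hx.isForm, incl_X_mul, ← mul_add, ← tau_eq T hx]

theorem coeff_sigma (m : ℕ) (a : Fed R g n A) : PowerSeries.coeff m (sigma a) =
    TensorProduct.rid R A (LinearMap.lTensor A ExteriorAlgebra.algebraMapInv.toLinearMap
      (cf m 0 a)) := PowerSeries.coeff_mk _ _

theorem sigma_add (a a' : Fed R g n A) : sigma (a + a') = sigma a + sigma a' :=
  PowerSeries.ext fun m => by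
    rw [map_add, coeff_sigma, coeff_sigma, coeff_sigma, cf_add, map_add, map_add]

theorem coeff_sigma_smul (m : ℕ) (c : R) (a : Fed R g n A) :
    PowerSeries.coeff m (sigma (c • a)) = c • PowerSeries.coeff m (sigma a) := by
  rw [coeff_sigma, coeff_sigma, cf_smul, map_smul, map_smul]

theorem sigma_X_mul (a : Fed R g n A) :
    sigma (PowerSeries.X * a) = PowerSeries.X * sigma a := PowerSeries.ext fun m => by
  cases m with
  | zero => rw [coeff_sigma, cf_X_mul_zero, PowerSeries.coeff_zero_X_mul, map_zero, map_zero]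
  | succ m => rw [coeff_sigma, cf_X_mul_succ, PowerSeries.coeff_succ_X_mul, coeff_sigma]

theorem star_add_left (hx : IsFedosovElement b r s nab Om x) (ξ ξ' η : PowerSeries A) :
    star b T r s nab x (ξ + ξ') η = star b T r s nab x ξ η + star b T r s nab x ξ' η := by
  rw [star_eq, star_eq, star_eq, tau_add T hx, map_add, LinearMap.add_apply, sigma_add]

theorem star_add_right (hx : IsFedosovElement b r s nab Om x) (ξ η η' : PowerSeries A) :
    star b T r s nab x ξ (η + η') = star b T r s nab x ξ η + star b T r s nab x ξ η' := by
  rw [star_eq, star_eq, star_eq, tau_add T hx, map_add, sigma_add]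

theorem star_X_left (hx : IsFedosovElement b r s nab Om x) (ξ η : PowerSeries A) :
    star b T r s nab x (PowerSeries.X * ξ) η = PowerSeries.X * star b T r s nab x ξ η := by
  rw [star_eq, star_eq, tau_X_mul T hx, circ_X_left, sigma_X_mul]

theorem star_X_right (hx : IsFedosovElement b r s nab Om x) (ξ η : PowerSeries A) :
    star b T r s nab x ξ (PowerSeries.X * η) = PowerSeries.X * star b T r s nab x ξ η := by
  rw [star_eq, star_eq, tau_X_mul T hx, circ_X_right, sigma_X_mul]

/-- No continuity is needed: splitting off the constant term, `ξ = ξ₀ + t ξ'`, reaches the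
coefficient of `t^m` after finitely many steps. -/
theorem coeff_of_X_linear {B : Type*} [Ring B] {G : PowerSeries A → PowerSeries B}
    (hadd : ∀ ξ η, G (ξ + η) = G ξ + G η)
    (hX : ∀ ξ, G (PowerSeries.X * ξ) = PowerSeries.X * G ξ) (m : ℕ) (ξ : PowerSeries A) :
    PowerSeries.coeff m (G ξ) = ∑ q ∈ Finset.HasAntidiagonal.antidiagonal m,
      PowerSeries.coeff q.2 (G (PowerSeries.C (PowerSeries.coeff q.1 ξ))) := by
  have hξ : ∀ ξ : PowerSeries A, ξ = PowerSeries.C (PowerSeries.coeff 0 ξ)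
      + PowerSeries.X * PowerSeries.mk fun k => PowerSeries.coeff (k + 1) ξ := fun ξ =>
    PowerSeries.ext fun m => by
      cases m with
      | zero => simp
      | succ m => rw [map_add, PowerSeries.coeff_succ_X_mul, PowerSeries.coeff_mk,
          PowerSeries.coeff_succ_C, zero_add]
  induction m generalizing ξ with
  | zero =>
    conv_lhs => rw [hξ ξ, hadd, hX, map_add, PowerSeries.coeff_zero_X_mul, add_zero]
    simp
  | succ m ih =>
    conv_lhs => rw [hξ ξ, hadd, hX, map_add, PowerSeries.coeff_succ_X_mul, ih]
    rw [Finset.Nat.sum_antidiagonal_succ]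
    simp only [PowerSeries.coeff_mk]

theorem coeff_star_left (hx : IsFedosovElement b r s nab Om x) (m : ℕ) (ξ η : PowerSeries A) :
    PowerSeries.coeff m (star b T r s nab x ξ η) = ∑ q ∈ Finset.HasAntidiagonal.antidiagonal m,
      PowerSeries.coeff q.2 (star b T r s nab x (PowerSeries.C (PowerSeries.coeff q.1 ξ)) η) :=
  coeff_of_X_linear (G := fun ξ => star b T r s nab x ξ η)
    (fun _ _ => star_add_left T hx _ _ _) (fun _ => star_X_left T hx _ _) m ξ

theorem coeff_star_right (hx : IsFedosovElement b r s nab Om x) (m : ℕ) (ξ η : PowerSeries A) :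
    PowerSeries.coeff m (star b T r s nab x ξ η) = ∑ q ∈ Finset.HasAntidiagonal.antidiagonal m,
      PowerSeries.coeff q.2 (star b T r s nab x ξ (PowerSeries.C (PowerSeries.coeff q.1 η))) :=
  coeff_of_X_linear (G := fun η => star b T r s nab x ξ η)
    (fun _ _ => star_add_right T hx _ _ _) (fun _ => star_X_right T hx _ _) m η

theorem opD_incl (i : Fin n) (ξ : PowerSeries A) : opD i (incl ξ : Fed R g n A) = 0 :=
  fed_ext fun m κ => by
    rw [cf_opD, cf_incl, if_neg, smul_zero, cf_zero]
    intro h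
    have := DFunLike.congr_fun h i
    simp at this

theorem opCov_incl (ξ : PowerSeries A) : opCov b nab (incl ξ : Fed R g n A) = 0 := by
  simp [opCov_apply, opNab_apply, opHat_apply, opD_incl, (isForm_incl ξ).opI_eq_zero]

/-- Elements of `A[[t]]` contain neither `y` nor forms, so the products with `ϱ` are undeformed;
they agree in both orders because `ϱ` is scalar-valued in `A`. -/
theorem opAd_incl (hx : IsForm 1 x) (ξ : PowerSeries A) :
    opAd (coords b (r + s)) (extL A x) (incl ξ) = 0 := X_mul_cancel (by
  rw [X_mul_opAd hx, mul_zero, opBr_apply, (isForm_incl ξ).opS_eq, pow_zero, one_smul,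
    circ_of_opD_left _ fun i => opD_incl i ξ, circ_of_opD_right _ fun i => opD_incl i ξ,
    extL_mul_comm_one A hx, (isForm_incl ξ).opS_eq, pow_zero, one_smul, sub_self])

theorem opPert_incl (hx : IsForm 1 x) (ξ : PowerSeries A) :
    opPert T b r s nab x (incl ξ) = opLeft b T (incl ξ) := by
  rw [opPert_apply, opCov_incl, opAd_incl hx, zero_add, add_zero]

theorem incl_one : (incl (1 : PowerSeries A) : Fed R g n A) = 1 := map_one _

theorem tau_one (hx : IsFedosovElement b r s nab Om x) : tau b T r s nab x 1 = 1 := by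
  refine (eq_tau T hx ?_).symm
  rw [opTau_apply, ← incl_one, opPert_incl T hx.isForm, incl_one, ← extL_one, opLeft_extL,
    map_zero, add_zero]

theorem star_one_left (hx : IsFedosovElement b r s nab Om x) (ξ : PowerSeries A) :
    star b T r s nab x 1 ξ = ξ := by
  rw [star_eq, tau_one T hx, circ_of_opD_left _ opD_one, one_mul, sigma_tau T hx]

theorem star_one_right (hx : IsFedosovElement b r s nab Om x) (ξ : PowerSeries A) :
    star b T r s nab x ξ 1 = ξ := by
  rw [star_eq, tau_one T hx, circ_of_opD_right _ opD_one, mul_one, sigma_tau T hx]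

theorem opAct_incl (i : Fin n) (c : A) : opAct b T i (incl (PowerSeries.C c) : Fed R g n A)
    = incl (PowerSeries.C (T.act (b i) c)) := fed_ext fun m κ => by
  rw [cf_opAct, cf_incl, cf_incl, PowerSeries.coeff_C, PowerSeries.coeff_C]
  split_ifs <;> simp

/-- The Fedosov-Taylor series in symmetric degree at most one. -/
theorem tau_C_approx (hx : IsFedosovElement b r s nab Om x) (c : A) :
    InFiltration 2 (tau b T r s nab x (PowerSeries.C c) - (incl (PowerSeries.C c)
      + ∑ i, opY i (incl (PowerSeries.C (T.act (b i) c))))) := by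
  have h1 : opTau T b r s nab x (incl (PowerSeries.C c)) =
      ∑ i, opY i (incl (PowerSeries.C (T.act (b i) c))) := by
    -- The image under `δ⁻¹` is found backwards: `δ` of the proposed answer is `L_A c`, and its
    -- other Hodge components vanish.
    have h := hodge_apply b (∑ i, opY i (incl (PowerSeries.C (T.act (b i) c))) : Fed R g n A)
    have hδ : opDelta b (∑ i, opY i (incl (PowerSeries.C (T.act (b i) c))) : Fed R g n A)
        = opLeft b T (incl (PowerSeries.C c)) := by
      simp only [opDelta_apply, opLeft_apply, map_sum, opY_opD', opD_incl, map_zero, zero_add,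
        opAct_incl, apply_ite, map_zero]
      refine Finset.sum_congr rfl fun i _ => ?_
      simp
    have hP : opP (∑ i, opY i (incl (PowerSeries.C (T.act (b i) c))) : Fed R g n A) = 0 :=
      fed_ext fun m κ => by
        rw [cf_opP]
        split_ifs with h
        · subst h
          simp [cf_opY_zero]
        · simp
    have h0 : IsForm 0 (∑ i, opY i (incl (PowerSeries.C (T.act (b i) c))) : Fed R g n A) :=
      IsForm.sum fun i _ => (isForm_incl _).opY i
    rw [h0.opInv_eq_zero, map_zero, zero_add, hδ, hP, sub_zero] at h
    rw [opTau_apply, opPert_incl T hx.isForm, h]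
  have h2 : InFiltration 1 (tau b T r s nab x (PowerSeries.C c) - incl (PowerSeries.C c)) := by
    have e := tau_eq T hx (PowerSeries.C c)
    rw [← sub_eq_iff_eq_add'] at e
    rw [e]
    exact InFiltration.opTau T hx.filtration (InFiltration.zero_left _)
  have h3 := InFiltration.opTau T hx.filtration h2 (b := b) (r := r) (s := s) (nab := nab)
  rw [map_sub, h1] at h3
  nth_rewrite 1 [tau_eq T hx]
  rwa [add_sub_add_left_eq_sub]

theorem coeff_sigma_opD_tau (hx : IsFedosovElement b r s nab Om x) (c : A) (i : Fin n) :
    PowerSeries.coeff 0 (sigma (opD i (tau b T r s nab x (PowerSeries.C c)))) = T.act (b i) c := by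
  have h := tau_C_approx T hx c 0 (Finsupp.single i 1) (by rw [Finsupp.degree_single]; omega)
  have hne : Finsupp.single i 1 ≠ (0 : Fin n →₀ ℕ) := fun h => by
    have := DFunLike.congr_fun h i
    simp at this
  rw [cf_sub, sub_eq_zero, cf_add, cf_incl, if_neg hne, zero_add, cf_sum,
    Finset.sum_eq_single i] at h
  · rw [cf_opY, if_neg (by simp), tsub_self, cf_incl, if_pos rfl] at h
    rw [coeff_sigma, cf_opD, zero_add, h]
    simp
  · intro j _ hj
    rw [cf_opY, if_pos (by simp [hj.symm])]
  · simp

end Linearity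

/-! ### Equivariant linear maps of the coefficient algebra. -/

section Naturality

variable {R g : Type*} [CommRing R] [Algebra ℚ R] [LieRing g] [LieAlgebra R g] {n : ℕ}
  {A : Type*} [Ring A] [Algebra R A]
  {b : Module.Basis (Fin n) R g} {r s : g ⊗[R] g} {nab : g →ₗ[R] g →ₗ[R] g}
  {Om : PowerSeries (Forms R g)} (T : DerivationAction R g A) {x : Fed R g n R}

/-- A linear map of the coefficients in `A`. -/
def opMap (f : Module.End R A) : Module.End R (Fed R g n A) :=
  mapEnd R g n A (LinearMap.rTensor (Forms R g) f)

theorem cf_opMap (f : Module.End R A) (m : ℕ) (κ : Fin n →₀ ℕ) (a : Fed R g n A) :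
    cf m κ (opMap f a) = LinearMap.rTensor (Forms R g) f (cf m κ a) := cf_mapEnd _ _ _ _

theorem tlinear_opMap (f : Module.End R A) : TLinear (opMap f : Module.End R (Fed R g n A)) :=
  tlinear_mapEnd _

theorem opMap_opD (f : Module.End R A) (i : Fin n) (a : Fed R g n A) :
    opMap f (opD i a) = opD i (opMap f a) :=
  (LinearMap.congr_fun (opD_mapEnd i (LinearMap.rTensor (Forms R g) f)) a).symm

theorem opMap_opY (f : Module.End R A) (i : Fin n) (a : Fed R g n A) :
    opMap f (opY i a) = opY i (opMap f a) :=
  (LinearMap.congr_fun (opY_mapEnd i (LinearMap.rTensor (Forms R g) f)) a).symm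

theorem rTensor_lTensor_comm (f : Module.End R A) (h : Forms R g →ₗ[R] Forms R g)
    (c : Cf R g A) : LinearMap.rTensor (Forms R g) f (LinearMap.lTensor A h c)
      = LinearMap.lTensor A h (LinearMap.rTensor (Forms R g) f c) := by
  rw [← LinearMap.comp_apply, ← LinearMap.comp_apply, LinearMap.rTensor_comp_lTensor,
    LinearMap.lTensor_comp_rTensor]

theorem opMap_lTensor (f : Module.End R A) (h : Forms R g →ₗ[R] Forms R g) (a : Fed R g n A) :
    opMap f (mapEnd R g n A (LinearMap.lTensor A h) a)
      = mapEnd R g n A (LinearMap.lTensor A h) (opMap f a) := fed_ext fun m κ => by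
  simp only [cf_opMap, cf_mapEnd, rTensor_lTensor_comm]

theorem opMap_opI (f : Module.End R A) (j : Fin n) (a : Fed R g n A) :
    opMap f (opI b j a) = opI b j (opMap f a) := opMap_lTensor _ _ _

theorem opMap_opS (f : Module.End R A) (a : Fed R g n A) :
    opMap f (opS a) = opS (opMap f a) := opMap_lTensor _ _ _

theorem opMap_opE (f : Module.End R A) (j : Fin n) (a : Fed R g n A) :
    opMap f (opE b j a) = opE b j (opMap f a) := by
  rw [opE_eq_lTensor, opMap_lTensor]

theorem opMap_opW (f : Module.End R A) (a : Fed R g n A) :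
    opMap f (opW a) = opW (opMap f a) := fed_ext fun m κ => by
  simp only [cf_opMap, cf_opW, map_sum, map_smul, rTensor_lTensor_comm]

theorem opInv_apply (a : Fed R g n A) : opInv b a = ∑ i, opY i (opI b i (opW a)) := by
  rw [opInv, Module.End.mul_apply, opDeltaStar, LinearMap.sum_apply]; rfl

theorem opMap_opInv (f : Module.End R A) (a : Fed R g n A) :
    opMap f (opInv b a) = opInv b (opMap f a) := by
  simp only [opInv_apply, map_sum, opMap_opY, opMap_opI, opMap_opW]

theorem opMap_opCov (f : Module.End R A) (a : Fed R g n A) :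
    opMap f (opCov b nab a) = opCov b nab (opMap f a) := by
  simp only [opCov_apply, opNab_apply, opHat_apply, map_sum, map_neg, map_smul, map_add,
    opMap_opE, opMap_opY, opMap_opD, opMap_opI]

theorem opMap_opLeft {f : Module.End R A} (hf : ∀ X a, f (T.act X a) = T.act X (f a))
    (a : Fed R g n A) : opMap f (opLeft b T a) = opLeft b T (opMap f a) := by
  have h : ∀ i a, opMap f (opAct b T i a) = opAct b T i (opMap f a : Fed R g n A) := fun i a =>
    fed_ext fun m κ => by
      rw [cf_opMap, cf_opAct, cf_opAct, cf_opMap, ← LinearMap.comp_apply, ← LinearMap.comp_apply,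
        ← LinearMap.rTensor_comp, ← LinearMap.rTensor_comp,
        show f ∘ₗ T.act (b i) = T.act (b i) ∘ₗ f from LinearMap.ext (hf _)]
  simp only [opLeft_apply, map_sum, opMap_opE, h]

theorem rTensor_cfExt_mul (f : Module.End R A) (c : Cf R g R) (c' : Cf R g A) :
    LinearMap.rTensor (Forms R g) f (cfExt A c * c')
      = cfExt A c * LinearMap.rTensor (Forms R g) f c' := by
  induction c using TensorProduct.induction_on with
  | zero => simp
  | add y z hy hz => simp only [map_add, add_mul, hy, hz]
  | tmul q α =>
    induction c' using TensorProduct.induction_on with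
    | zero => simp
    | add y z hy hz => simp only [map_add, mul_add, hy, hz]
    | tmul a β =>
      simp [cfExt_tmul, Algebra.TensorProduct.tmul_mul_tmul, ← Algebra.smul_def]

theorem rTensor_mul_cfExt (f : Module.End R A) (c : Cf R g R) (c' : Cf R g A) :
    LinearMap.rTensor (Forms R g) f (c' * cfExt A c)
      = LinearMap.rTensor (Forms R g) f c' * cfExt A c := by
  induction c using TensorProduct.induction_on with
  | zero => simp
  | add y z hy hz => simp only [map_add, mul_add, hy, hz]
  | tmul q α =>
    induction c' using TensorProduct.induction_on with
    | zero => simp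
    | add y z hy hz => simp only [map_add, add_mul, hy, hz]
    | tmul a β =>
      simp [cfExt_tmul, Algebra.TensorProduct.tmul_mul_tmul, ← Algebra.commutes,
        ← Algebra.smul_def]

/-- The map `f` is linear but not multiplicative. It passes through the product only because the
other factor is scalar-valued in `A`. -/
theorem opMap_circ_left (f : Module.End R A) (p : Matrix (Fin n) (Fin n) R) (y : Fed R g n R)
    (a : Fed R g n A) : opMap f (circL p (extL A y) a) = circL p (extL A y) (opMap f a) := by
  have h : ∀ (N : ℕ) (y : Fed R g n R) (a : Fed R g n A),
      opMap f (moyalL p N (extL A y) a) = moyalL p N (extL A y) (opMap f a) := fun N => by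
    induction N with
    | zero =>
      intro y a
      refine fed_ext fun m κ => ?_
      simp only [moyalL_zero, cf_opMap, cf_mul, map_sum, cf_extL, rTensor_cfExt_mul]
    | succ N ih =>
      intro y a
      simp only [moyalL_succ, map_sum, map_smul, ← extL_opD, ih, opMap_opD]
  exact tlinear_circ_eq p (tlinear_mapEnd _) fun N => h N y a

theorem opMap_circ_right (f : Module.End R A) (p : Matrix (Fin n) (Fin n) R) (y : Fed R g n R)
    (a : Fed R g n A) : opMap f (circL p a (extL A y)) = circL p (opMap f a) (extL A y) := by
  have h : ∀ (N : ℕ) (y : Fed R g n R) (a : Fed R g n A),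
      opMap f (moyalL p N a (extL A y)) = moyalL p N (opMap f a) (extL A y) := fun N => by
    induction N with
    | zero =>
      intro y a
      refine fed_ext fun m κ => ?_
      simp only [moyalL_zero, cf_opMap, cf_mul, map_sum, cf_extL, rTensor_mul_cfExt]
    | succ N ih =>
      intro y a
      simp only [moyalL_succ, map_sum, map_smul, ← extL_opD, ih, opMap_opD]
  exact tlinear_circ_eq p (tlinear_mapEnd _) fun N => h N y a

theorem opMap_opAd (f : Module.End R A) {p : Matrix (Fin n) (Fin n) R} (hx : IsForm 1 x)
    (a : Fed R g n A) : opMap f (opAd p (extL A x) a) = opAd p (extL A x) (opMap f a) :=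
  X_mul_cancel (by
    rw [← tlinear_opMap, X_mul_opAd hx, X_mul_opAd hx, opBr_apply, opBr_apply, map_sub, opMap_circ_left, opMap_circ_right, opMap_opS])

theorem opMap_opPert (hx : IsForm 1 x) {f : Module.End R A}
    (hf : ∀ X a, f (T.act X a) = T.act X (f a)) (a : Fed R g n A) :
    opMap f (opPert T b r s nab x a) = opPert T b r s nab x (opMap f a) := by
  rw [opPert_apply, opPert_apply, map_add, map_add, opMap_opCov, opMap_opLeft T hf,
    opMap_opAd f hx]

/-- An equivariant map commutes with every operator in the fixed point equation, so it carries the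
solution for `ξ` to that for `ξ'`. Multiplicativity of `f` plays no role. -/
theorem tau_map (hx : IsFedosovElement b r s nab Om x) {f : Module.End R A}
    (hf : ∀ X a, f (T.act X a) = T.act X (f a)) {ξ ξ' : PowerSeries A}
    (h : ∀ m, PowerSeries.coeff m ξ' = f (PowerSeries.coeff m ξ)) :
    tau b T r s nab x ξ' = opMap f (tau b T r s nab x ξ) := by
  refine (eq_tau T hx ?_).symm
  have hi : (incl ξ' : Fed R g n A) = opMap f (incl ξ) := fed_ext fun m κ => by
    rw [cf_opMap, cf_incl, cf_incl, h]
    split_ifs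
    · rfl
    · exact (map_zero _).symm
  rw [hi]
  conv_lhs => rw [tau_eq T hx ξ]
  rw [map_add, opTau_apply, opTau_apply, opMap_opInv, opMap_opPert T hx.isForm hf]

end Naturality

/-! ### The star product with an arbitrary bilinear map in place of the product. -/

section BilinearStar

variable {R g : Type*} [CommRing R] [Algebra ℚ R] [LieRing g] [LieAlgebra R g] {n : ℕ}
  {A : Type*} [Ring A] [Algebra R A] {B : Type*} [AddCommGroup B] [Module R B]
  {C : Type*} [AddCommGroup C] [Module R C] (p : Matrix (Fin n) (Fin n) R)

/-- The coefficient of `t^k` in `σ(P^N (a ⊗ a'))`, multiplied with the bilinear map `β`. -/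
def moyalB (β : A →ₗ[R] A →ₗ[R] B) : ℕ → Fed R g n A → Fed R g n A → ℕ → B
  | 0, a, a', k => ∑ q ∈ Finset.HasAntidiagonal.antidiagonal k,
      β (PowerSeries.coeff q.1 (sigma a)) (PowerSeries.coeff q.2 (sigma a'))
  | N + 1, a, a', k => ∑ i, ∑ j, p i j • moyalB β N (opD i a) (opD j a') k

/-- The coefficient of `t^m` in `σ(a ∘ a')`, with the bilinear map `β` for the product of `A`. -/
def starB (β : A →ₗ[R] A →ₗ[R] B) (a a' : Fed R g n A) (m : ℕ) : B :=
  ∑ N ∈ Finset.range (m + 1), wt R N • moyalB p β N a a' (m - N)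

theorem map_moyalB (β : A →ₗ[R] A →ₗ[R] B) (γ : B →ₗ[R] C) (N : ℕ) (a a' : Fed R g n A) (k : ℕ) :
    γ (moyalB p β N a a' k) = moyalB p (β.compr₂ γ) N a a' k := by
  induction N generalizing a a' with
  | zero => simp only [moyalB, map_sum, LinearMap.compr₂_apply]
  | succ N ih => simp only [moyalB, map_sum, map_smul, ih]

theorem map_starB (β : A →ₗ[R] A →ₗ[R] B) (γ : B →ₗ[R] C) (a a' : Fed R g n A) (m : ℕ) :
    γ (starB p β a a' m) = starB p (β.compr₂ γ) a a' m := by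
  simp only [starB, map_sum, map_smul, map_moyalB]

theorem coeff_sigma_opMap (f : Module.End R A) (m : ℕ) (a : Fed R g n A) :
    PowerSeries.coeff m (sigma (opMap f a)) = f (PowerSeries.coeff m (sigma a)) := by
  rw [coeff_sigma, coeff_sigma, cf_opMap]
  induction cf m 0 a using TensorProduct.induction_on with
  | zero => simp
  | add y z hy hz => simp only [map_add, hy, hz]
  | tmul c α => simp

/-- Linear maps of the coefficients can be shifted from the arguments into the bilinear map.
Combined with `tau_map`, this reduces all star products on `T(U(g))` to one computation. -/
theorem moyalB_opMap (β : A →ₗ[R] A →ₗ[R] B) (f f' : Module.End R A) (N : ℕ)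
    (a a' : Fed R g n A) (k : ℕ) :
    moyalB p β N (opMap f a) (opMap f' a') k = moyalB p (β.compl₁₂ f f') N a a' k := by
  induction N generalizing a a' with
  | zero => simp only [moyalB, coeff_sigma_opMap, LinearMap.compl₁₂_apply]
  | succ N ih => simp only [moyalB, ← opMap_opD, ih]

theorem starB_opMap (β : A →ₗ[R] A →ₗ[R] B) (f f' : Module.End R A)
    (a a' : Fed R g n A) (m : ℕ) :
    starB p β (opMap f a) (opMap f' a') m = starB p (β.compl₁₂ f f') a a' m := by
  simp only [starB, moyalB_opMap]

/-- The projection `c ⊗ α ↦ ε(α) c` on the coefficients. -/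
def cfSigma : Cf R g A →ₐ[R] A :=
  (Algebra.TensorProduct.rid R R A).toAlgHom.comp
    (Algebra.TensorProduct.map (AlgHom.id R A) ExteriorAlgebra.algebraMapInv)

theorem coeff_sigma' (m : ℕ) (a : Fed R g n A) :
    PowerSeries.coeff m (sigma a) = cfSigma (cf m 0 a) := coeff_sigma m a

theorem coeff_sigma_mul (k : ℕ) (a a' : Fed R g n A) : PowerSeries.coeff k (sigma (a * a')) =
    ∑ q ∈ Finset.HasAntidiagonal.antidiagonal k,
      PowerSeries.coeff q.1 (sigma a) * PowerSeries.coeff q.2 (sigma a') := by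
  simp only [coeff_sigma', cf_mul, map_sum, map_mul]
  refine Finset.sum_congr rfl fun q _ => ?_
  simp

theorem coeff_sigma_sum {ι : Type*} (t : Finset ι) (f : ι → Fed R g n A) (k : ℕ) :
    PowerSeries.coeff k (sigma (∑ i ∈ t, f i)) = ∑ i ∈ t, PowerSeries.coeff k (sigma (f i)) := by
  simp only [coeff_sigma', cf_sum, map_sum]

theorem moyalB_mul (N : ℕ) (a a' : Fed R g n A) (k : ℕ) :
    moyalB p (LinearMap.mul R A) N a a' k = PowerSeries.coeff k (sigma (moyalL p N a a')) := by
  induction N generalizing a a' with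
  | zero => simp only [moyalB, LinearMap.mul_apply', moyalL_zero, coeff_sigma_mul]
  | succ N ih => simp only [moyalB, moyalL_succ, coeff_sigma_sum, coeff_sigma_smul, ih]

theorem starB_mul (a a' : Fed R g n A) (m : ℕ) :
    starB p (LinearMap.mul R A) a a' m = PowerSeries.coeff m (sigma (circL p a a')) := by
  simp only [starB, moyalB_mul, coeff_sigma', cf_circL, map_sum, map_smul]

end BilinearStar

attribute [local instance 100] LieRing.ofAssociativeRing

/-! ### The action of the enveloping algebra and its coproduct. -/

section Enveloping

variable {R g : Type*} [CommRing R] [LieRing g] [LieAlgebra R g]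

/-- The elements with the property form a subalgebra. The universal property maps `U(g)` into it,
and uniqueness of maps out of `U(g)` shows that this is the identity. -/
theorem enveloping_induction {C : U R g → Prop} (hr : ∀ c : R, C (algebraMap R _ c))
    (hι : ∀ X : g, C (UniversalEnvelopingAlgebra.ι R X))
    (hmul : ∀ u v, C u → C v → C (u * v)) (hadd : ∀ u v, C u → C v → C (u + v)) (u : U R g) :
    C u := by
  let S : Subalgebra R (U R g) :=
    { carrier := {u | C u}
      mul_mem' := fun {u v} => hmul u v
      add_mem' := fun {u v} => hadd u v
      algebraMap_mem' := hr }
  let f : g →ₗ⁅R⁆ S :=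
    { toFun := fun X => ⟨UniversalEnvelopingAlgebra.ι R X, hι X⟩
      map_add' := fun X Y => Subtype.ext (map_add _ _ _)
      map_smul' := fun c X => Subtype.ext (map_smul _ _ _)
      map_lie' := fun {X Y} =>
        Subtype.ext (LieHom.map_lie (UniversalEnvelopingAlgebra.ι R) X Y) }
  have h : S.val.comp (UniversalEnvelopingAlgebra.lift R f) = AlgHom.id R _ := by
    refine UniversalEnvelopingAlgebra.hom_ext R (LieHom.ext fun X => ?_)
    change S.val (UniversalEnvelopingAlgebra.lift R f (UniversalEnvelopingAlgebra.ι R X)) =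
      UniversalEnvelopingAlgebra.ι R X
    rw [UniversalEnvelopingAlgebra.lift_ι_apply]; rfl
  rw [← AlgHom.id_apply (R := R) u, ← h]
  exact (UniversalEnvelopingAlgebra.lift R f u).2

variable {A : Type*} [Ring A] [Algebra R A] (T : DerivationAction R g A)

/-- The action of the universal enveloping algebra. -/
def envAct : U R g →ₐ[R] Module.End R A :=
  UniversalEnvelopingAlgebra.lift R
    { toFun := T.act
      map_add' := map_add _
      map_smul' := map_smul _
      map_lie' := fun {X Y} => LinearMap.ext fun a => T.act_lie X Y a }

theorem envAct_ι (X : g) : envAct T (UniversalEnvelopingAlgebra.ι R X) = T.act X :=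
  UniversalEnvelopingAlgebra.lift_ι_apply R _ X

theorem act_one (X : g) : T.act X 1 = 0 := by
  have h := T.leibniz X 1 1
  rwa [one_mul, one_mul, mul_one, left_eq_add] at h

theorem envAct_one (u : U R g) : envAct T u 1 = counit R g u • (1 : A) := by
  induction u using enveloping_induction with
  | hr c => simp
  | hι X => rw [envAct_ι, act_one, counit, UniversalEnvelopingAlgebra.lift_ι_apply]; simp
  | hmul u v hu hv => rw [map_mul, Module.End.mul_apply, hv, map_smul, hu, map_mul, smul_smul,
      mul_comm]
  | hadd u v hu hv => rw [map_add, LinearMap.add_apply, hu, hv, map_add, add_smul]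

/-- The orbit map `u ↦ u ▷ a`. -/
def orbit (a : A) : U R g →ₗ[R] A := (LinearMap.applyₗ a) ∘ₗ (envAct T).toLinearMap

theorem orbit_apply (a : A) (u : U R g) : orbit T a u = envAct T u a := rfl

theorem act_ι (X : g) (v : U R g) : (tensorAction R g).act X (TensorAlgebra.ι R v)
    = TensorAlgebra.ι R (UniversalEnvelopingAlgebra.ι R X * v) := der_ι _ _

theorem envAct_ι_tensor (u v : U R g) : envAct (tensorAction R g) u (TensorAlgebra.ι R v)
    = TensorAlgebra.ι R (u * v) := by
  induction u using enveloping_induction generalizing v with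
  | hr c => simp [Algebra.algebraMap_eq_smul_one]
  | hι X => rw [envAct_ι, act_ι]
  | hmul u w hu hw => rw [map_mul, Module.End.mul_apply, hw, hu, mul_assoc]
  | hadd u w hu hw => rw [map_add, LinearMap.add_apply, hu, hw, add_mul, map_add]

theorem tensorTwo_tmul (v w : U R g) :
    tensorTwo R g (v ⊗ₜ w) = TensorAlgebra.ι R v * TensorAlgebra.ι R w := rfl

/-- The Leibniz rule on a product of two generators is left multiplication by `X ⊗ 1 + 1 ⊗ X`; this
is where the coproduct enters. -/
theorem act_tensorTwo (X : g) (w : U R g ⊗[R] U R g) :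
    (tensorAction R g).act X (tensorTwo R g w)
      = tensorTwo R g (comul R g (UniversalEnvelopingAlgebra.ι R X) * w) := by
  rw [comul, UniversalEnvelopingAlgebra.lift_ι_apply]
  induction w using TensorProduct.induction_on with
  | zero => simp
  | add y z hy hz => simp only [map_add, mul_add, hy, hz]
  | tmul v w =>
    rw [tensorTwo_tmul, (tensorAction R g).leibniz, act_ι, act_ι]
    change _ = tensorTwo R g ((_ ⊗ₜ 1 + 1 ⊗ₜ _) * v ⊗ₜ w)
    rw [add_mul, Algebra.TensorProduct.tmul_mul_tmul, Algebra.TensorProduct.tmul_mul_tmul, one_mul,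
      one_mul, map_add, tensorTwo_tmul, tensorTwo_tmul]

theorem envAct_tensorTwo (u : U R g) (w : U R g ⊗[R] U R g) :
    envAct (tensorAction R g) u (tensorTwo R g w) = tensorTwo R g (comul R g u * w) := by
  induction u using enveloping_induction generalizing w with
  | hr c => simp [Algebra.algebraMap_eq_smul_one]
  | hι X => rw [envAct_ι, act_tensorTwo]
  | hmul u v hu hv => rw [map_mul, Module.End.mul_apply, hv, hu, map_mul (comul R g), mul_assoc]
  | hadd u v hu hv => rw [map_add, LinearMap.add_apply, hu, hv, map_add, add_mul, map_add]

end Enveloping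

/-! ### Components of low degree in a tensor algebra. -/

section Retractions

variable {R M : Type*} [CommRing R] [AddCommGroup M] [Module R M]

/-- Tensors of degree at most three. -/
abbrev Trunc (R M : Type*) [CommRing R] [AddCommGroup M] [Module R M] : Type _ :=
  R × M × (M ⊗[R] M) × (M ⊗[R] (M ⊗[R] M))

/-- Left multiplication of tensors of degree at most three by elements of `M`, without the
terms of higher degree. -/
def truncMul : M →ₗ[R] Module.End R (Trunc R M) :=
  LinearMap.mk₂ R (fun m z => (0, z.1 • m, m ⊗ₜ z.2.1, m ⊗ₜ z.2.2.1))
    (fun m m' z => by simp [TensorProduct.add_tmul])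
    (fun c m z => by simp [TensorProduct.smul_tmul', smul_comm c])
    (fun m z z' => by simp [TensorProduct.tmul_add, add_smul])
    (fun c m z => by simp [mul_smul])

/-- The action of the tensor algebra on tensors of degree at most three. -/
def truncAct : TensorAlgebra R M →ₐ[R] Module.End R (Trunc R M) :=
  TensorAlgebra.lift R truncMul

theorem truncAct_ι (m : M) (z : Trunc R M) : truncAct (TensorAlgebra.ι R m) z =
    (0, z.1 • m, m ⊗ₜ z.2.1, m ⊗ₜ z.2.2.1) := by
  rw [truncAct, TensorAlgebra.lift_ι_apply]; rfl

/-- The components of degree at most three of an element of the tensor algebra. -/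
def trunc : TensorAlgebra R M →ₗ[R] Trunc R M :=
  LinearMap.applyₗ ((1, 0, 0, 0) : Trunc R M) ∘ₗ truncAct.toLinearMap

theorem trunc_apply (a : TensorAlgebra R M) : trunc a = truncAct a (1, 0, 0, 0) := rfl

theorem trunc_ι_mul (m : M) (a : TensorAlgebra R M) : trunc (TensorAlgebra.ι R m * a) =
    (0, (trunc a).1 • m, m ⊗ₜ (trunc a).2.1, m ⊗ₜ (trunc a).2.2.1) := by
  rw [trunc_apply, map_mul, Module.End.mul_apply, truncAct_ι]; rfl

theorem trunc_one : trunc (1 : TensorAlgebra R M) = (1, 0, 0, 0) := by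
  rw [trunc_apply, map_one]; rfl

theorem trunc_ι (m : M) : trunc (TensorAlgebra.ι R m) = (0, m, 0, 0) := by
  rw [← mul_one (TensorAlgebra.ι R m), trunc_ι_mul, trunc_one]; simp

/-- The projection on tensor degree one. -/
def projOne : TensorAlgebra R M →ₗ[R] M :=
  LinearMap.fst R _ _ ∘ₗ LinearMap.snd R _ _ ∘ₗ trunc

theorem projOne_ι (m : M) : projOne (TensorAlgebra.ι R m) = m := by
  change (trunc _).2.1 = m
  rw [trunc_ι]

theorem projOne_algebraMap (c : R) : projOne (algebraMap R (TensorAlgebra R M) c) = 0 := by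
  rw [Algebra.algebraMap_eq_smul_one, map_smul]
  change c • (trunc _).2.1 = 0
  rw [trunc_one, smul_zero]

/-- Components of degree zero and one multiply as in the dual numbers, independently of higher
degrees. -/
theorem truncAct_fst (a : TensorAlgebra R M) (z : Trunc R M) :
    (truncAct a z).1 = TensorAlgebra.algebraMapInv a * z.1 ∧
      (truncAct a z).2.1 = TensorAlgebra.algebraMapInv a • z.2.1 + z.1 • projOne a := by
  induction a using TensorAlgebra.induction generalizing z with
  | algebraMap c =>
    rw [AlgHom.commutes, AlgHom.commutes, Module.algebraMap_end_apply, projOne_algebraMap]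
    simp
  | ι m => rw [truncAct_ι, projOne_ι]; simp [TensorAlgebra.algebraMapInv]
  | mul a a' h h' =>
    have h1 : projOne (a * a') = (truncAct a (trunc a')).2.1 := by
      change (truncAct (a * a') _).2.1 = _
      rw [map_mul]; rfl
    rw [h1, map_mul, Module.End.mul_apply, (h _).1, (h _).2, (h' _).1, (h' _).2, (h _).2,
      trunc_apply, (h' _).1, (h' _).2, map_mul]
    constructor
    · ring
    · simp only [smul_add, smul_smul, smul_zero, zero_add, one_smul, one_mul, ← add_assoc,
        mul_comm]
  | add a a' h h' =>
    rw [map_add, LinearMap.add_apply, Prod.fst_add, Prod.snd_add, Prod.fst_add, (h _).1, (h _).2,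
      (h' _).1, (h' _).2, map_add, map_add, add_mul, add_smul, smul_add]
    exact ⟨rfl, by abel⟩

theorem projOne_mul (a a' : TensorAlgebra R M) : projOne (a * a') =
    TensorAlgebra.algebraMapInv a • projOne a' + TensorAlgebra.algebraMapInv a' • projOne a := by
  have h1 : projOne (a * a') = (truncAct a (trunc a')).2.1 := by
    change (truncAct (a * a') _).2.1 = _
    rw [map_mul]; rfl
  rw [h1, (truncAct_fst a _).2, trunc_apply, (truncAct_fst a' _).1, mul_one]
  rfl

/-- A derivation extending a map of generators preserves the tensor degree, so the projection on
degree one intertwines it with that map. This makes `projOne` equivariant. -/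
theorem projOne_der (f : M →ₗ[R] M) (a : TensorAlgebra R M) :
    TensorAlgebra.algebraMapInv (der f a) = 0 ∧ projOne (der f a) = f (projOne a) := by
  induction a using TensorAlgebra.induction with
  | algebraMap c => simp [der_algebraMap, projOne_algebraMap]
  | ι m => rw [der_ι, projOne_ι, projOne_ι]; simp [TensorAlgebra.algebraMapInv]
  | mul a a' h h' =>
    rw [der_mul, map_add, map_mul, map_mul, h.1, h'.1, map_add, projOne_mul, projOne_mul,
      projOne_mul, h.1, h'.1, h.2, h'.2, map_add, map_smul, map_smul]
    simp [add_comm]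
  | add a a' h h' => rw [map_add, map_add, map_add, map_add, map_add, h.1, h.2, h'.1, h'.2]; simp

/-- The inclusion of the tensors of degree three. -/
def tensorThree : (M ⊗[R] M) ⊗[R] M →ₗ[R] TensorAlgebra R M :=
  LinearMap.mul' R _ ∘ₗ TensorProduct.map
    (LinearMap.mul' R _ ∘ₗ TensorProduct.map (TensorAlgebra.ι R) (TensorAlgebra.ι R))
    (TensorAlgebra.ι R)

theorem tensorThree_tmul (m m' m'' : M) : tensorThree ((m ⊗ₜ[R] m') ⊗ₜ m'') =
    TensorAlgebra.ι R m * TensorAlgebra.ι R m' * TensorAlgebra.ι R m'' := rfl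

/-- The degree three component supplied by `trunc` is a left inverse, for any module. Identities
between tensors can therefore be checked inside the tensor algebra. -/
theorem tensorThree_injective :
    Function.Injective (tensorThree : (M ⊗[R] M) ⊗[R] M →ₗ[R] TensorAlgebra R M) := by
  have h : ((TensorProduct.assoc R M M M).symm.toLinearMap ∘ₗ LinearMap.snd R _ _ ∘ₗ
      LinearMap.snd R _ _ ∘ₗ LinearMap.snd R _ _ ∘ₗ trunc) ∘ₗ tensorThree = LinearMap.id := by
    refine TensorProduct.ext_threefold fun m m' m'' => ?_
    change (TensorProduct.assoc R M M M).symm (trunc (tensorThree ((m ⊗ₜ[R] m') ⊗ₜ m''))).2.2.2 = _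
    rw [tensorThree_tmul, mul_assoc, trunc_ι_mul, trunc_ι_mul, trunc_ι]
    rfl
  refine fun u v huv => ?_
  have hu := LinearMap.congr_fun h u
  have hv := LinearMap.congr_fun h v
  rw [LinearMap.comp_apply, LinearMap.id_apply] at hu hv
  rw [← hu, ← hv, huv]

end Retractions

/-! ### Twist identities expressed through the action. -/

section TwistMaps

variable {R g : Type*} [CommRing R] [LieRing g] [LieAlgebra R g]

theorem comulLeft_tmul (u v : U R g) : comulLeft R g (u ⊗ₜ v) = comul R g u ⊗ₜ v := rfl

theorem comulRight_tmul (u v : U R g) :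
    comulRight R g (u ⊗ₜ v) = reassoc R g (u ⊗ₜ comul R g v) := rfl

theorem counitLeft_tmul (u v : U R g) : counitLeft R g (u ⊗ₜ v) = counit R g u • v := rfl

theorem counitRight_tmul (u v : U R g) : counitRight R g (u ⊗ₜ v) = counit R g v • u := rfl

theorem tensorThree_tmul_right (w : U R g ⊗[R] U R g) (v : U R g) :
    tensorThree (w ⊗ₜ[R] v) = tensorTwo R g w * TensorAlgebra.ι R v := rfl

theorem tensorThree_reassoc (u : U R g) (w : U R g ⊗[R] U R g) :
    tensorThree (reassoc R g (u ⊗ₜ[R] w)) = TensorAlgebra.ι R u * tensorTwo R g w := by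
  induction w using TensorProduct.induction_on with
  | zero => simp
  | add y z hy hz => rw [TensorProduct.tmul_add, map_add, map_add, map_add, mul_add, hy, hz]
  | tmul v w =>
    change tensorThree ((u ⊗ₜ[R] v) ⊗ₜ[R] w) = _
    rw [tensorThree_tmul, tensorTwo_tmul, mul_assoc]

/-- The map `u ⊗ v ↦ (u ▷ a) (v ▷ a')`. -/
def pairing {A : Type*} [Ring A] [Algebra R A] (T : DerivationAction R g A) (a a' : A) :
    U R g ⊗[R] U R g →ₗ[R] A :=
  LinearMap.mul' R A ∘ₗ TensorProduct.map (orbit T a) (orbit T a')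

theorem pairing_tmul {A : Type*} [Ring A] [Algebra R A] (T : DerivationAction R g A) (a a' : A)
    (u v : U R g) : pairing T a a' (u ⊗ₜ v) = envAct T u a * envAct T v a' := rfl

theorem pairing_one_one (w : U R g ⊗[R] U R g) :
    pairing (tensorAction R g) (TensorAlgebra.ι R 1) (TensorAlgebra.ι R 1) w
      = tensorTwo R g w := by
  induction w using TensorProduct.induction_on with
  | zero => simp
  | add y z hy hz => rw [map_add, map_add, hy, hz]
  | tmul u v => rw [pairing_tmul, envAct_ι_tensor, envAct_ι_tensor, mul_one, mul_one,
      tensorTwo_tmul]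

/-- Acting on a tensor of degree two applies the coproduct to the first leg, so the product `(1 ⋆ 1)
⋆ 1` takes the shape `(Δ ⊗ id)(F) (F ⊗ 1)`. -/
theorem pairing_tensorTwo_left (w' w : U R g ⊗[R] U R g) :
    pairing (tensorAction R g) (tensorTwo R g w') (TensorAlgebra.ι R 1) w
      = tensorThree (comulLeft R g w * tensorOne R g w') := by
  induction w using TensorProduct.induction_on with
  | zero => simp
  | add y z hy hz => rw [map_add, map_add, add_mul, map_add, hy, hz]
  | tmul u v =>
    rw [pairing_tmul, envAct_ι_tensor, envAct_tensorTwo, mul_one, comulLeft_tmul]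
    change _ = tensorThree ((comul R g u ⊗ₜ[R] v) * (w' ⊗ₜ[R] (1 : U R g)))
    rw [Algebra.TensorProduct.tmul_mul_tmul, mul_one, tensorThree_tmul_right]

theorem pairing_tensorTwo_right (w' w : U R g ⊗[R] U R g) :
    pairing (tensorAction R g) (TensorAlgebra.ι R 1) (tensorTwo R g w') w
      = tensorThree (comulRight R g w * oneTensor R g w') := by
  induction w using TensorProduct.induction_on with
  | zero => simp
  | add y z hy hz => rw [map_add, map_add, add_mul, map_add, hy, hz]
  | tmul u v =>
    rw [pairing_tmul, envAct_ι_tensor, envAct_tensorTwo, mul_one, comulRight_tmul]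
    change _ = tensorThree (reassoc R g (u ⊗ₜ[R] comul R g v) *
      reassoc R g ((1 : U R g) ⊗ₜ[R] w'))
    rw [← map_mul (reassoc R g), Algebra.TensorProduct.tmul_mul_tmul, mul_one,
      tensorThree_reassoc]

/-- On the unit of the tensor algebra the action factors through the counit, since derivations kill
the unit. -/
theorem pairing_unit_left (w : U R g ⊗[R] U R g) :
    pairing (tensorAction R g) 1 (TensorAlgebra.ι R 1) w
      = TensorAlgebra.ι R (counitLeft R g w) := by
  induction w using TensorProduct.induction_on with
  | zero => simp
  | add y z hy hz => rw [map_add, map_add, map_add, hy, hz]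
  | tmul u v => rw [pairing_tmul, envAct_one, envAct_ι_tensor, mul_one, counitLeft_tmul, map_smul,
      smul_mul_assoc, one_mul]

theorem pairing_unit_right (w : U R g ⊗[R] U R g) :
    pairing (tensorAction R g) (TensorAlgebra.ι R 1) 1 w
      = TensorAlgebra.ι R (counitRight R g w) := by
  induction w using TensorProduct.induction_on with
  | zero => simp
  | add y z hy hz => rw [map_add, map_add, map_add, hy, hz]
  | tmul u v => rw [pairing_tmul, envAct_one, envAct_ι_tensor, mul_one, counitRight_tmul, map_smul,
      mul_smul_comm, mul_one]

/-- The bilinear map `(a, a') ↦ pr₁ a ⊗ pr₁ a'`. -/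
def tensorProj : TensorAlgebra R (U R g) →ₗ[R] TensorAlgebra R (U R g) →ₗ[R] U R g ⊗[R] U R g :=
  (TensorProduct.mk R (U R g) (U R g)).compl₁₂ projOne projOne

theorem tensorProj_ι (u v : U R g) :
    tensorProj (TensorAlgebra.ι R u) (TensorAlgebra.ι R v) = u ⊗ₜ[R] v := by
  rw [tensorProj, LinearMap.compl₁₂_apply, projOne_ι, projOne_ι]; rfl

end TwistMaps

/-! ### The twist and its properties. -/

section Twist

variable {R g : Type*} [CommRing R] [Algebra ℚ R] [LieRing g] [LieAlgebra R g] {n : ℕ}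
variable {b : Module.Basis (Fin n) R g} {r s : g ⊗[R] g} {nab : g →ₗ[R] g →ₗ[R] g}
variable {Om : PowerSeries (Forms R g)} {x : Fed R g n R}

variable (b r s nab x) in
/-- The Drinfel'd twist of the universal deformation formula. -/
def twist : PowerSeries (U R g ⊗[R] U R g) :=
  PowerSeries.mk (starB (coords b (r + s)) tensorProj
    (tau b (tensorAction R g) r s nab x (oneT R g))
    (tau b (tensorAction R g) r s nab x (oneT R g)))

/-- Projection to degree one followed by `u ↦ u ▷ a` is equivariant and takes the unit of `U(g)` to
`a`. So a single Taylor series determines all the others. -/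
theorem tau_C_eq_opMap (hx : IsFedosovElement b r s nab Om x) (a : TensorAlgebra R (U R g)) :
    tau b (tensorAction R g) r s nab x (PowerSeries.C a) =
      opMap (orbit (tensorAction R g) a ∘ₗ projOne)
        (tau b (tensorAction R g) r s nab x (oneT R g)) := by
  refine tau_map _ hx (fun X a' => ?_) fun m => ?_
  · have h : projOne ((tensorAction R g).act X a') =
        UniversalEnvelopingAlgebra.ι R X * projOne a' := (projOne_der (leftMul R X) a').2
    rw [LinearMap.comp_apply, LinearMap.comp_apply, h, orbit_apply, map_mul,
      Module.End.mul_apply, envAct_ι, orbit_apply]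
  · rw [oneT, PowerSeries.coeff_C, PowerSeries.coeff_C]
    split_ifs
    · rw [LinearMap.comp_apply, projOne_ι, orbit_apply, map_one]; rfl
    · rw [map_zero]

/-- The universal deformation formula is determined by the twist. -/
theorem coeff_star_C (hx : IsFedosovElement b r s nab Om x) (a a' : TensorAlgebra R (U R g))
    (m : ℕ) : PowerSeries.coeff m (star b (tensorAction R g) r s nab x (PowerSeries.C a)
      (PowerSeries.C a')) =
      pairing (tensorAction R g) a a' (PowerSeries.coeff m (twist b r s nab x)) := by
  rw [star_eq, ← starB_mul, tau_C_eq_opMap hx a, tau_C_eq_opMap hx a', starB_opMap, twist,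
    PowerSeries.coeff_mk, map_starB]
  rfl

theorem tensorTwo_coeff_twist (hx : IsFedosovElement b r s nab Om x) (m : ℕ) :
    tensorTwo R g (PowerSeries.coeff m (twist b r s nab x)) =
      PowerSeries.coeff m (star b (tensorAction R g) r s nab x (oneT R g) (oneT R g)) := by
  rw [oneT, coeff_star_C hx, pairing_one_one]

theorem twist_cocycle (hr : IsNondegRMatrix b r) (hs : IsSymm s)
    (hnab : IsSymplecticTorsionFree b r nab) (hnabs : IsCovConst nab s)
    (hOm : IsClosedSeries b Om) (hx : IsFedosovElement b r s nab Om x) :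
    ext (comulLeft R g) (twist b r s nab x) * ext (tensorOne R g) (twist b r s nab x)
      = ext (comulRight R g) (twist b r s nab x) * ext (oneTensor R g) (twist b r s nab x) := by
  refine PowerSeries.ext fun m => tensorThree_injective ?_
  have h := congrArg (PowerSeries.coeff m)
    (star_assoc (tensorAction R g) hr hs hnab hnabs hOm hx (oneT R g) (oneT R g) (oneT R g))
  -- The inner product is a series in `t`, whereas `coeff_star_C` treats constant arguments;
  -- linearity in `t` expands it.
  rw [coeff_star_left _ hx, coeff_star_right _ hx] at h
  simp only [← tensorTwo_coeff_twist hx] at h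
  simp only [oneT, coeff_star_C hx, pairing_tensorTwo_left, pairing_tensorTwo_right] at h
  rw [PowerSeries.coeff_mul, PowerSeries.coeff_mul, map_sum, map_sum]
  -- In `h` the inner star product carries the first index, in the product of series the outer one
  -- does.
  refine (Finset.Nat.sum_antidiagonal_swap
    (f := fun q => tensorThree (comulLeft R g (PowerSeries.coeff q.1 (twist b r s nab x)) *
      tensorOne R g (PowerSeries.coeff q.2 (twist b r s nab x))))).symm.trans (h.trans ?_)
  exact Finset.Nat.sum_antidiagonal_swap
    (f := fun q => tensorThree (comulRight R g (PowerSeries.coeff q.1 (twist b r s nab x)) *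
      oneTensor R g (PowerSeries.coeff q.2 (twist b r s nab x))))

theorem twist_counit_left (hx : IsFedosovElement b r s nab Om x) :
    ext (counitLeft R g) (twist b r s nab x) = 1 := by
  refine PowerSeries.ext fun m => ?_
  have h := congrArg (PowerSeries.coeff m) (star_one_left (tensorAction R g) hx (oneT R g))
  -- Here `1` is the unit of the tensor algebra, in tensor degree zero, which is neutral for `⋆`;
  -- `oneT` is the unit of `U(g)` in degree one.
  rw [← map_one (PowerSeries.C (R := TensorAlgebra R (U R g)))] at h
  rw [oneT, coeff_star_C hx, pairing_unit_left] at h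
  have h' := congrArg projOne h
  rw [projOne_ι] at h'
  refine h'.trans ?_
  rw [PowerSeries.coeff_C, PowerSeries.coeff_one]
  split_ifs
  · exact projOne_ι _
  · exact map_zero _

theorem twist_counit_right (hx : IsFedosovElement b r s nab Om x) :
    ext (counitRight R g) (twist b r s nab x) = 1 := by
  refine PowerSeries.ext fun m => ?_
  have h := congrArg (PowerSeries.coeff m) (star_one_right (tensorAction R g) hx (oneT R g))
  rw [← map_one (PowerSeries.C (R := TensorAlgebra R (U R g)))] at h
  rw [oneT, coeff_star_C hx, pairing_unit_right] at h
  have h' := congrArg projOne h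
  rw [projOne_ι] at h'
  refine h'.trans ?_
  rw [PowerSeries.coeff_C, PowerSeries.coeff_one]
  split_ifs
  · exact projOne_ι _
  · exact map_zero _

theorem coeff_zero_twist (hx : IsFedosovElement b r s nab Om x) :
    PowerSeries.coeff 0 (twist b r s nab x) = (1 : U R g) ⊗ₜ[R] (1 : U R g) := by
  have h : wt R 0 = 1 := by simp [wt]
  rw [twist, PowerSeries.coeff_mk, starB, zero_add, Finset.sum_range_one, h, one_smul, moyalB,
    Nat.sub_self, Finset.HasAntidiagonal.antidiagonal_zero, Finset.sum_singleton, sigma_tau _ hx,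
    oneT,
    PowerSeries.coeff_zero_C, tensorProj_ι]

theorem coeff_one_twist (hx : IsFedosovElement b r s nab Om x) :
    PowerSeries.coeff 1 (twist b r s nab x) = rat R (1 / 2) • gg (r + s) := by
  have h : wt R 1 = rat R (1 / 2) := by simp [wt]
  rw [twist, PowerSeries.coeff_mk, starB, Finset.sum_range_succ, Finset.sum_range_one]
  -- The undeformed term involves only `σ(τ(1)) = 1`, constant in `t`, and so does not contribute to
  -- first order.
  have h0 : moyalB (coords b (r + s)) tensorProj 0
      (tau b (tensorAction R g) r s nab x (oneT R g))
      (tau b (tensorAction R g) r s nab x (oneT R g)) 1 = 0 := by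
    rw [moyalB, sigma_tau _ hx, oneT]
    refine Finset.sum_eq_zero fun q hq => ?_
    rw [Finset.HasAntidiagonal.mem_antidiagonal] at hq
    rcases Nat.eq_zero_or_pos q.1 with h1 | h1
    · rw [PowerSeries.coeff_C (q.2), if_neg (by omega), map_zero]
    · rw [PowerSeries.coeff_C (q.1), if_neg (by omega), map_zero, LinearMap.zero_apply]
  rw [Nat.sub_zero, h0, smul_zero, zero_add, h, Nat.sub_self, moyalB]
  simp only [moyalB, Finset.HasAntidiagonal.antidiagonal_zero, Finset.sum_singleton, oneT,
    coeff_sigma_opD_tau _ hx, act_ι, mul_one, tensorProj_ι]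
  conv_rhs => rw [tensor_eq_sum b (r + s)]
  simp only [gg, map_sum, map_smul, TensorProduct.map_tmul]
  rfl

theorem isTwist_twist (hr : IsNondegRMatrix b r) (hs : IsSymm s)
    (hnab : IsSymplecticTorsionFree b r nab) (hnabs : IsCovConst nab s)
    (hOm : IsClosedSeries b Om) (hx : IsFedosovElement b r s nab Om x) :
    IsTwist (twist b r s nab x) where
  isUnit := by
    -- A series whose constant term is a unit has a two-sided inverse, even with noncommutative
    -- coefficients.
    have h : PowerSeries.constantCoeff (twist b r s nab x) =
        ((1 : (U R g ⊗[R] U R g)ˣ) : U R g ⊗[R] U R g) :=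
      (PowerSeries.coeff_zero_eq_constantCoeff_apply _).symm.trans (coeff_zero_twist hx)
    exact ⟨⟨_, _, PowerSeries.mul_invOfUnit _ _ h, PowerSeries.invOfUnit_mul _ _ h⟩, rfl⟩
  cocycle := twist_cocycle hr hs hnab hnabs hOm hx
  counit_left := twist_counit_left hx
  counit_right := twist_counit_right hx
  coeff_zero := coeff_zero_twist hx

end Twist

end Fedosov

end

theorem mainTheorem2 {R g : Type*} [CommRing R] [Algebra ℚ R] [LieRing g] [LieAlgebra R g]
    {n : ℕ} (b : Module.Basis (Fin n) R g)
    (r : g ⊗[R] g) (hr : Fedosov.IsNondegRMatrix b r)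
    (s : g ⊗[R] g) (hs : Fedosov.IsSymm s)
    (nab : g →ₗ[R] g →ₗ[R] g) (hnab : Fedosov.IsSymplecticTorsionFree b r nab)
    (hnabs : Fedosov.IsCovConst nab s)
    (Om : PowerSeries (Fedosov.Forms R g)) (hOm : Fedosov.IsClosedSeries b Om) :
    ∃ x : Fedosov.Fed R g n R,
      Fedosov.IsFedosovElement b r s nab Om x ∧
      (∀ x', Fedosov.IsFedosovElement b r s nab Om x' → x' = x) ∧
      ∃ F : PowerSeries (Fedosov.U R g ⊗[R] Fedosov.U R g),
        (∀ m, Fedosov.tensorTwo R g (PowerSeries.coeff m F) =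
          PowerSeries.coeff m (Fedosov.star b (Fedosov.tensorAction R g) r s nab x
            (Fedosov.oneT R g) (Fedosov.oneT R g))) ∧
        Fedosov.IsTwist F ∧
        PowerSeries.coeff 0 F = (1 : Fedosov.U R g) ⊗ₜ[R] (1 : Fedosov.U R g) ∧
        PowerSeries.coeff 1 F = Fedosov.rat R (1 / 2) • Fedosov.gg (r + s) := by
  obtain ⟨x, hx⟩ := Fedosov.exists_fedosovElement hr hs hnab hnabs hOm
  exact ⟨x, hx, fun x' hx' => hx.unique hx', Fedosov.twist b r s nab x,
    Fedosov.tensorTwo_coeff_twist hx, Fedosov.isTwist_twist hr hs hnab hnabs hOm hx,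
    Fedosov.coeff_zero_twist hx, Fedosov.coeff_one_twist hx⟩
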